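/- An element of $\mathrm{SO}_n$ is called a rotation if its fixed point subspace has codimension two; a rotation group is a finite subgroup of $\mathrm{SO}_n$ generated by rotations. A subgroup $G$ is imprimitive if $\mathbb{R}^n$ is a direct sum of nonzero proper subspaces $V_1,\dots,V_l$ such that for all $g\in G$ and all $i$ there is a $j$ with $g(V_i)=V_j$; otherwise $G$ is primitive. Let $W(I_2(4))<\mathrm{O}_2$ be the dihedral group of order $8$ generated by the reflections $\mathrm{diag}(1,-1)$ and $e_1\leftrightarrow e_2$. Let $H=W(I_2(4))\otimes W(I_2(4))\otimes W(I_2(4))<\mathrm{SO}_8$, acting on $\mathbb{R}^8=\mathbb{R}^2\otimes\mathbb{R}^2\otimes\mathbb{R}^2$, and let $N=N_{\mathrm{SO}_8}(H)$ be its normalizer. The group $H/\{\pm1\}$ is a vector space over $\mathbb{F}_2$ with a nondegenerate quadratic form $Q$, where $Q(\{\pm h\})=0$ if $h^2=1$ and $Q(\{\pm h\})=1$ if $h^2=-1$, and $N$ acts on it by conjugation. Let $O^+(Q)$ be the subgroup of the orthogonal group $O(Q)$ of elements with Dickson invariant $0$, i.e. of those $g\in O(Q)$ for which $g-1$ has even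 rank, and let $L$ be the preimage of $O^+(Q)$ in $N$. Lemma. The only primitive rotation group $G$ with $H<G\le N$ is the group $L$. That is, for every subgroup $G$ of $\mathrm{SO}_8$: $G$ is a primitive rotation group with $H<G\le N$ if and only if $G=L$. -/

import Mathlib

open Module Matrix
open scoped Kronecker

namespace RotationGroup

/-! ### Rotation groups and primitive groups -/

section General

variable {n : Type} [Fintype n] [DecidableEq n]

/-- A rotation (orthogonal pseudoreflection): its fixed point subspace has codimension two. -/
def IsRotation (g : Matrix.specialOrthogonalGroup n ℝ) : Prop :=
  finrank ℝ (LinearMap.ker (Matrix.toLin' g.1 - LinearMap.id)) + 2 = Fintype.card n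

/-- A rotation group: a finite group generated by rotations. -/
def IsRotationGroup (G : Subgroup (Matrix.specialOrthogonalGroup n ℝ)) : Prop :=
  Finite G ∧ Subgroup.closure {g | g ∈ G ∧ IsRotation g} = G

/-- `G` is imprimitive: the space is the (internal) direct sum of nonzero proper subspaces
`V 0, …, V (l - 1)`, each of which is carried onto one of them by every element of `G`. -/
def IsImprimitive (G : Subgroup (Matrix.specialOrthogonalGroup n ℝ)) : Prop :=
  ∃ (l : ℕ) (V : Fin l → Submodule ℝ (n → ℝ)),
    DirectSum.IsInternal V ∧ (∀ i, V i ≠ ⊥ ∧ V i ≠ ⊤) ∧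
      ∀ g ∈ G, ∀ i, ∃ j, (V i).map (Matrix.toLin' g.1) = V j

/-- A group is primitive if it is not imprimitive. -/
def IsPrimitive (G : Subgroup (Matrix.specialOrthogonalGroup n ℝ)) : Prop :=
  ¬ IsImprimitive G

end General

/-! ### Isometries of a quadratic form over the field with two elements, Dickson invariant -/

/-- An alternating bilinear form has even rank. -/
theorem exists_finrank_eq_finrank_ker_add {K : Type*} [Field K] :
    ∀ (n : ℕ) {V : Type _} [AddCommGroup V] [Module K V] [FiniteDimensional K V]
      (B : LinearMap.BilinForm K V), B.IsAlt → finrank K V = n →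
      ∃ k : ℕ, finrank K V = finrank K (LinearMap.ker B) + 2 * k := by
  intro n
  induction n using Nat.strong_induction_on with
  | _ n ih =>
    intro V _ _ _ B hB hn
    by_cases h0 : B = 0
    · refine ⟨0, ?_⟩
      subst h0
      rw [LinearMap.ker_zero, finrank_top]
      rfl
    · obtain ⟨u, v, huv⟩ : ∃ u v, B u v ≠ 0 := by
        by_contra! hc
        exact h0 (LinearMap.ext fun u => LinearMap.ext fun v => hc u v)
      have hvu : B v u ≠ 0 := fun h => huv ((LinearMap.BilinForm.IsAlt.eq_iff hB).2 h)
      let f : V →ₗ[K] K × K := (B u).prod (B v)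
      have hfapp : ∀ y, f y = (B u y, B v y) := fun _ => rfl
      have huu : B u u = 0 := hB u
      have hvv : B v v = 0 := hB v
      have key : ∀ y : V, y - (B v y / B v u) • u - (B u y / B u v) • v ∈ LinearMap.ker f := by
        intro y
        rw [LinearMap.mem_ker, hfapp]
        simp only [map_sub, map_smul, huu, hvv, smul_eq_mul, Prod.mk_eq_zero]
        constructor <;> field_simp <;> ring
      have hf : LinearMap.range f = ⊤ := by
        rw [LinearMap.range_eq_top]
        rintro ⟨a, b⟩
        refine ⟨(b / B v u) • u + (a / B u v) • v, ?_⟩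
        rw [hfapp]
        simp only [map_add, map_smul, huu, hvv, smul_eq_mul, Prod.mk.injEq]
        constructor <;> field_simp <;> ring
      have hdim := LinearMap.finrank_range_add_finrank_ker f
      rw [hf, finrank_top, finrank_prod, finrank_self] at hdim
      let B' : LinearMap.BilinForm K (LinearMap.ker f) :=
        LinearMap.BilinForm.restrict B (LinearMap.ker f)
      have hB' : B'.IsAlt := fun x => hB x
      obtain ⟨k, hk⟩ := ih (finrank K (LinearMap.ker f)) (by omega) B' hB' rfl
      have hker : (LinearMap.ker B').map (LinearMap.ker f).subtype = LinearMap.ker B := by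
        ext x
        simp only [Submodule.mem_map, LinearMap.mem_ker, Submodule.subtype_apply]
        constructor
        · rintro ⟨⟨x, hx⟩, hx', rfl⟩
          have hx1 : B u x = 0 ∧ B v x = 0 := by
            simpa [f] using hx
          have e1 : B x u = 0 := (LinearMap.BilinForm.IsAlt.eq_iff hB).2 hx1.1
          have e2 : B x v = 0 := (LinearMap.BilinForm.IsAlt.eq_iff hB).2 hx1.2
          ext y
          have := LinearMap.congr_fun hx' ⟨_, key y⟩
          have h3 : B x (y - (B v y / B v u) • u - (B u y / B u v) • v) = 0 := this
          simpa [e1, e2] using h3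
        · intro hx
          have hxf : x ∈ LinearMap.ker f := by
            have e1 : B u x = 0 := (LinearMap.BilinForm.IsAlt.eq_iff hB).2 (by simp [hx])
            have e2 : B v x = 0 := (LinearMap.BilinForm.IsAlt.eq_iff hB).2 (by simp [hx])
            simp [f, e1, e2]
          refine ⟨⟨x, hxf⟩, ?_, rfl⟩
          ext y
          change B x y = 0
          simp [hx]
      have hk2 : finrank K (LinearMap.ker B') = finrank K (LinearMap.ker B) := by
        rw [← hker]
        exact (Submodule.finrank_map_subtype_eq _ _).symm
      exact ⟨k + 1, by omega⟩

section Dickson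

variable {V : Type*} [AddCommGroup V] [Module (ZMod 2) V]

/-- The orthogonal group `O(Q)`: the linear automorphisms preserving `Q`. -/
def IsometryGroup (Q : QuadraticForm (ZMod 2) V) : Subgroup (V ≃ₗ[ZMod 2] V) where
  carrier := {g | ∀ v, Q (g v) = Q v}
  one_mem' _ := rfl
  mul_mem' {g h} hg hh v := by
    change Q (g (h v)) = Q v
    rw [hg, hh]
  inv_mem' {g} hg v := by
    have := hg (g⁻¹ v)
    rw [← this]
    congr 1
    exact g.apply_symm_apply v

/-- The Dickson invariant of `g ∈ O(Q)`: the rank of `g - 1`, modulo two. -/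
noncomputable def dicksonInvariant (g : V ≃ₗ[ZMod 2] V) : ZMod 2 :=
  (finrank (ZMod 2) (LinearMap.range ((g : V →ₗ[ZMod 2] V) - LinearMap.id)) : ℕ)

/-- On `O(Q)`, with `Q` nondegenerate, the Dickson invariant is multiplicative. -/
theorem dicksonInvariant_inv_mul [FiniteDimensional (ZMod 2) V] (Q : QuadraticForm (ZMod 2) V)
    (hQ : Q.polarBilin.Nondegenerate) {g h : V ≃ₗ[ZMod 2] V}
    (hg : g ∈ IsometryGroup Q) (hh : h ∈ IsometryGroup Q) :
    dicksonInvariant (h⁻¹ * g) = dicksonInvariant g + dicksonInvariant h := by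
  have two : ∀ x : V, x + x = 0 := fun x => by
    rw [← two_smul (ZMod 2) x]
    exact zero_smul _ x
  have neg : ∀ x : V, -x = x := fun x => neg_eq_of_add_eq_zero_left (two x)
  have two' : ∀ x : ZMod 2, x + x = 0 := by decide
  have neg' : ∀ x : ZMod 2, -x = x := by decide
  set B : LinearMap.BilinForm (ZMod 2) V := Q.polarBilin with hB
  have Bapp : ∀ x y, B x y = Q (x + y) - Q x - Q y := fun _ _ => rfl
  have Balt : B.IsAlt := fun x => by
    rw [Bapp, two, QuadraticMap.map_zero, sub_sub, two', sub_zero]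
  have Brefl : B.IsRefl := Balt.isRefl
  have Binv : ∀ k ∈ IsometryGroup Q, ∀ x y, B (k x) (k y) = B x y := by
    intro k hk x y
    rw [Bapp, Bapp, ← map_add, hk, hk, hk]
  have Bself : ∀ k ∈ IsometryGroup Q, ∀ x, B x (k x - x) = Q (k x - x) := by
    intro k hk x
    have e : k x - x = k x + x := by rw [sub_eq_add_neg, neg]
    rw [map_sub, Balt x, sub_zero, Bapp, hk, sub_sub, two', sub_zero, e, add_comm]
  let S : (V ≃ₗ[ZMod 2] V) → (V →ₗ[ZMod 2] V) := fun k => (k : V →ₗ[ZMod 2] V) - LinearMap.id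
  have Sapp : ∀ k x, S k x = k x - x := fun _ _ => rfl
  have orth : ∀ k ∈ IsometryGroup Q, B.orthogonal (LinearMap.range (S k)) = LinearMap.ker (S k) := by
    intro k hk
    ext x
    rw [LinearMap.BilinForm.mem_orthogonal_iff, LinearMap.mem_ker, Sapp]
    constructor
    · intro hx
      have : B (k x - x) = 0 := by
        refine LinearMap.ext fun y => ?_
        obtain ⟨z, rfl⟩ := k.surjective y
        rw [LinearMap.zero_apply, Brefl.eq_iff]
        have h1 := hx (S k z) ⟨z, rfl⟩
        rw [Sapp, map_sub, LinearMap.sub_apply] at h1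
        rw [map_sub, Binv k hk, ← neg' (_ - _), neg_sub]
        exact h1
      exact hQ.1 _ fun y => LinearMap.congr_fun this y
    · rintro hx _ ⟨z, rfl⟩
      have e : B (k z) x = B z x := by
        nth_rewrite 1 [← sub_eq_zero.1 hx]
        exact Binv k hk z x
      rw [Sapp, map_sub, LinearMap.sub_apply, e, sub_self]
  have dbl : ∀ W : Submodule (ZMod 2) V, B.orthogonal (B.orthogonal W) = W :=
    LinearMap.BilinForm.orthogonal_orthogonal hQ Brefl
  have orth_sup : ∀ W W' : Submodule (ZMod 2) V,
      B.orthogonal (W ⊔ W') = B.orthogonal W ⊓ B.orthogonal W' := by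
    intro W W'
    apply le_antisymm
    · exact le_inf (LinearMap.BilinForm.orthogonal_le le_sup_left)
        (LinearMap.BilinForm.orthogonal_le le_sup_right)
    · rintro x ⟨h1, h2⟩ y hy
      obtain ⟨a, ha, b, hb, rfl⟩ := Submodule.mem_sup.1 hy
      have e1 : B a x = 0 := h1 a ha
      have e2 : B b x = 0 := h2 b hb
      change B (a + b) x = 0
      rw [map_add, LinearMap.add_apply, e1, e2, add_zero]
  have orth_inf : B.orthogonal (LinearMap.range (S g) ⊓ LinearMap.range (S h)) =
      LinearMap.ker (S g) ⊔ LinearMap.ker (S h) := by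
    rw [← dbl (LinearMap.range (S g)), ← dbl (LinearMap.range (S h)), orth g hg, orth h hh,
      ← orth_sup, dbl]
  set f : V × V →ₗ[ZMod 2] V := (S g).coprod (S h) with hf
  have fapp : ∀ a b, f (a, b) = S g a + S h b := fun a b => by simp [hf]
  let β : LinearMap.BilinForm (ZMod 2) (LinearMap.ker f) :=
    LinearMap.BilinForm.restrict
      (B.compl₁₂ (LinearMap.fst (ZMod 2) V V + LinearMap.snd (ZMod 2) V V)
        (S g ∘ₗ LinearMap.fst (ZMod 2) V V)) (LinearMap.ker f)
  have βapp : ∀ x y, β x y = B (x.1.1 + x.1.2) (S g y.1.1) := fun _ _ => rfl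
  have memW : ∀ a b, (a, b) ∈ LinearMap.ker f ↔ S g a = S h b := fun a b => by
    rw [LinearMap.mem_ker, fapp, add_eq_zero_iff_eq_neg, neg]
  have βalt : β.IsAlt := by
    rintro ⟨⟨a, b⟩, hab⟩
    rw [memW] at hab
    rw [βapp]
    change B (a + b) (S g a) = 0
    rw [map_add, LinearMap.add_apply]
    nth_rewrite 2 [hab]
    rw [Sapp, Sapp, Bself g hg, Bself h hh, ← Sapp, ← Sapp, hab, two']
  obtain ⟨k, hk⟩ := exists_finrank_eq_finrank_ker_add _ β βalt rfl
  let D : V →ₗ[ZMod 2] V × V := LinearMap.id.prod LinearMap.id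
  have Dapp : ∀ x, D x = (x, x) := fun _ => rfl
  have Dinj : Function.Injective D := fun x y hxy => congrArg Prod.fst hxy
  let T : V →ₗ[ZMod 2] V := (g : V →ₗ[ZMod 2] V) - (h : V →ₗ[ZMod 2] V)
  have Tapp : ∀ x, T x = g x - h x := fun _ => rfl
  have Rad : (LinearMap.ker β).map (LinearMap.ker f).subtype =
      (LinearMap.ker (S g)).prod (LinearMap.ker (S h)) ⊔ (LinearMap.ker T).map D := by
    apply le_antisymm
    · rintro _ ⟨⟨⟨a, b⟩, hab⟩, hx, rfl⟩
      have h1 : a + b ∈ LinearMap.ker (S g) ⊔ LinearMap.ker (S h) := by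
        rw [← orth_inf]
        rintro _ ⟨⟨a', rfl⟩, ⟨b', hb'⟩⟩
        have := LinearMap.congr_fun hx ⟨(a', b'), (memW a' b').2 hb'.symm⟩
        exact Brefl.eq_iff.1 this
      obtain ⟨p, hp, q, hq, hpq⟩ := Submodule.mem_sup.1 h1
      have hc : a - p = b - q := by
        have : a - p = -(b - q) := by
          rw [← add_eq_zero_iff_eq_neg]
          rw [show a - p + (b - q) = (a + b) - (p + q) by abel, hpq, sub_self]
        rw [this, neg]
      refine Submodule.mem_sup.2 ⟨(p, q), ⟨hp, hq⟩, (a - p, a - p), ⟨a - p, ?_, rfl⟩, ?_⟩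
      · have h2 : S g (a - p) = S h (a - p) := by
          nth_rewrite 2 [hc]
          rw [map_sub, map_sub, LinearMap.mem_ker.1 hp, LinearMap.mem_ker.1 hq, sub_zero, sub_zero]
          exact (memW a b).1 hab
        rw [Sapp, Sapp] at h2
        change T (a - p) = 0
        rw [Tapp, sub_left_inj.1 h2, sub_self]
      · nth_rewrite 2 [hc]
        simp
    · refine sup_le ?_ ?_
      · rintro ⟨p, q⟩ ⟨hp, hq⟩
        refine ⟨⟨(p, q), (memW p q).2 (hp.trans hq.symm)⟩, ?_, rfl⟩
        change β _ = 0
        ext ⟨⟨a, b⟩, hab⟩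
        rw [memW] at hab
        change B (p + q) (S g a) = 0
        have e1 : B p (S g a) = 0 := by
          rw [Brefl.eq_iff]
          have : p ∈ B.orthogonal (LinearMap.range (S g)) := by rw [orth g hg]; exact hp
          exact this _ ⟨a, rfl⟩
        have e2 : B q (S h b) = 0 := by
          rw [Brefl.eq_iff]
          have : q ∈ B.orthogonal (LinearMap.range (S h)) := by rw [orth h hh]; exact hq
          exact this _ ⟨b, rfl⟩
        rw [map_add, LinearMap.add_apply, e1, hab, e2, add_zero]
      · rintro _ ⟨c, hc, rfl⟩
        have hc' : g c = h c := sub_eq_zero.1 hc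
        refine ⟨⟨(c, c), (memW c c).2 (by rw [Sapp, Sapp, hc'])⟩, ?_, rfl⟩
        change β _ = 0
        ext ⟨⟨a, b⟩, hab⟩
        change B (c + c) (S g a) = 0
        rw [two, map_zero, LinearMap.zero_apply]
  have Inf : (LinearMap.ker (S g)).prod (LinearMap.ker (S h)) ⊓ (LinearMap.ker T).map D =
      (LinearMap.ker (S g) ⊓ LinearMap.ker (S h)).map D := by
    ext ⟨x, y⟩
    constructor
    · rintro ⟨⟨hx, hy⟩, c, hc, hcd⟩
      obtain ⟨rfl, rfl⟩ := Prod.ext_iff.1 hcd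
      exact ⟨c, ⟨hx, hy⟩, rfl⟩
    · rintro ⟨c, ⟨hx, hy⟩, hcd⟩
      obtain ⟨rfl, rfl⟩ := Prod.ext_iff.1 hcd
      refine ⟨⟨hx, hy⟩, c, ?_, rfl⟩
      have h1 : g c - c = 0 := hx
      have h2 : h c - c = 0 := hy
      change g c - h c = 0
      rw [sub_eq_zero.1 h1, sub_eq_zero.1 h2, sub_self]
  have d1 : finrank (ZMod 2) (LinearMap.ker β) = finrank (ZMod 2)
      ↥((LinearMap.ker (S g)).prod (LinearMap.ker (S h)) ⊔ (LinearMap.ker T).map D) := by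
    rw [← Rad, Submodule.finrank_map_subtype_eq]
  have d2 := Submodule.finrank_sup_add_finrank_inf_eq
    ((LinearMap.ker (S g)).prod (LinearMap.ker (S h))) ((LinearMap.ker T).map D)
  have map_D : ∀ W : Submodule (ZMod 2) V,
      finrank (ZMod 2) (W.map D) = finrank (ZMod 2) W := fun W =>
    (Submodule.equivMapOfInjective D Dinj W).finrank_eq.symm
  have d3 : finrank (ZMod 2) ((LinearMap.ker (S g)).prod (LinearMap.ker (S h))) =
      finrank (ZMod 2) (LinearMap.ker (S g)) + finrank (ZMod 2) (LinearMap.ker (S h)) := by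
    rw [← finrank_prod]
    exact LinearEquiv.finrank_eq
      { toFun := fun x => (⟨x.1.1, x.2.1⟩, ⟨x.1.2, x.2.2⟩)
        map_add' := fun _ _ => rfl
        map_smul' := fun _ _ => rfl
        invFun := fun x => ⟨(x.1.1, x.2.1), x.1.2, x.2.2⟩
        left_inv := fun _ => rfl
        right_inv := fun _ => rfl }
  rw [Inf, map_D, map_D, d3] at d2
  have d4 := LinearMap.finrank_range_add_finrank_ker f
  rw [finrank_prod, hf, LinearMap.range_coprod, ← hf] at d4
  have d5 := LinearMap.BilinForm.finrank_orthogonal hQ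
    (LinearMap.range (S g) ⊔ LinearMap.range (S h))
  rw [orth_sup, orth g hg, orth h hh] at d5
  have d6 := Submodule.finrank_le (LinearMap.range (S g) ⊔ LinearMap.range (S h))
  have d7 := LinearMap.finrank_range_add_finrank_ker (S g)
  have d8 := LinearMap.finrank_range_add_finrank_ker (S h)
  have d9 := LinearMap.finrank_range_add_finrank_ker T
  have d10 : finrank (ZMod 2) (LinearMap.range (S (h⁻¹ * g))) =
      finrank (ZMod 2) (LinearMap.range T) := by
    have : T = (h : V →ₗ[ZMod 2] V) ∘ₗ S (h⁻¹ * g) := by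
      refine LinearMap.ext fun x => ?_
      have e : h ((h⁻¹ * g) x) = g x := h.apply_symm_apply (g x)
      change g x - h x = h ((h⁻¹ * g) x - x)
      rw [map_sub, e]
    rw [this, LinearMap.range_comp]
    exact (LinearEquiv.finrank_map_eq h _).symm
  change ((finrank (ZMod 2) (LinearMap.range (S (h⁻¹ * g))) : ℕ) : ZMod 2) =
    (finrank (ZMod 2) (LinearMap.range (S g)) : ℕ) + (finrank (ZMod 2) (LinearMap.range (S h)) : ℕ)
  rw [d10, ← Nat.cast_add, ZMod.natCast_eq_natCast_iff]
  change _ % 2 = _ % 2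
  omega

theorem dicksonInvariant_one : dicksonInvariant (1 : V ≃ₗ[ZMod 2] V) = 0 := by
  have : (((1 : V ≃ₗ[ZMod 2] V) : V →ₗ[ZMod 2] V) - LinearMap.id) = 0 := by
    ext x
    exact sub_self x
  rw [dicksonInvariant, this, LinearMap.range_zero, finrank_bot, Nat.cast_zero]

/-- `O⁺(Q)`: the elements of `O(Q)` whose Dickson invariant is `0`. -/
def SpecialIsometryGroup [FiniteDimensional (ZMod 2) V] (Q : QuadraticForm (ZMod 2) V)
    (hQ : Q.polarBilin.Nondegenerate) : Subgroup (V ≃ₗ[ZMod 2] V) where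
  carrier := {g | g ∈ IsometryGroup Q ∧ dicksonInvariant g = 0}
  one_mem' := ⟨one_mem _, dicksonInvariant_one⟩
  inv_mem' {g} hg := by
    refine ⟨inv_mem hg.1, ?_⟩
    have := dicksonInvariant_inv_mul Q hQ (one_mem (IsometryGroup Q)) hg.1
    rwa [mul_one, dicksonInvariant_one, zero_add, hg.2] at this
  mul_mem' {g h} hg hh := by
    refine ⟨mul_mem hg.1 hh.1, ?_⟩
    have h1 := dicksonInvariant_inv_mul Q hQ (one_mem (IsometryGroup Q)) hg.1
    rw [mul_one, dicksonInvariant_one, zero_add, hg.2] at h1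
    have h2 := dicksonInvariant_inv_mul Q hQ hh.1 (inv_mem hg.1)
    rwa [inv_inv, h1, hh.2, add_zero] at h2
end Dickson

/-! ### The group `H`, its normalizer `N` and the quotient `H / {±1}` -/

/-- `SO₈`, acting on `ℝ⁸ = ℝ² ⊗ ℝ² ⊗ ℝ²` in the basis `e_i ⊗ e_j ⊗ e_k`. -/
abbrev SO8 : Type := Matrix.specialOrthogonalGroup (Fin 2 × Fin 2 × Fin 2) ℝ

/-- The reflection `e₁ ↦ e₁`, `e₂ ↦ -e₂`. -/
def refl₁ : Matrix.orthogonalGroup (Fin 2) ℝ :=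
  ⟨!![1, 0; 0, -1], by
    rw [Matrix.mem_orthogonalGroup_iff]
    ext i j; fin_cases i <;> fin_cases j <;>
      simp [Matrix.mul_apply, Fin.sum_univ_two, Matrix.transpose_apply]⟩

/-- The reflection interchanging `e₁` and `e₂`. -/
def refl₂ : Matrix.orthogonalGroup (Fin 2) ℝ :=
  ⟨!![0, 1; 1, 0], by
    rw [Matrix.mem_orthogonalGroup_iff]
    ext i j; fin_cases i <;> fin_cases j <;>
      simp [Matrix.mul_apply, Fin.sum_univ_two, Matrix.transpose_apply]⟩

/-- The reflection group `W(I₂(4)) < O₂`, dihedral of order `8`; it is generated by two reflections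
in lines at an angle of `π / 4`. -/
def WI24 : Subgroup (Matrix.orthogonalGroup (Fin 2) ℝ) := Subgroup.closure {refl₁, refl₂}

/-- The tensor product `(a, b, c) ↦ a ⊗ b ⊗ c` of three orthogonal transformations of `ℝ²`. -/
def tensorHom : Matrix.orthogonalGroup (Fin 2) ℝ × Matrix.orthogonalGroup (Fin 2) ℝ ×
    Matrix.orthogonalGroup (Fin 2) ℝ →* SO8 where
  toFun w := ⟨w.1.1 ⊗ₖ (w.2.1.1 ⊗ₖ w.2.2.1), by
    rw [Matrix.mem_specialOrthogonalGroup_iff]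
    refine ⟨Matrix.kronecker_mem_unitary w.1.2 (Matrix.kronecker_mem_unitary w.2.1.2 w.2.2.2), ?_⟩
    have h : ∀ u : Matrix.orthogonalGroup (Fin 2) ℝ, u.1.det ^ 4 = 1 := fun u => by
      have := congrArg Matrix.det ((Matrix.mem_orthogonalGroup_iff _ _).1 u.2)
      rw [Matrix.det_mul, Matrix.det_transpose, Matrix.det_one] at this
      nlinarith
    simp only [Matrix.det_kronecker, Fintype.card_prod, Fintype.card_fin, mul_pow, ← pow_mul]
    norm_num [h]⟩
  map_one' := Subtype.ext (by simp)
  map_mul' u v := Subtype.ext (by simp [Matrix.mul_kronecker_mul])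

theorem WI24_form {w : Matrix.orthogonalGroup (Fin 2) ℝ} (hw : w ∈ WI24) :
    ∃ a b : ℝ, (a = 1 ∨ a = -1) ∧ (b = 1 ∨ b = -1) ∧
      (w.1 = !![a, 0; 0, b] ∨ w.1 = !![0, a; b, 0]) := by
  induction hw using Subgroup.closure_induction with
  | mem x hx =>
    rcases hx with rfl | rfl
    · exact ⟨1, -1, by simp, by simp, Or.inl rfl⟩
    · exact ⟨1, 1, by simp, by simp, Or.inr rfl⟩
  | one => exact ⟨1, 1, by simp, by simp, Or.inl Matrix.one_fin_two⟩
  | mul x y _ _ hx hy =>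
    obtain ⟨a, b, ha, hb, h⟩ := hx
    obtain ⟨c, d, hc, hd, h'⟩ := hy
    rcases h with h | h <;> rcases h' with h' | h'
    · refine ⟨a * c, b * d, ?_, ?_, Or.inl ?_⟩
      · rcases ha with rfl | rfl <;> rcases hc with rfl | rfl <;> simp
      · rcases hb with rfl | rfl <;> rcases hd with rfl | rfl <;> simp
      · change x.1 * y.1 = _
        rw [h, h']
        simp
    · refine ⟨a * c, b * d, ?_, ?_, Or.inr ?_⟩
      · rcases ha with rfl | rfl <;> rcases hc with rfl | rfl <;> simp
      · rcases hb with rfl | rfl <;> rcases hd with rfl | rfl <;> simp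
      · change x.1 * y.1 = _
        rw [h, h']
        simp
    · refine ⟨a * d, b * c, ?_, ?_, Or.inr ?_⟩
      · rcases ha with rfl | rfl <;> rcases hd with rfl | rfl <;> simp
      · rcases hb with rfl | rfl <;> rcases hc with rfl | rfl <;> simp
      · change x.1 * y.1 = _
        rw [h, h']
        simp
    · refine ⟨a * d, b * c, ?_, ?_, Or.inl ?_⟩
      · rcases ha with rfl | rfl <;> rcases hd with rfl | rfl <;> simp
      · rcases hb with rfl | rfl <;> rcases hc with rfl | rfl <;> simp
      · change x.1 * y.1 = _
        rw [h, h']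
        simp
  | inv x _ hx =>
    obtain ⟨a, b, ha, hb, h⟩ := hx
    have hinv : (x⁻¹).1 = x.1ᵀ := rfl
    rcases h with h | h
    · refine ⟨a, b, ha, hb, Or.inl ?_⟩
      rw [hinv, h]
      ext i j; fin_cases i <;> fin_cases j <;> simp
    · refine ⟨b, a, hb, ha, Or.inr ?_⟩
      rw [hinv, h]
      ext i j; fin_cases i <;> fin_cases j <;> simp

theorem WI24_sq {w : Matrix.orthogonalGroup (Fin 2) ℝ} (hw : w ∈ WI24) :
    w.1 * w.1 = 1 ∨ w.1 * w.1 = -1 := by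
  obtain ⟨a, b, ha, hb, h⟩ := WI24_form hw
  rcases h with h | h <;> rw [h, Matrix.mul_fin_two, Matrix.one_fin_two] <;>
    rcases ha with rfl | rfl <;> rcases hb with rfl | rfl <;> simp

theorem WI24_finite : (WI24 : Set (Matrix.orthogonalGroup (Fin 2) ℝ)).Finite := by
  have hS : ({1, -1} : Set ℝ).Finite := by simp
  have h1 := (hS.prod hS).image (fun p : ℝ × ℝ => !![p.1, 0; 0, p.2])
  have h2 := (hS.prod hS).image (fun p : ℝ × ℝ => !![0, p.1; p.2, 0])
  refine Set.Finite.subset ((h1.union h2).preimage (Subtype.val_injective.injOn)) ?_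
  intro w hw
  obtain ⟨a, b, ha, hb, h⟩ := WI24_form hw
  rcases h with h | h
  · exact Or.inl ⟨(a, b), ⟨ha, hb⟩, h.symm⟩
  · exact Or.inr ⟨(a, b), ⟨ha, hb⟩, h.symm⟩

/-- `H = W(I₂(4)) ⊗ W(I₂(4)) ⊗ W(I₂(4)) < SO₈`. -/
def H : Subgroup SO8 := (WI24.prod (WI24.prod WI24)).map tensorHom

theorem mem_H {h : SO8} : h ∈ H ↔ ∃ a ∈ WI24, ∃ b ∈ WI24, ∃ c ∈ WI24,
    h = tensorHom (a, b, c) := by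
  constructor
  · rintro ⟨⟨a, b, c⟩, ⟨ha, hb, hc⟩, rfl⟩
    exact ⟨a, ha, b, hb, c, hc, rfl⟩
  · rintro ⟨a, ha, b, hb, c, hc, rfl⟩
    exact ⟨(a, b, c), ⟨ha, hb, hc⟩, rfl⟩

instance : Finite H := by
  have : (H : Set SO8).Finite := by
    have h := (WI24_finite.prod (WI24_finite.prod WI24_finite)).image tensorHom
    refine h.subset ?_
    rintro _ ⟨⟨a, b, c⟩, ⟨ha, hb, hc⟩, rfl⟩
    exact ⟨(a, b, c), ⟨ha, hb, hc⟩, rfl⟩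
  exact this.to_subtype

/-- The normalizer `N` of `H` in `SO₈`. -/
abbrev N : Subgroup SO8 := Subgroup.normalizer (H : Set SO8)

/-- The matrix of an element of `H`. -/
abbrev mat (h : H) : Matrix (Fin 2 × Fin 2 × Fin 2) (Fin 2 × Fin 2 × Fin 2) ℝ := h.1.1

theorem mat_mul (h k : H) : mat (h * k) = mat h * mat k := rfl

theorem mat_one : mat 1 = 1 := rfl

theorem mat_inj {h k : H} (e : mat h = mat k) : h = k := Subtype.ext (Subtype.ext e)

theorem mat_sq (h : H) : mat h * mat h = 1 ∨ mat h * mat h = -1 := by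
  obtain ⟨a, ha, b, hb, c, hc, e⟩ := mem_H.1 h.2
  have e' : mat h = a.1 ⊗ₖ (b.1 ⊗ₖ c.1) := congrArg Subtype.val e
  have neg_left : ∀ {m : Type} {n : Type} (A : Matrix m m ℝ) (B : Matrix n n ℝ),
      (-A) ⊗ₖ B = -(A ⊗ₖ B) := fun A B => by ext; simp
  have neg_right : ∀ {m : Type} {n : Type} (A : Matrix m m ℝ) (B : Matrix n n ℝ),
      A ⊗ₖ (-B) = -(A ⊗ₖ B) := fun A B => by ext; simp
  rw [e', ← Matrix.mul_kronecker_mul, ← Matrix.mul_kronecker_mul]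
  rcases WI24_sq ha with h1 | h1 <;> rcases WI24_sq hb with h2 | h2 <;>
    rcases WI24_sq hc with h3 | h3 <;> rw [h1, h2, h3] <;>
    simp [neg_left, neg_right]

/-- The subgroup `{±1}` of `H`. -/
def signSubgroup : Subgroup H where
  carrier := {h | mat h = 1 ∨ mat h = -1}
  one_mem' := Or.inl rfl
  mul_mem' {h k} hh hk := by
    change mat (h * k) = 1 ∨ mat (h * k) = -1
    rw [mat_mul]
    rcases hh with e | e <;> rcases hk with e' | e' <;> rw [e, e'] <;> simp
  inv_mem' {h} hh := by
    have key : mat h⁻¹ * mat h = 1 := by rw [← mat_mul, inv_mul_cancel, mat_one]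
    rcases hh with e | e
    · left
      rwa [e, mul_one] at key
    · right
      rw [e, mul_neg, mul_one] at key
      change mat h⁻¹ = -1
      rw [← key, neg_neg]

instance : signSubgroup.Normal where
  conj_mem h hh k := by
    have key : mat k * mat k⁻¹ = 1 := by rw [← mat_mul, mul_inv_cancel, mat_one]
    change mat (k * h * k⁻¹) = 1 ∨ mat (k * h * k⁻¹) = -1
    rw [mat_mul, mat_mul]
    rcases hh with e | e <;> rw [e] <;> simp [key]

theorem mem_signSubgroup {h : H} : h ∈ signSubgroup ↔ mat h = 1 ∨ mat h = -1 := Iff.rfl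

open Classical in
/-- `sqType h` is `0` if `h² = 1`, and `1` otherwise, that is, if `h² = -1` (see `mat_sq`). -/
noncomputable def sqType (h : H) : ZMod 2 := if mat h * mat h = 1 then 0 else 1

/-- The scalar matrix `(-1) ^ x`. -/
def sgn (x : ZMod 2) : Matrix (Fin 2 × Fin 2 × Fin 2) (Fin 2 × Fin 2 × Fin 2) ℝ :=
  if x = 0 then 1 else -1

theorem zmod_cases : ∀ x : ZMod 2, x = 0 ∨ x = 1 := by decide

theorem sgn_zero : sgn 0 = 1 := if_pos rfl

theorem sgn_one : sgn 1 = -1 := if_neg (by decide)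

theorem sgn_add (x y : ZMod 2) : sgn (x + y) = sgn x * sgn y := by
  have h : (1 : ZMod 2) + 1 = 0 := by decide
  rcases zmod_cases x with rfl | rfl <;> rcases zmod_cases y with rfl | rfl <;>
    simp [sgn_zero, sgn_one, h]

theorem sgn_comm (x : ZMod 2) (M : Matrix (Fin 2 × Fin 2 × Fin 2) (Fin 2 × Fin 2 × Fin 2) ℝ) :
    M * sgn x = sgn x * M := by
  rcases zmod_cases x with rfl | rfl <;> simp [sgn_zero, sgn_one]

theorem sgn_mul_self (x : ZMod 2) : sgn x * sgn x = 1 := by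
  rcases zmod_cases x with rfl | rfl <;> simp [sgn_zero, sgn_one]

theorem one_ne_neg_one :
    (1 : Matrix (Fin 2 × Fin 2 × Fin 2) (Fin 2 × Fin 2 × Fin 2) ℝ) ≠ -1 := by
  intro h
  have := congrFun (congrFun h (0, 0, 0)) (0, 0, 0)
  simp at this
  norm_num at this

theorem sgn_inj {x y : ZMod 2} (h : sgn x = sgn y) : x = y := by
  rcases zmod_cases x with rfl | rfl <;> rcases zmod_cases y with rfl | rfl
  · rfl
  · rw [sgn_zero, sgn_one] at h
    exact absurd h one_ne_neg_one
  · rw [sgn_zero, sgn_one] at h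
    exact absurd h.symm one_ne_neg_one
  · rfl

theorem mat_sq_eq (h : H) : mat h * mat h = sgn (sqType h) := by
  by_cases e : mat h * mat h = 1
  · rw [sqType, if_pos e, sgn_zero, e]
  · rw [sqType, if_neg e, sgn_one, (mat_sq h).resolve_left e]

/-- `h k = (-1) ^ commType h k • k h`, see `mat_comm`. -/
noncomputable def commType (h k : H) : ZMod 2 := sqType (h * k) - sqType h - sqType k

theorem mat_comm (h k : H) : mat h * mat k = sgn (commType h k) * (mat k * mat h) := by
  have e1 := mat_sq_eq (h * k)
  have e2 : sqType (h * k) = (sqType k + sqType h) + commType h k := by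
    rw [commType]; ring
  have e3 : mat h * mat k * (mat h * mat k) * (mat k * mat h) =
      sgn (sqType k + sqType h) * (mat h * mat k) := by
    calc _ = mat h * mat k * (mat h * (mat k * mat k) * mat h) := by simp only [mul_assoc]
      _ = mat h * mat k * (sgn (sqType k) * (mat h * mat h)) := by
        rw [mat_sq_eq k, sgn_comm, mul_assoc (sgn _)]
      _ = _ := by rw [mat_sq_eq h, ← sgn_add, sgn_comm]
  rw [mat_mul] at e1
  rw [e1, e2, sgn_add, mul_assoc] at e3
  have e4 := congrArg (sgn (sqType k + sqType h) * ·) e3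
  simp only [← mul_assoc, sgn_mul_self, one_mul] at e4
  rw [← mul_assoc]
  exact e4.symm

theorem mat_mul_inv (h : H) : mat h * mat h⁻¹ = 1 := by rw [← mat_mul, mul_inv_cancel, mat_one]

theorem commType_mul_left (h h' k : H) :
    commType (h * h') k = commType h k + commType h' k := by
  apply sgn_inj
  have e1 := mat_comm (h * h') k
  have e2 : mat (h * h') * mat k =
      sgn (commType h k + commType h' k) * (mat k * mat (h * h')) := by
    rw [mat_mul, mul_assoc, mat_comm h' k, ← mul_assoc, sgn_comm, mul_assoc, ← mul_assoc (mat h),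
      mat_comm h k, add_comm, sgn_add]
    simp only [mul_assoc]
  rw [e1] at e2
  have e3 := congrArg (· * mat (k * (h * h'))⁻¹) e2
  simpa only [← mat_mul k, mul_assoc, mat_mul_inv, mul_one] using e3

theorem sqType_congr {h k : H} (e : h⁻¹ * k ∈ signSubgroup) : sqType h = sqType k := by
  have : mat k = mat h * mat (h⁻¹ * k) := by rw [← mat_mul, mul_inv_cancel_left]
  apply sgn_inj
  rw [← mat_sq_eq, ← mat_sq_eq, this]
  rcases e with e | e <;> rw [e] <;> simp

instance : CommGroup (H ⧸ signSubgroup) where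
  mul_comm x y := by
    induction x using QuotientGroup.induction_on with | _ h
    induction y using QuotientGroup.induction_on with | _ k
    rw [← QuotientGroup.mk_mul, ← QuotientGroup.mk_mul, QuotientGroup.eq]
    have e : mat ((h * k)⁻¹ * (k * h)) = sgn (commType k h) := by
      rw [mat_mul, mat_mul k, mat_comm k h, ← mul_assoc, sgn_comm, mul_assoc, ← mat_mul h,
        ← mat_mul, inv_mul_cancel, mat_one, mul_one]
    rw [mem_signSubgroup, e]
    rcases zmod_cases (commType k h) with h0 | h0 <;> rw [h0]
    · exact Or.inl sgn_zero
    · exact Or.inr sgn_one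

/-- `H / {±1}`, written additively; it is a vector space over the field with two elements. -/
abbrev A : Type := Additive (H ⧸ signSubgroup)

noncomputable instance : Module (ZMod 2) A := AddCommGroup.zmodModule (n := 2) fun x => by
  induction x using Additive.rec with | _ x
  induction x using QuotientGroup.induction_on with | _ h
  rw [two_nsmul]
  refine congrArg Additive.ofMul ((QuotientGroup.eq_one_iff (h * h)).2 ?_)
  rw [mem_signSubgroup, mat_mul]
  exact mat_sq h

instance : Finite A := inferInstanceAs (Finite (H ⧸ signSubgroup))

/-- The class `{±h}` of `h`. -/
noncomputable def toA (h : H) : A := Additive.ofMul (h : H ⧸ signSubgroup)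

theorem toA_mul (h k : H) : toA (h * k) = toA h + toA k := rfl

theorem toA_surjective : Function.Surjective toA := fun x => by
  induction x using Additive.rec with | _ x
  induction x using QuotientGroup.induction_on with | _ h
  exact ⟨h, rfl⟩

/-- The function `{±h} ↦ sqType h`. -/
noncomputable def Qfun (x : A) : ZMod 2 :=
  Quotient.liftOn' x.toMul sqType fun _ _ e => sqType_congr (QuotientGroup.leftRel_apply.1 e)

theorem Qfun_toA (h : H) : Qfun (toA h) = sqType h := rfl

theorem polar_toA (h k : H) : QuadraticMap.polar Qfun (toA h) (toA k) = commType h k := rfl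

theorem sqType_one : sqType 1 = 0 := if_pos (by rw [mat_one, mul_one])

theorem polar_zero_left (y : A) : QuadraticMap.polar Qfun 0 y = 0 := by
  rw [QuadraticMap.polar, zero_add, sub_right_comm, sub_self, zero_sub]
  exact neg_eq_zero.2 sqType_one

/-- The quadratic form on `H / {±1}` with `Q {±h} = 0` if `h² = 1` and `Q {±h} = 1` if `h² = -1`. -/
noncomputable def Q : QuadraticForm (ZMod 2) A :=
  QuadraticMap.ofPolar Qfun
    (fun a x => by
      rcases zmod_cases a with rfl | rfl
      · rw [zero_smul, mul_zero, zero_smul]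
        exact sqType_one
      · rw [one_smul, mul_one, one_smul])
    (fun x x' y => by
      obtain ⟨h, rfl⟩ := toA_surjective x
      obtain ⟨h', rfl⟩ := toA_surjective x'
      obtain ⟨k, rfl⟩ := toA_surjective y
      exact commType_mul_left h h' k)
    (fun a x y => by
      rcases zmod_cases a with rfl | rfl
      · rw [zero_smul, zero_smul, polar_zero_left]
      · rw [one_smul, one_smul])

theorem kron_left_cancel {m n : Type} {a : Matrix m m ℝ} {b b' : Matrix n n ℝ} (ha : a ≠ 0)
    (e : a ⊗ₖ b = a ⊗ₖ b') : b = b' := by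
  obtain ⟨i, j, hij⟩ : ∃ i j, a i j ≠ 0 := by
    by_contra! hc
    exact ha (Matrix.ext hc)
  ext k l
  have := congrFun (congrFun e (i, k)) (j, l)
  exact mul_left_cancel₀ hij this

theorem kron_right_cancel {m n : Type} {a a' : Matrix m m ℝ} {b : Matrix n n ℝ} (hb : b ≠ 0)
    (e : a ⊗ₖ b = a' ⊗ₖ b) : a = a' := by
  obtain ⟨i, j, hij⟩ : ∃ i j, b i j ≠ 0 := by
    by_contra! hc
    exact hb (Matrix.ext hc)
  ext k l
  have := congrFun (congrFun e (k, i)) (l, j)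
  exact mul_right_cancel₀ hij this

theorem kron_ne_zero {m n : Type} {a : Matrix m m ℝ} {b : Matrix n n ℝ} (ha : a ≠ 0) (hb : b ≠ 0) :
    a ⊗ₖ b ≠ 0 := by
  intro e
  refine hb (kron_left_cancel ha (e.trans ?_))
  ext; simp

theorem orth_ne_zero (w : Matrix.orthogonalGroup (Fin 2) ℝ) : w.1 ≠ 0 := by
  intro e
  have := (Matrix.mem_orthogonalGroup_iff _ _).1 w.2
  rw [e, zero_mul] at this
  exact zero_ne_one this

theorem WI24_central {w : Matrix.orthogonalGroup (Fin 2) ℝ} (hw : w ∈ WI24)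
    (h₁ : w.1 * refl₁.1 = refl₁.1 * w.1) (h₂ : w.1 * refl₂.1 = refl₂.1 * w.1) :
    w.1 = 1 ∨ w.1 = -1 := by
  obtain ⟨a, b, ha, hb, h⟩ := WI24_form hw
  rw [refl₁] at h₁
  rw [refl₂] at h₂
  have e1 := congrFun (congrFun h₁ 0) 1
  have e2 := congrFun (congrFun h₂ 0) 1
  rcases h with h | h <;> rw [h] at e1 e2 ⊢ <;> rcases ha with rfl | rfl <;>
    rcases hb with rfl | rfl <;> rw [Matrix.one_fin_two] <;>
    simp [Matrix.mul_apply, Fin.sum_univ_two] at e1 e2 ⊢ <;> linarith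

theorem refl₁_mem : refl₁ ∈ WI24 := Subgroup.subset_closure (by simp)

theorem refl₂_mem : refl₂ ∈ WI24 := Subgroup.subset_closure (by simp)

theorem H_central {h : H} (hc : ∀ k : H, mat h * mat k = mat k * mat h) : h ∈ signSubgroup := by
  obtain ⟨a, ha, b, hb, c, hc', e⟩ := mem_H.1 h.2
  have e' : mat h = a.1 ⊗ₖ (b.1 ⊗ₖ c.1) := congrArg Subtype.val e
  have key : ∀ u ∈ WI24, ∀ v ∈ WI24, ∀ w ∈ WI24,
      (a.1 * u.1) ⊗ₖ ((b.1 * v.1) ⊗ₖ (c.1 * w.1)) = (u.1 * a.1) ⊗ₖ ((v.1 * b.1) ⊗ₖ (w.1 * c.1)) := by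
    intro u hu v hv w hw
    have := hc ⟨tensorHom (u, v, w), mem_H.2 ⟨u, hu, v, hv, w, hw, rfl⟩⟩
    rw [e'] at this
    change a.1 ⊗ₖ (b.1 ⊗ₖ c.1) * u.1 ⊗ₖ (v.1 ⊗ₖ w.1) = u.1 ⊗ₖ (v.1 ⊗ₖ w.1) * a.1 ⊗ₖ (b.1 ⊗ₖ c.1) at this
    simpa only [← Matrix.mul_kronecker_mul] using this
  have one : (1 : Matrix.orthogonalGroup (Fin 2) ℝ).1 = 1 := rfl
  have ka : ∀ u ∈ WI24, a.1 * u.1 = u.1 * a.1 := fun u hu => by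
    have := key u hu 1 (one_mem _) 1 (one_mem _)
    simp only [one, mul_one, one_mul] at this
    exact kron_right_cancel (kron_ne_zero (orth_ne_zero b) (orth_ne_zero c)) this
  have kb : ∀ u ∈ WI24, b.1 * u.1 = u.1 * b.1 := fun u hu => by
    have := key 1 (one_mem _) u hu 1 (one_mem _)
    simp only [one, mul_one, one_mul] at this
    exact kron_right_cancel (orth_ne_zero c) (kron_left_cancel (orth_ne_zero a) this)
  have kc : ∀ u ∈ WI24, c.1 * u.1 = u.1 * c.1 := fun u hu => by
    have := key 1 (one_mem _) 1 (one_mem _) u hu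
    simp only [one, mul_one, one_mul] at this
    exact kron_left_cancel (orth_ne_zero b) (kron_left_cancel (orth_ne_zero a) this)
  have neg_left : ∀ {m : Type} {n : Type} (A : Matrix m m ℝ) (B : Matrix n n ℝ),
      (-A) ⊗ₖ B = -(A ⊗ₖ B) := fun A B => by ext; simp
  have neg_right : ∀ {m : Type} {n : Type} (A : Matrix m m ℝ) (B : Matrix n n ℝ),
      A ⊗ₖ (-B) = -(A ⊗ₖ B) := fun A B => by ext; simp
  rw [mem_signSubgroup, e']
  rcases WI24_central ha (ka _ refl₁_mem) (ka _ refl₂_mem) with h1 | h1 <;>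
    rcases WI24_central hb (kb _ refl₁_mem) (kb _ refl₂_mem) with h2 | h2 <;>
    rcases WI24_central hc' (kc _ refl₁_mem) (kc _ refl₂_mem) with h3 | h3 <;>
    rw [h1, h2, h3] <;> simp [neg_left, neg_right]

theorem Q_nondegenerate : Q.polarBilin.Nondegenerate := by
  have left : ∀ x : A, (∀ y, Q.polarBilin x y = 0) → x = 0 := by
    intro x hx
    obtain ⟨h, rfl⟩ := toA_surjective x
    refine congrArg Additive.ofMul ((QuotientGroup.eq_one_iff h).2 (H_central fun k => ?_))
    have : commType h k = 0 := hx (toA k)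
    rw [mat_comm, this, sgn_zero, one_mul]
  refine ⟨left, fun y hy => left y fun x => ?_⟩
  rw [← hy x]
  exact QuadraticMap.polar_comm _ _ _

theorem mat_normalizer (n : N) (h : H) :
    mat (Subgroup.normalizerMonoidHom H n h) = n.1.1 * mat h * (n.1⁻¹).1 := rfl

theorem normalizer_map_le (n : N) :
    signSubgroup.map (Subgroup.normalizerMonoidHom H n : H →* H) ≤ signSubgroup := by
  rintro _ ⟨h, hh, rfl⟩
  have key : n.1.1 * (n.1⁻¹).1 = 1 := congrArg Subtype.val (mul_inv_cancel n.1)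
  change mat (Subgroup.normalizerMonoidHom H n h) = 1 ∨
    mat (Subgroup.normalizerMonoidHom H n h) = -1
  rw [mat_normalizer]
  rcases hh with e | e <;> rw [e] <;> simp only [mul_one, mul_neg, neg_mul, key]
  · exact Or.inl trivial
  · exact Or.inr trivial

theorem normalizer_map (n : N) :
    signSubgroup.map (Subgroup.normalizerMonoidHom H n : H →* H) = signSubgroup := by
  refine le_antisymm (normalizer_map_le n) fun h hh => ?_
  refine ⟨Subgroup.normalizerMonoidHom H n⁻¹ h, normalizer_map_le n⁻¹ ⟨h, hh, rfl⟩, ?_⟩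
  change (Subgroup.normalizerMonoidHom H n * Subgroup.normalizerMonoidHom H n⁻¹) h = h
  rw [← map_mul, mul_inv_cancel, map_one]
  rfl

/-- The action of `N` on `H / {±1}` by conjugation. -/
noncomputable def conjAction : N →* (A ≃ₗ[ZMod 2] A) where
  toFun n := (MulEquiv.toAdditive (QuotientGroup.congr signSubgroup signSubgroup
    (Subgroup.normalizerMonoidHom H n) (normalizer_map n))).toLinearEquiv
      fun c x => ZMod.map_smul (MulEquiv.toAdditive (QuotientGroup.congr signSubgroup signSubgroup
        (Subgroup.normalizerMonoidHom H n) (normalizer_map n))) c x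
  map_one' := by
    ext x
    obtain ⟨h, rfl⟩ := toA_surjective x
    change toA (Subgroup.normalizerMonoidHom H 1 h) = toA h
    rw [map_one]
    rfl
  map_mul' m n := by
    ext x
    obtain ⟨h, rfl⟩ := toA_surjective x
    change toA (Subgroup.normalizerMonoidHom H (m * n) h) =
      toA (Subgroup.normalizerMonoidHom H m (Subgroup.normalizerMonoidHom H n h))
    rw [map_mul]
    rfl

theorem conjAction_toA (n : N) (h : H) :
    conjAction n (toA h) = toA (Subgroup.normalizerMonoidHom H n h) := rfl

/-- `L`: the preimage in `N` of `O⁺(Q)`, i.e. of the isometries of `(H / {±1}, Q)` whose Dickson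
invariant is `0`. -/
noncomputable def L : Subgroup SO8 :=
  ((SpecialIsometryGroup Q Q_nondegenerate).comap conjAction).map N.subtype

end RotationGroup

/-!
The quadratic space `H / {±1}` is the space `Λ² 𝔽₂⁴` of bivectors with the Klein quadric, the two
reflections in each tensor factor of `H` giving three hyperbolic pairs. Let `n ∈ N` be a rotation.
The fixed spaces of `n` and of its conjugate by `h ∈ H` have dimension `6` in `ℝ⁸`, hence meet, so
the commutator of `n` and `h` is an element of `H` with a fixed vector, and it squares to `1`.
Therefore `n - 1` has totally singular image on `H / {±1}`, and `n` acts as the Siegel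
transformation of a totally singular plane, that is, as a transvection of `𝔽₂⁴`. Conversely every
Siegel transformation is induced by a rotation.

A rotation group between `H` and `N` thus determines a set of transvections of `𝔽₂⁴` that is
closed under conjugation and under the addition of axes at a common center. Such a set contains
all transvections, or leaves a nonzero totally singular space of bivectors invariant, or fixes a
nonzero bivector. In the first case the group contains `L`, since the Siegel transformations
generate `O⁺(Q)`. In the second case the lifts of the singular space to `H` are commuting
involutions, whose joint eigenspaces form a system of imprimitivity. The third case is impossible,
because a lift of the fixed bivector would commute with the whole group and in particular with `H`.

Conversely, `H / {±1}` permutes the at most eight blocks of a system of imprimitivity of `L`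
transitively, so one of its `64` elements, other than the identity, fixes every block. Since `L`
acts irreducibly on `H / {±1}`, all of `H` fixes every block, but `H` is irreducible on `ℝ⁸`.
-/

namespace RotationGroup

open QuadraticMap (polar)

section TotallySingular

variable {R M : Type*} [CommRing R] [AddCommGroup M] [Module R M]

theorem polar_eq_zero_of_mem_span (Q : QuadraticForm R M) {X Y : Set M}
    (h : ∀ x ∈ X, ∀ y ∈ Y, polar Q x y = 0) {v w : M}
    (hv : v ∈ Submodule.span R X) (hw : w ∈ Submodule.span R Y) : polar Q v w = 0 := by
  induction hv, hw using Submodule.span_induction₂ with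
  | mem_mem x y hx hy => exact h x hx y hy
  | zero_left => exact QuadraticMap.polar_zero_left Q _
  | zero_right => exact QuadraticMap.polar_zero_right Q _
  | add_left x y z _ _ _ hx hy => rw [QuadraticMap.polar_add_left, hx, hy, add_zero]
  | add_right x y z _ _ _ hy hz => rw [QuadraticMap.polar_add_right, hy, hz, add_zero]
  | smul_left a x y _ _ h => rw [QuadraticMap.polar_smul_left, h, smul_zero]
  | smul_right a x y _ _ h => rw [QuadraticMap.polar_smul_right, h, smul_zero]

theorem eq_zero_of_mem_span (Q : QuadraticForm R M) {X : Set M} (hQ : ∀ x ∈ X, Q x = 0)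
    (hB : ∀ x ∈ X, ∀ y ∈ X, polar Q x y = 0) {w : M}
    (hw : w ∈ Submodule.span R X) : Q w = 0 := by
  induction hw using Submodule.span_induction with
  | mem x hx => exact hQ x hx
  | zero => exact QuadraticMap.map_zero Q
  | add u v hu hv hQu hQv =>
    rw [QuadraticMap.map_add Q, hQu, hQv, polar_eq_zero_of_mem_span Q hB hu hv, add_zero, add_zero]
  | smul a u _ hu => rw [QuadraticMap.map_smul, hu, smul_zero]

end TotallySingular

section CharTwo

variable {M : Type*} [AddCommGroup M] [Module (ZMod 2) M]

theorem add_eq_zero_iff_eq_of_zmod_two {x y : M} : x + y = 0 ↔ x = y := by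
  rw [add_eq_zero_iff_eq_neg, ZModModule.neg_eq_self]

/-- The subspace `{0} ∪ P` of a space over `𝔽₂`, where closure under sums of distinct elements
suffices because `x + x = 0`. -/
def insertZero (P : M → Prop) (hP : ∀ x y, P x → P y → x ≠ y → P (x + y)) :
    Submodule (ZMod 2) M where
  carrier := {x | x = 0 ∨ P x}
  zero_mem' := Or.inl rfl
  add_mem' {x y} := by
    rintro (rfl | hx) (rfl | hy)
    · exact Or.inl (add_zero 0)
    · exact Or.inr ((zero_add y).symm ▸ hy)
    · exact Or.inr ((add_zero x).symm ▸ hx)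
    · by_cases h : x = y
      · exact Or.inl (add_eq_zero_iff_eq_of_zmod_two.2 h)
      · exact Or.inr (hP x y hx hy h)
  smul_mem' a x hx := by
    rcases zmod_cases a with rfl | rfl
    · exact Or.inl (zero_smul _ x)
    · rwa [one_smul]

theorem linearIndependent_pair_of_ne {x y : M} (hx : x ≠ 0) (hy : y ≠ 0) (hxy : x ≠ y) :
    LinearIndependent (ZMod 2) ![x, y] := by
  refine linearIndependent_fin2.2 ⟨hy, fun a => ?_⟩
  rcases zmod_cases a with rfl | rfl
  · exact fun e => hx ((zero_smul _ y).symm.trans e).symm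
  · exact fun e => hxy ((one_smul _ y).symm.trans e).symm

theorem two_le_finrank_of_ne [Finite M] {S : Submodule (ZMod 2) M} {x y : M} (hx : x ∈ S)
    (hy : y ∈ S) (hx0 : x ≠ 0) (hy0 : y ≠ 0) (hxy : x ≠ y) : 2 ≤ finrank (ZMod 2) S := by
  have hli : LinearIndependent (ZMod 2) ![(⟨x, hx⟩ : S), ⟨y, hy⟩] :=
    linearIndependent_pair_of_ne (fun e => hx0 congr($e)) (fun e => hy0 congr($e))
      (fun e => hxy congr($e))
  simpa using hli.fintype_card_le_finrank

variable {N : Type*} [AddCommGroup N] [Module (ZMod 2) N]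
  {B : M →ₗ[ZMod 2] N →ₗ[ZMod 2] ZMod 2}

theorem exists_apply_eq_one (hB : B.SeparatingRight) {v : N} (hv : v ≠ 0) : ∃ x, B x v = 1 := by
  by_contra! h
  exact hv (hB v fun x => (zmod_cases _).resolve_right (h x))

theorem exists_apply_eq_zero_one (hB : B.SeparatingRight) {u v : N} (hv : v ≠ 0) (huv : u ≠ v) :
    ∃ x, B x u = 0 ∧ B x v = 1 := by
  obtain ⟨x, hx⟩ := exists_apply_eq_one hB hv
  rcases zmod_cases (B x u) with hxu | hxu
  · exact ⟨x, hxu, hx⟩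
  obtain ⟨y, hy⟩ := exists_apply_eq_one hB (sub_ne_zero.2 huv)
  rw [map_sub, sub_eq_iff_eq_add] at hy
  rcases zmod_cases (B y v) with hyv | hyv <;> rw [hyv] at hy
  · refine ⟨x + y, ?_, ?_⟩ <;> rw [map_add, LinearMap.add_apply]
    · rw [hxu, hy, add_zero, CharTwo.add_self_eq_zero]
    · rw [hx, hyv, add_zero]
  · exact ⟨y, hy.trans (CharTwo.add_self_eq_zero 1), hyv⟩

end CharTwo

/-! ### Transvections of bivectors -/

/-- The space `𝔽₂⁴`; its dual is identified with it by the dot product. -/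
abbrev Vec : Type := Fin 4 → ZMod 2

theorem separatingRight_dotProduct :
    (dotProductEquiv (ZMod 2) (Fin 4)).toLinearMap.SeparatingRight := fun v h =>
  dotProduct_eq_zero v fun x => (dotProduct_comm v x).trans (h x)

theorem exists_dotProduct_eq_one {v : Vec} (hv : v ≠ 0) : ∃ x, x ⬝ᵥ v = 1 :=
  exists_apply_eq_one separatingRight_dotProduct hv

theorem exists_dotProduct_eq_zero_one {u v : Vec} (hv : v ≠ 0) (huv : u ≠ v) :
    ∃ x, x ⬝ᵥ u = 0 ∧ x ⬝ᵥ v = 1 :=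
  exists_apply_eq_zero_one separatingRight_dotProduct hv huv

theorem exists_ne_zero_dotProduct_eq_zero {P : Submodule (ZMod 2) Vec}
    (hP : 2 ≤ finrank (ZMod 2) P) (q : Vec) : ∃ φ ∈ P, φ ≠ 0 ∧ φ ⬝ᵥ q = 0 := by
  let f : P →ₗ[ZMod 2] ZMod 2 := dotProductEquiv (ZMod 2) (Fin 4) q ∘ₗ P.subtype
  obtain ⟨φ, hφ, hφ0⟩ := (Submodule.ne_bot_iff _).1
    (LinearMap.ker_ne_bot_of_finrank_lt (f := f) (by rw [finrank_self]; omega))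
  exact ⟨φ, φ.2, fun h => hφ0 (Subtype.ext h), (dotProduct_comm _ _).trans hφ⟩

theorem exists_forall_dotProduct_eq_zero (v : Fin 3 → Vec) : ∃ x ≠ 0, ∀ i, v i ⬝ᵥ x = 0 := by
  obtain ⟨x, hx, hx0⟩ := (Submodule.ne_bot_iff _).1
    (LinearMap.ker_ne_bot_of_finrank_lt (f := Matrix.mulVecLin (Matrix.of v)) (by simp))
  exact ⟨x, hx0, congrFun hx⟩

theorem exists_dotProduct_eq_zero_of_ne_top {Z : Submodule (ZMod 2) Vec} (hZ : Z ≠ ⊤) :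
    ∃ χ : Vec, χ ≠ 0 ∧ ∀ z ∈ Z, χ ⬝ᵥ z = 0 := by
  obtain ⟨f, hf, hfZ⟩ := Submodule.exists_le_ker_of_lt_top Z (lt_top_iff_ne_top.2 hZ)
  obtain ⟨χ, rfl⟩ := (dotProductEquiv (ZMod 2) (Fin 4)).surjective f
  exact ⟨χ, by rintro rfl; exact hf (map_zero _), fun z hz => hfZ hz⟩

/-- The bivectors of `𝔽₂⁴`, in the Plücker coordinates `p₀₁, p₂₃, p₀₂, p₁₃, p₀₃, p₁₂`. -/
abbrev Biv : Type := Fin 6 → ZMod 2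

/-- The Klein quadratic form on bivectors. Its zeros are the decomposable bivectors. -/
noncomputable def klein : QuadraticForm (ZMod 2) Biv :=
  QuadraticMap.proj 0 1 + QuadraticMap.proj 2 3 + QuadraticMap.proj 4 5

theorem klein_apply (w : Biv) : klein w = w 0 * w 1 + w 2 * w 3 + w 4 * w 5 := rfl

theorem polar_klein (v w : Biv) : polar klein v w =
    v 0 * w 1 + v 1 * w 0 + v 2 * w 3 + v 3 * w 2 + v 4 * w 5 + v 5 * w 4 := by
  simp only [QuadraticMap.polar, klein_apply, Pi.add_apply]
  ring

/-- The exterior product of two vectors. -/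
def wedge : Vec →ₗ[ZMod 2] Vec →ₗ[ZMod 2] Biv :=
  LinearMap.mk₂ (ZMod 2)
    (fun p x : Vec =>
      ![p 0 * x 1 + p 1 * x 0, p 2 * x 3 + p 3 * x 2, p 0 * x 2 + p 2 * x 0,
        p 1 * x 3 + p 3 * x 1, p 0 * x 3 + p 3 * x 0, p 1 * x 2 + p 2 * x 1])
    (fun p p' x => by ext i; fin_cases i <;> dsimp <;> ring)
    (fun a p x => by ext i; fin_cases i <;> dsimp <;> ring)
    (fun p x x' => by ext i; fin_cases i <;> dsimp <;> ring)
    (fun a p x => by ext i; fin_cases i <;> dsimp <;> ring)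

/-- The contraction of a bivector by a functional. -/
def contract : Vec →ₗ[ZMod 2] Biv →ₗ[ZMod 2] Vec :=
  LinearMap.mk₂ (ZMod 2)
    (fun (φ : Vec) (w : Biv) =>
      ![w 0 * φ 1 + w 2 * φ 2 + w 4 * φ 3, w 0 * φ 0 + w 5 * φ 2 + w 3 * φ 3,
        w 2 * φ 0 + w 5 * φ 1 + w 1 * φ 3, w 4 * φ 0 + w 3 * φ 1 + w 1 * φ 2])
    (fun φ ψ w => by ext i; fin_cases i <;> dsimp <;> ring)
    (fun a φ w => by ext i; fin_cases i <;> dsimp <;> ring)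
    (fun φ v w => by ext i; fin_cases i <;> dsimp <;> ring)
    (fun a φ w => by ext i; fin_cases i <;> dsimp <;> ring)

/-- The action on bivectors of the transvection `x ↦ x + φ(x) p`. -/
def transvect (p φ : Vec) : Biv →ₗ[ZMod 2] Biv := LinearMap.id + wedge p ∘ₗ contract φ

theorem wedge_apply (p x : Vec) : wedge p x =
    ![p 0 * x 1 + p 1 * x 0, p 2 * x 3 + p 3 * x 2, p 0 * x 2 + p 2 * x 0,
      p 1 * x 3 + p 3 * x 1, p 0 * x 3 + p 3 * x 0, p 1 * x 2 + p 2 * x 1] := rfl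

theorem contract_apply (φ : Vec) (w : Biv) : contract φ w =
    ![w 0 * φ 1 + w 2 * φ 2 + w 4 * φ 3, w 0 * φ 0 + w 5 * φ 2 + w 3 * φ 3,
      w 2 * φ 0 + w 5 * φ 1 + w 1 * φ 3, w 4 * φ 0 + w 3 * φ 1 + w 1 * φ 2] := rfl

theorem transvect_apply (p φ : Vec) (w : Biv) :
    transvect p φ w = w + wedge p (contract φ w) := rfl

theorem wedge_self (p : Vec) : wedge p p = 0 := by
  ext i
  fin_cases i <;> simp [wedge_apply, mul_comm, CharTwo.add_self_eq_zero]

theorem wedge_comm (p x : Vec) : wedge p x = wedge x p := by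
  ext i
  fin_cases i <;> simp [wedge_apply] <;> ring

theorem contract_wedge (φ p x : Vec) :
    contract φ (wedge p x) = (φ ⬝ᵥ x) • p + (φ ⬝ᵥ p) • x := by
  ext i
  fin_cases i <;> simp [contract_apply, wedge_apply, dotProduct, Fin.sum_univ_four] <;> grind

theorem dotProduct_contract_self (φ : Vec) (w : Biv) : φ ⬝ᵥ contract φ w = 0 := by
  simp [contract_apply, dotProduct, Fin.sum_univ_four]
  grind

theorem dotProduct_contract_comm (φ ψ : Vec) (w : Biv) :
    φ ⬝ᵥ contract ψ w = ψ ⬝ᵥ contract φ w := by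
  simp [contract_apply, dotProduct, Fin.sum_univ_four]
  ring

theorem klein_wedge (p x : Vec) : klein (wedge p x) = 0 := by
  simp [klein_apply, wedge_apply]
  grind

theorem wedge_ne_zero {u v : Vec} (hu : u ≠ 0) (hv : v ≠ 0) (huv : u ≠ v) : wedge u v ≠ 0 := by
  obtain ⟨φ, hφu, hφv⟩ := exists_dotProduct_eq_zero_one hv huv
  intro h
  have := contract_wedge φ u v
  rw [h, map_zero, hφu, hφv, one_smul, zero_smul, add_zero] at this
  exact hu this.symm

theorem exists_wedge_ne_zero {v : Vec} (hv : v ≠ 0) : ∃ x, wedge v x ≠ 0 := by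
  obtain ⟨φ, hφ, hφv⟩ := exists_forall_dotProduct_eq_zero fun _ => v
  obtain ⟨x, hx⟩ := exists_dotProduct_eq_one hφ
  refine ⟨x, fun h => hv ?_⟩
  have := contract_wedge φ v x
  rwa [h, map_zero, dotProduct_comm, hx, dotProduct_comm φ, hφv 0, one_smul, zero_smul, add_zero,
    eq_comm] at this

/-- The Hodge dual of a bivector. -/
def hodge (w : Biv) : Biv := ![w 1, w 0, w 3, w 2, w 5, w 4]

theorem contract_contract_hodge (φ : Vec) (w : Biv) :
    contract (contract φ w) (hodge w) = klein w • φ := by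
  ext i
  fin_cases i <;> simp [contract_apply, hodge, klein_apply] <;> grind

theorem klein_eq_zero_of_contract {χ : Vec} (hχ : χ ≠ 0) {w : Biv} (h : contract χ w = 0) :
    klein w = 0 := by
  have := contract_contract_hodge χ w
  rw [h, map_zero, LinearMap.zero_apply, eq_comm, smul_eq_zero] at this
  exact this.resolve_right hχ

/-- The functionals annihilating a bivector. -/
def annihilator (w : Biv) : Submodule (ZMod 2) Vec := LinearMap.ker (contract.flip w)

theorem mem_annihilator {w : Biv} {φ : Vec} : φ ∈ annihilator w ↔ contract φ w = 0 := Iff.rfl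

theorem disjoint_annihilator {v w : Biv} (h : polar klein v w ≠ 0) :
    Disjoint (annihilator v) (annihilator w) := by
  rw [Submodule.disjoint_def]
  intro χ hv hw
  rw [mem_annihilator] at hv hw
  by_contra hχ
  refine h ?_
  rw [QuadraticMap.polar, klein_eq_zero_of_contract hχ hv, klein_eq_zero_of_contract hχ hw,
    klein_eq_zero_of_contract hχ (by rw [map_add, hv, hw, add_zero]), sub_zero, sub_zero]

theorem exists_ne_zero_contract_eq_zero (φ ψ : Vec) :
    ∃ w ≠ 0, contract φ w = 0 ∧ contract ψ w = 0 := by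
  obtain ⟨u, hu, huφψ⟩ := exists_forall_dotProduct_eq_zero ![φ, ψ, ψ]
  obtain ⟨χ, hχ⟩ := exists_dotProduct_eq_one hu
  obtain ⟨v, hv, hvφψ⟩ := exists_forall_dotProduct_eq_zero ![φ, ψ, χ]
  have huv : u ≠ v := by
    rintro rfl
    exact one_ne_zero (hχ.symm.trans (hvφψ 2))
  have hφu : φ ⬝ᵥ u = 0 := huφψ 0
  have hψu : ψ ⬝ᵥ u = 0 := huφψ 1
  have hφv : φ ⬝ᵥ v = 0 := hvφψ 0
  have hψv : ψ ⬝ᵥ v = 0 := hvφψ 1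
  refine ⟨wedge u v, wedge_ne_zero hu hv huv, ?_, ?_⟩
  · rw [contract_wedge, hφu, hφv, zero_smul, zero_smul, add_zero]
  · rw [contract_wedge, hψu, hψv, zero_smul, zero_smul, add_zero]

theorem exists_contract_eq (f : Vec →ₗ[ZMod 2] Vec) (hf : ∀ φ, φ ⬝ᵥ f φ = 0) :
    ∃ w, ∀ φ, contract φ w = f φ := by
  have hpolar : ∀ φ ψ, φ ⬝ᵥ f ψ = ψ ⬝ᵥ f φ := fun φ ψ => by
    have := hf (φ + ψ)
    rw [map_add, add_dotProduct, dotProduct_add, dotProduct_add, hf, hf, zero_add, add_zero] at this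
    exact add_eq_zero_iff_eq_of_zmod_two.1 this
  set s : Fin 4 → Vec := fun i => f (Pi.single i 1) with hs
  have s_comm : ∀ i j, s i j = s j i := fun i j => by
    simpa using hpolar (Pi.single j 1) (Pi.single i 1)
  have s_self : ∀ i, s i i = 0 := fun i => by simpa using hf (Pi.single i 1)
  refine ⟨![s 0 1, s 2 3, s 0 2, s 1 3, s 0 3, s 1 2], fun φ => ?_⟩
  have hφ : f φ = ∑ i, φ i • s i := by
    conv_lhs => rw [← Finset.univ_sum_single φ, map_sum]
    exact Finset.sum_congr rfl fun i _ => by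
      rw [hs, ← map_smul, ← Pi.single_smul, smul_eq_mul, mul_one]
  rw [hφ]
  ext j
  fin_cases j <;>
    simp [contract_apply, Fin.sum_univ_four, s_self, s_comm 1 0, s_comm 2 0, s_comm 3 0,
      s_comm 2 1, s_comm 3 1, s_comm 3 2] <;> ring

/-- The transvection of `𝔽₂⁴` with center `q` and axis `ψ = 0`. By duality, `shear ψ q` is its
action on functionals. -/
def shear (q ψ x : Vec) : Vec := x + (ψ ⬝ᵥ x) • q

theorem shear_shear {q ψ : Vec} (h : ψ ⬝ᵥ q = 0) (x : Vec) : shear q ψ (shear q ψ x) = x := by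
  rw [shear, shear, dotProduct_add, dotProduct_smul, h, smul_zero, add_zero, add_assoc,
    ZModModule.add_self, add_zero]

theorem shear_injective {q ψ : Vec} (h : ψ ⬝ᵥ q = 0) : Function.Injective (shear q ψ) :=
  Function.LeftInverse.injective (shear_shear h)

theorem shear_zero (q ψ : Vec) : shear q ψ 0 = 0 := by
  rw [shear, dotProduct_zero, zero_smul, add_zero]

theorem shear_dotProduct_shear {q ψ : Vec} (h : ψ ⬝ᵥ q = 0) (φ p : Vec) :
    shear ψ q φ ⬝ᵥ shear q ψ p = φ ⬝ᵥ p := by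
  simp only [shear, add_dotProduct, dotProduct_add, smul_dotProduct, dotProduct_smul, h,
    smul_eq_mul, mul_zero, add_zero]
  rw [dotProduct_comm q, mul_comm, add_assoc, CharTwo.add_self_eq_zero, add_zero]

theorem transvect_wedge (q ψ p x : Vec) :
    transvect q ψ (wedge p x) = wedge (shear q ψ p) (shear q ψ x) := by
  simp only [transvect_apply, shear, contract_wedge, map_add, map_smul, LinearMap.add_apply,
    LinearMap.smul_apply, wedge_self, smul_zero, add_zero]
  rw [wedge_comm q p]
  abel

theorem contract_transvect {q ψ : Vec} (h : ψ ⬝ᵥ q = 0) (φ : Vec) (w : Biv) :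
    contract (shear ψ q φ) (transvect q ψ w) = shear q ψ (contract φ w) := by
  simp only [transvect_apply, shear, map_add, map_smul, LinearMap.add_apply, LinearMap.smul_apply,
    contract_wedge, dotProduct_contract_self, h, smul_zero, zero_smul, add_zero]
  rw [dotProduct_contract_comm φ ψ, dotProduct_comm q, add_right_comm,
    add_assoc _ _ (_ • contract ψ w), add_right_comm, add_assoc _ (_ • contract ψ w),
    ZModModule.add_self, add_zero]

theorem transvect_conj {q ψ : Vec} (h : ψ ⬝ᵥ q = 0) (p φ : Vec) (w : Biv) :
    transvect q ψ (transvect p φ w) =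
      transvect (shear q ψ p) (shear ψ q φ) (transvect q ψ w) := by
  rw [transvect_apply p, map_add, transvect_wedge, ← contract_transvect h]
  rfl

theorem transvect_transvect {p φ ψ : Vec} (h : φ ⬝ᵥ p = 0) (w : Biv) :
    transvect p φ (transvect p ψ w) = transvect p (φ + ψ) w := by
  simp only [transvect_apply, map_add, LinearMap.add_apply, contract_wedge, h, map_smul, wedge_self,
    smul_zero, zero_smul, add_zero]
  abel

theorem transvect_involutive {q ψ : Vec} (h : ψ ⬝ᵥ q = 0) (w : Biv) :
    transvect q ψ (transvect q ψ w) = w := by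
  rw [transvect_transvect h, ZModModule.add_self, transvect_apply, map_zero, LinearMap.zero_apply,
    map_zero, add_zero]

theorem transvect_mem_span {X : Set Biv} {p φ : Vec}
    (h : ∀ x ∈ X, transvect p φ x ∈ Submodule.span (ZMod 2) X) {w : Biv}
    (hw : w ∈ Submodule.span (ZMod 2) X) : transvect p φ w ∈ Submodule.span (ZMod 2) X :=
  (Submodule.span_le.2 h : _ ≤ (Submodule.span (ZMod 2) X).comap (transvect p φ)) hw

/-! ### Sets of transvections closed under conjugation -/

/-- A set of transvections of `𝔽₂⁴`, where `T p φ` stands for `x ↦ x + φ(x) p`, which is closed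
under conjugation and under nontrivial products of transvections with the same center. -/
structure IsTransvectionSet (T : Vec → Vec → Prop) : Prop where
  center_ne : ∀ {p φ}, T p φ → p ≠ 0
  axis_ne : ∀ {p φ}, T p φ → φ ≠ 0
  flag : ∀ {p φ}, T p φ → φ ⬝ᵥ p = 0
  add : ∀ {p φ ψ}, T p φ → T p ψ → φ ≠ ψ → T p (φ + ψ)
  conj : ∀ {p φ q ψ}, T q ψ → T p φ → T (shear q ψ p) (shear ψ q φ)

/-- There is a nonzero totally singular space of bivectors invariant under all transvections
in `T`. -/
def HasSingularInvariant (T : Vec → Vec → Prop) : Prop :=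
  ∃ S : Submodule (ZMod 2) Biv, S ≠ ⊥ ∧ (∀ w ∈ S, klein w = 0) ∧
    ∀ p φ, T p φ → ∀ w ∈ S, transvect p φ w ∈ S

theorem hasSingularInvariant_of_fixed {T : Vec → Vec → Prop} {v : Vec} (hv : v ≠ 0)
    (h : ∀ p φ, T p φ → φ ⬝ᵥ v = 0) : HasSingularInvariant T := by
  refine ⟨LinearMap.range (wedge v), ?_, ?_, ?_⟩
  · obtain ⟨x, hx⟩ := exists_wedge_ne_zero hv
    exact (Submodule.ne_bot_iff _).2 ⟨_, LinearMap.mem_range_self _ x, hx⟩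
  · rintro _ ⟨x, rfl⟩
    exact klein_wedge v x
  · rintro p φ hp _ ⟨x, rfl⟩
    rw [transvect_wedge, shear, h p φ hp, zero_smul, add_zero]
    exact LinearMap.mem_range_self _ _

theorem hasSingularInvariant_of_subspace {T : Vec → Vec → Prop} {Z : Submodule (ZMod 2) Vec}
    (hZ : Z ≠ ⊤) {u v : Vec} (hu : u ∈ Z) (hv : v ∈ Z) (hu0 : u ≠ 0) (hv0 : v ≠ 0) (huv : u ≠ v)
    (h : ∀ p φ, T p φ → ∀ z ∈ Z, shear p φ z ∈ Z) : HasSingularInvariant T := by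
  obtain ⟨χ, hχ, hχZ⟩ := exists_dotProduct_eq_zero_of_ne_top hZ
  let X : Set Biv := {w | ∃ x ∈ Z, ∃ y ∈ Z, wedge x y = w}
  have hX : Submodule.span (ZMod 2) X ≤ LinearMap.ker (contract χ) := by
    refine Submodule.span_le.2 ?_
    rintro _ ⟨x, hx, y, hy, rfl⟩
    rw [SetLike.mem_coe, LinearMap.mem_ker, contract_wedge, hχZ x hx, hχZ y hy, zero_smul,
      zero_smul, add_zero]
  refine ⟨Submodule.span (ZMod 2) X, (Submodule.ne_bot_iff _).2
    ⟨_, Submodule.subset_span ⟨u, hu, v, hv, rfl⟩, wedge_ne_zero hu0 hv0 huv⟩,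
    fun w hw => klein_eq_zero_of_contract hχ (hX hw), fun p φ hp w hw => transvect_mem_span ?_ hw⟩
  rintro _ ⟨x, hx, y, hy, rfl⟩
  exact Submodule.subset_span ⟨_, h p φ hp x hx, _, h p φ hp y hy, (transvect_wedge p φ x y).symm⟩

/-- All transvections with center `p` belong to `T`. -/
def IsFullCenter (T : Vec → Vec → Prop) (p : Vec) : Prop :=
  p ≠ 0 ∧ ∀ φ, φ ≠ 0 → φ ⬝ᵥ p = 0 → T p φ

namespace IsTransvectionSet

variable {T : Vec → Vec → Prop}

theorem isFullCenter_shear (hT : IsTransvectionSet T) {p q ψ : Vec} (hp : IsFullCenter T p)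
    (hq : T q ψ) : IsFullCenter T (shear q ψ p) := by
  have h := hT.flag hq
  have h' : q ⬝ᵥ ψ = 0 := (dotProduct_comm q ψ).trans h
  refine ⟨fun e => hp.1 (shear_injective h (e.trans (shear_zero q ψ).symm)), fun φ hφ hφp => ?_⟩
  have hne : shear ψ q φ ≠ 0 := fun e => hφ (shear_injective h' (e.trans (shear_zero ψ q).symm))
  have hd : shear ψ q φ ⬝ᵥ p = 0 := by
    rw [← shear_shear h p, shear_dotProduct_shear h, hφp]
  have := hT.conj hq (hp.2 _ hne hd)
  rwa [shear_shear h'] at this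

theorem isFullCenter_add (hT : IsTransvectionSet T) {p q : Vec} (hp : IsFullCenter T p)
    (hq : IsFullCenter T q) (h : p ≠ q) : IsFullCenter T (p + q) := by
  obtain ⟨ψ, hψp, hψq⟩ := exists_dotProduct_eq_zero_one hq.1 h
  have hψ : ψ ≠ 0 := by
    rintro rfl
    exact zero_ne_one ((zero_dotProduct q).symm.trans hψq)
  have := hT.isFullCenter_shear hq (hp.2 ψ hψ hψp)
  rwa [shear, hψq, one_smul, add_comm] at this

theorem all_or_hasSingularInvariant (hT : IsTransvectionSet T) {p : Vec}
    (hp : IsFullCenter T p) :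
    (∀ p φ, p ≠ 0 → φ ≠ 0 → φ ⬝ᵥ p = 0 → T p φ) ∨ HasSingularInvariant T := by
  let Z := insertZero (IsFullCenter T) fun x y => hT.isFullCenter_add
  have hinv : ∀ q ψ, T q ψ → ∀ z ∈ Z, shear q ψ z ∈ Z := by
    rintro q ψ hq z (rfl | hz)
    · exact Or.inl (shear_zero q ψ)
    · exact Or.inr (hT.isFullCenter_shear hz hq)
  by_cases hZ : Z = ⊤
  · refine Or.inl fun q φ hq => ?_
    have : q ∈ Z := hZ ▸ Submodule.mem_top
    exact (this.resolve_left hq).2 φ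
  right
  by_cases huniq : ∃ q, IsFullCenter T q ∧ q ≠ p
  · obtain ⟨q, hq, hqp⟩ := huniq
    exact hasSingularInvariant_of_subspace hZ (Or.inr hq) (Or.inr hp) hq.1 hp.1 hqp hinv
  · push Not at huniq
    refine hasSingularInvariant_of_fixed hp.1 fun q ψ hq => ?_
    have := huniq _ (hT.isFullCenter_shear hp hq)
    rw [shear, add_eq_left, smul_eq_zero] at this
    exact this.resolve_right (hT.center_ne hq)

/-- The axes of the transvections in `T` with a given center. -/
def axes (hT : IsTransvectionSet T) (p : Vec) : Submodule (ZMod 2) Vec :=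
  insertZero (T p) fun _ _ => hT.add

theorem dotProduct_eq_zero_of_mem_axes (hT : IsTransvectionSet T) {p φ : Vec}
    (hφ : φ ∈ hT.axes p) : φ ⬝ᵥ p = 0 := by
  rcases hφ with rfl | hφ
  · exact zero_dotProduct p
  · exact hT.flag hφ

theorem shear_mem_axes (hT : IsTransvectionSet T) {p φ q ψ : Vec} (hψ : T q ψ)
    (hφ : φ ∈ hT.axes p) : shear ψ q φ ∈ hT.axes (shear q ψ p) := by
  rcases hφ with rfl | hφ
  · exact Or.inl (shear_zero ψ q)
  · exact Or.inr (hT.conj hψ hφ)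

theorem isFullCenter_of_linearIndependent (hT : IsTransvectionSet T) {r : Vec} (hr : r ≠ 0)
    {v : Fin 3 → Vec} (hv : LinearIndependent (ZMod 2) v) (hvr : ∀ i, v i ∈ hT.axes r) :
    IsFullCenter T r := by
  let ℓ := dotProductEquiv (ZMod 2) (Fin 4) r
  have hℓ : ℓ ≠ 0 := (LinearEquiv.map_ne_zero_iff _).2 hr
  have hle : hT.axes r ≤ LinearMap.ker ℓ := fun φ hφ =>
    (dotProduct_comm r φ).trans (hT.dotProduct_eq_zero_of_mem_axes hφ)
  have hdim : finrank (ZMod 2) (LinearMap.ker ℓ) ≤ finrank (ZMod 2) (hT.axes r) := by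
    have h3 := Submodule.finrank_mono (Submodule.span_le.2 (Set.range_subset_iff.2 hvr))
    rw [finrank_span_eq_card hv, Fintype.card_fin] at h3
    have h4 := Module.Dual.finrank_ker_add_one_of_ne_zero hℓ
    rw [finrank_fin_fun] at h4
    omega
  refine ⟨hr, fun φ hφ hφr => ?_⟩
  have : φ ∈ hT.axes r := by
    rw [Submodule.eq_of_le_of_finrank_le hle hdim]
    exact (dotProduct_comm r φ).trans hφr
  exact this.resolve_left hφ

end IsTransvectionSet

theorem exists_mem_dotProduct_eq_one {P P' : Submodule (ZMod 2) Vec} (hPP' : P ⊔ P' = ⊤) {q : Vec}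
    (hq : q ≠ 0) (hP' : ∀ φ ∈ P', φ ⬝ᵥ q = 0) : ∃ φ ∈ P, φ ⬝ᵥ q = 1 := by
  obtain ⟨x, hx⟩ := exists_dotProduct_eq_one hq
  obtain ⟨φ, hφ, ψ, hψ, rfl⟩ := Submodule.mem_sup.1 (hPP' ▸ Submodule.mem_top : x ∈ P ⊔ P')
  rw [add_dotProduct, hP' ψ hψ, add_zero] at hx
  exact ⟨φ, hφ, hx⟩

theorem linearIndependent_of_disjoint {P P' : Submodule (ZMod 2) Vec} (hPP' : Disjoint P P')
    {p q φ φ' ψ ψ' : Vec} (hφ : φ ∈ P) (hφ' : φ' ∈ P) (hψ : ψ ∈ P') (hψ' : ψ' ∈ P') (hφ0 : φ ≠ 0)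
    (hψ0 : ψ ≠ 0) (hφq : φ ⬝ᵥ q = 0) (hφ'q : φ' ⬝ᵥ q = 1) (hψp : ψ ⬝ᵥ p = 0)
    (hψ'p : ψ' ⬝ᵥ p = 1) : LinearIndependent (ZMod 2) ![φ, ψ, φ' + ψ'] := by
  have cancel : ∀ {r χ χ' : Vec} {a c : ZMod 2}, χ ≠ 0 → χ ⬝ᵥ r = 0 → χ' ⬝ᵥ r = 1 →
      a • χ + c • χ' = 0 → a = 0 ∧ c = 0 := by
    intro r χ χ' a c hχ hχr hχ'r e
    have hc : c = 0 := by simpa [add_dotProduct, hχr, hχ'r] using congr($e ⬝ᵥ r)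
    rw [hc, zero_smul, add_zero, smul_eq_zero] at e
    exact ⟨e.resolve_right hχ, hc⟩
  rw [Fintype.linearIndependent_iff]
  intro g e
  simp only [Fin.sum_univ_three, Matrix.cons_val_zero, Matrix.cons_val_one, Matrix.cons_val] at e
  have hsum : (g 0 • φ + g 2 • φ') + (g 1 • ψ + g 2 • ψ') = 0 := by
    rw [← e, smul_add]
    abel
  have hP := P.add_mem (P.smul_mem (g 0) hφ) (P.smul_mem (g 2) hφ')
  have hP' := P'.add_mem (P'.smul_mem (g 1) hψ) (P'.smul_mem (g 2) hψ')
  have heq := add_eq_zero_iff_eq_of_zmod_two.1 hsum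
  have hzero := Submodule.disjoint_def.1 hPP' _ hP (heq ▸ hP')
  obtain ⟨h0, h2⟩ := cancel hφ0 hφq hφ'q hzero
  obtain ⟨h1, -⟩ := cancel hψ0 hψp hψ'p (heq ▸ hzero)
  intro i
  fin_cases i <;> assumption

namespace IsTransvectionSet

variable {T : Vec → Vec → Prop}

/-- Conjugating by transvections from one plane of axes, those from the other plane and back, moves
both centers to `p + q`, where three independent axes appear. -/
theorem exists_isFullCenter (hT : IsTransvectionSet T) {p q : Vec}
    {P P' : Submodule (ZMod 2) Vec} (hP : P ≤ hT.axes p) (hP' : P' ≤ hT.axes q)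
    (hPP' : Disjoint P P') (hdim : 2 ≤ finrank (ZMod 2) P) (hdim' : 2 ≤ finrank (ZMod 2) P')
    (hp : p ≠ 0) (hq : q ≠ 0) : ∃ r, IsFullCenter T r := by
  have htop : P ⊔ P' = ⊤ := Submodule.eq_top_of_disjoint P P'
    (by rw [finrank_fin_fun]; omega) hPP'
  obtain ⟨φ', hφ', hφ'q⟩ := exists_mem_dotProduct_eq_one htop hq
    fun φ hφ => hT.dotProduct_eq_zero_of_mem_axes (hP' hφ)
  obtain ⟨ψ', hψ', hψ'p⟩ := exists_mem_dotProduct_eq_one (sup_comm P P' ▸ htop) hp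
    fun φ hφ => hT.dotProduct_eq_zero_of_mem_axes (hP hφ)
  obtain ⟨φ, hφ, hφ0, hφq⟩ := exists_ne_zero_dotProduct_eq_zero hdim q
  obtain ⟨ψ, hψ, hψ0, hψp⟩ := exists_ne_zero_dotProduct_eq_zero hdim' p
  have ne_zero : ∀ {r χ : Vec}, χ ⬝ᵥ r = 1 → χ ≠ 0 := by
    rintro r χ h rfl
    exact zero_ne_one ((zero_dotProduct r).symm.trans h)
  have hTφ' : T p φ' := (hP hφ').resolve_left (ne_zero hφ'q)
  have hTψ' : T q ψ' := (hP' hψ').resolve_left (ne_zero hψ'p)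
  have hcenter : shear p φ' q = p + q := by rw [shear, hφ'q, one_smul, add_comm]
  have hcenter' : shear q ψ' p = p + q := by rw [shear, hψ'p, one_smul]
  have hφr : φ ∈ hT.axes (p + q) := by
    have := hT.shear_mem_axes hTψ' (hP hφ)
    rwa [hcenter', shear, dotProduct_comm, hφq, zero_smul, add_zero] at this
  have hψr : ψ ∈ hT.axes (p + q) := by
    have := hT.shear_mem_axes hTφ' (hP' hψ)
    rwa [hcenter, shear, dotProduct_comm, hψp, zero_smul, add_zero] at this
  have hsum : φ' + ψ' ∈ hT.axes (p + q) := by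
    have := hT.shear_mem_axes hTψ' (hP hφ')
    rwa [hcenter', shear, dotProduct_comm, hφ'q, one_smul] at this
  have hr : p + q ≠ 0 := fun e => by
    rw [add_eq_zero_iff_eq_of_zmod_two.1 e, hT.flag hTψ'] at hψ'p
    exact zero_ne_one hψ'p
  exact ⟨p + q, hT.isFullCenter_of_linearIndependent hr
    (linearIndependent_of_disjoint hPP' hφ hφ' hψ hψ' hφ0 hψ0 hφq hφ'q hψp hψ'p)
    fun i => by fin_cases i <;> assumption⟩

theorem hasSingularInvariant_of_two_axes (hT : IsTransvectionSet T)
    (hfull : ∀ r, ¬IsFullCenter T r) {p α β : Vec} (hα : T p α) (hβ : T p β) (hαβ : α ≠ β) :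
    HasSingularInvariant T := by
  -- In Plücker terms, the planes which are the intersection of two axes with the same center.
  let X : Set Biv := {w | ∃ p α β, T p α ∧ T p β ∧ α ≠ β ∧ contract α w = 0 ∧ contract β w = 0}
  have hXdim : ∀ w p α β, T p α → T p β → α ≠ β → contract α w = 0 → contract β w = 0 →
      2 ≤ finrank (ZMod 2) (hT.axes p ⊓ annihilator w : Submodule (ZMod 2) Vec) :=
    fun w p α β hα hβ hαβ hαw hβw => two_le_finrank_of_ne ⟨Or.inr hα, hαw⟩ ⟨Or.inr hβ, hβw⟩
      (hT.axis_ne hα) (hT.axis_ne hβ) hαβ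
  refine ⟨Submodule.span (ZMod 2) X, ?_, fun w hw => eq_zero_of_mem_span klein ?_ ?_ hw,
    fun q ψ hq w hw => transvect_mem_span ?_ hw⟩
  · obtain ⟨w, hw, hαw, hβw⟩ := exists_ne_zero_contract_eq_zero α β
    exact (Submodule.ne_bot_iff _).2
      ⟨w, Submodule.subset_span ⟨p, α, β, hα, hβ, hαβ, hαw, hβw⟩, hw⟩
  · rintro x ⟨p, α, -, hα, -, -, hαx, -⟩
    exact klein_eq_zero_of_contract (hT.axis_ne hα) hαx
  · rintro x ⟨p, α, β, hα, hβ, hαβ, hαx, hβx⟩ y ⟨q, α', β', hα', hβ', hαβ', hαy, hβy⟩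
    by_contra hxy
    obtain ⟨r, hr⟩ := hT.exists_isFullCenter inf_le_left inf_le_left
      ((disjoint_annihilator hxy).mono inf_le_right inf_le_right)
      (hXdim x p α β hα hβ hαβ hαx hβx) (hXdim y q α' β' hα' hβ' hαβ' hαy hβy)
      (hT.center_ne hα) (hT.center_ne hα')
    exact hfull r hr
  · rintro x ⟨p, α, β, hα, hβ, hαβ, hαx, hβx⟩
    have h := hT.flag hq
    refine Submodule.subset_span ⟨_, _, _, hT.conj hq hα, hT.conj hq hβ, fun e => hαβ ?_, ?_, ?_⟩
    · exact shear_injective ((dotProduct_comm q ψ).trans h) e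
    · rw [contract_transvect h, hαx, shear_zero]
    · rw [contract_transvect h, hβx, shear_zero]

theorem dotProduct_comm_of_unique_axis (hT : IsTransvectionSet T)
    (huniq : ∀ p φ ψ, T p φ → T p ψ → φ = ψ) {p φ q ψ : Vec} (hp : T p φ) (hq : T q ψ) :
    φ ⬝ᵥ q = ψ ⬝ᵥ p := by
  have aux : ∀ {p φ q ψ}, T p φ → T q ψ → ψ ⬝ᵥ p = 0 → φ ⬝ᵥ q = 0 := by
    intro p φ q ψ hp hq h
    have hconj := hT.conj hq hp
    rw [shear, h, zero_smul, add_zero] at hconj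
    have := huniq _ _ _ hconj hp
    rw [shear, add_eq_left, smul_eq_zero, dotProduct_comm] at this
    exact this.resolve_right (hT.axis_ne hq)
  rcases zmod_cases (φ ⬝ᵥ q) with hφq | hφq
  · rw [hφq, aux hq hp hφq]
  · rcases zmod_cases (ψ ⬝ᵥ p) with hψp | hψp
    · rw [hψp, aux hp hq hψp]
    · rw [hφq, hψp]

end IsTransvectionSet

/-- An alternating relation defined everywhere is the graph of an alternating map, hence given by
contraction with a bivector. -/
theorem exists_contract_eq_of_alternating {R : Submodule (ZMod 2) (Vec × Vec)}
    (hR : ∀ x ∈ R, x.1 ⬝ᵥ x.2 = 0) (htop : R.map (LinearMap.fst (ZMod 2) Vec Vec) = ⊤) :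
    ∃ w, ∀ x ∈ R, contract x.1 w = x.2 := by
  have hsurj : ∀ ψ : Vec, ∃ y ∈ R, y.1 = ψ := fun ψ => by
    simpa using (htop ▸ Submodule.mem_top : ψ ∈ R.map (LinearMap.fst (ZMod 2) Vec Vec))
  have hinj : ∀ x ∈ R, x.1 = 0 → x.2 = 0 := by
    intro x hx hx1
    refine dotProduct_eq_zero x.2 fun ψ => ?_
    obtain ⟨y, hy, rfl⟩ := hsurj ψ
    have := hR _ (add_mem hx hy)
    rw [Prod.fst_add, Prod.snd_add, hx1, zero_add, dotProduct_add, hR y hy, add_zero] at this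
    rwa [dotProduct_comm]
  obtain ⟨f, rfl⟩ : ∃ f : Vec →ₗ[ZMod 2] Vec, R = LinearMap.graph f := by
    refine Submodule.exists_eq_graph ⟨fun x y hxy => Subtype.ext (Prod.ext hxy ?_), fun ψ => ?_⟩
    · exact sub_eq_zero.1 (hinj _ (sub_mem x.2 y.2) (sub_eq_zero.2 hxy))
    · obtain ⟨y, hy, hyψ⟩ := hsurj ψ
      exact ⟨⟨y, hy⟩, hyψ⟩
  obtain ⟨w, hw⟩ := exists_contract_eq f fun φ => hR (φ, f φ) rfl
  exact ⟨w, fun x hx => (hw x.1).trans hx.symm⟩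

namespace IsTransvectionSet

variable {T : Vec → Vec → Prop}

theorem hasSingularInvariant_or_fixed_of_unique_axis (hT : IsTransvectionSet T)
    (huniq : ∀ p φ ψ, T p φ → T p ψ → φ = ψ) {p₀ φ₀ : Vec} (h₀ : T p₀ φ₀) :
    HasSingularInvariant T ∨ ∃ w, w ≠ 0 ∧ ∀ p φ, T p φ → transvect p φ w = w := by
  set X : Set (Vec × Vec) := {x | T x.2 x.1}
  -- The relation spanned by the pairs (axis, center) is totally singular for `(φ, p) ↦ φ ⬝ᵥ p`.
  let pairing : QuadraticForm (ZMod 2) (Vec × Vec) := LinearMap.BilinMap.toQuadraticMap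
    ((dotProductEquiv (ZMod 2) (Fin 4)).toLinearMap.compl₁₂ (LinearMap.fst _ _ _)
      (LinearMap.snd _ _ _))
  have halt : ∀ x ∈ Submodule.span (ZMod 2) X, x.1 ⬝ᵥ x.2 = 0 := by
    refine fun x => eq_zero_of_mem_span pairing (fun y hy => hT.flag hy) fun y hy z hz => ?_
    have hyy : y.1 ⬝ᵥ y.2 = 0 := hT.flag hy
    have hzz : z.1 ⬝ᵥ z.2 = 0 := hT.flag hz
    have hyz : y.1 ⬝ᵥ z.2 = z.1 ⬝ᵥ y.2 := hT.dotProduct_comm_of_unique_axis huniq hy hz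
    change (y.1 + z.1) ⬝ᵥ (y.2 + z.2) - y.1 ⬝ᵥ y.2 - z.1 ⬝ᵥ z.2 = 0
    rw [add_dotProduct, dotProduct_add, dotProduct_add, hyy, hzz, hyz, zero_add, add_zero, sub_zero,
      sub_zero, CharTwo.add_self_eq_zero]
  by_cases htop : (Submodule.span (ZMod 2) X).map (LinearMap.fst (ZMod 2) Vec Vec) = ⊤
  · obtain ⟨w, hw⟩ := exists_contract_eq_of_alternating halt htop
    have hcontract : ∀ p φ, T p φ → contract φ w = p := fun p φ h =>
      hw (φ, p) (Submodule.subset_span h)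
    refine Or.inr ⟨w, ?_, fun p φ h => ?_⟩
    · rintro rfl
      exact hT.center_ne h₀ ((hcontract p₀ φ₀ h₀).symm.trans (map_zero _))
    · rw [transvect_apply, hcontract p φ h, wedge_self, add_zero]
  · obtain ⟨χ, hχ, h⟩ := exists_dotProduct_eq_zero_of_ne_top htop
    refine Or.inl (hasSingularInvariant_of_fixed hχ fun p φ hp => ?_)
    rw [dotProduct_comm]
    exact h φ ⟨(φ, p), Submodule.subset_span hp, rfl⟩

theorem trichotomy (hT : IsTransvectionSet T) {p₀ φ₀ : Vec} (h₀ : T p₀ φ₀) :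
    (∀ p φ, p ≠ 0 → φ ≠ 0 → φ ⬝ᵥ p = 0 → T p φ) ∨ HasSingularInvariant T ∨
      ∃ w, w ≠ 0 ∧ ∀ p φ, T p φ → transvect p φ w = w := by
  by_cases hfull : ∃ r, IsFullCenter T r
  · obtain ⟨r, hr⟩ := hfull
    exact (hT.all_or_hasSingularInvariant hr).imp_right Or.inl
  push Not at hfull
  right
  by_cases htwo : ∃ p φ ψ, T p φ ∧ T p ψ ∧ φ ≠ ψ
  · obtain ⟨p, φ, ψ, hφ, hψ, h⟩ := htwo
    exact Or.inl (hT.hasSingularInvariant_of_two_axes hfull hφ hψ h)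
  · push Not at htwo
    exact hT.hasSingularInvariant_or_fixed_of_unique_axis htwo h₀

end IsTransvectionSet

/-! ### Siegel transformations over the field with two elements -/

section Isometries

variable {V : Type*} [AddCommGroup V] [Module (ZMod 2) V] {q : QuadraticForm (ZMod 2) V}

theorem polar_self_eq_zero (x : V) : polar q x x = 0 := by
  rw [QuadraticMap.polar_self, two_smul, CharTwo.add_self_eq_zero]

theorem exists_polar_eq_one (hq : q.polarBilin.Nondegenerate) {v : V} (hv : v ≠ 0) :
    ∃ x, polar q x v = 1 :=
  exists_apply_eq_one hq.2 hv

theorem exists_polar_eq_zero_one (hq : q.polarBilin.Nondegenerate) {u v : V} (hv : v ≠ 0)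
    (huv : u ≠ v) : ∃ x, polar q x u = 0 ∧ polar q x v = 1 :=
  exists_apply_eq_zero_one hq.2 hv huv

theorem ne_zero_of_eq_one {v : V} (hv : q v = 1) : v ≠ 0 := by
  rintro rfl
  exact zero_ne_one ((QuadraticMap.map_zero q).symm.trans hv)

theorem polar_map_of_mem_isometryGroup {g : V ≃ₗ[ZMod 2] V} (hg : g ∈ IsometryGroup q) (x y : V) :
    polar q (g x) (g y) = polar q x y := by
  rw [polar, polar, ← map_add, hg, hg, hg]

/-- The vectors `s` and `a` span a totally singular plane. -/
structure IsSingularPlane (q : QuadraticForm (ZMod 2) V) (s a : V) : Prop where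
  left : q s = 0
  right : q a = 0
  orthogonal : polar q s a = 0
  left_ne : s ≠ 0
  right_ne : a ≠ 0
  ne : s ≠ a

theorem isSingularPlane_of_polar {s a x : V} (hs : q s = 0) (ha : q a = 0) (h : polar q s a = 0)
    (hs0 : s ≠ 0) (hxs : polar q x s = 0) (hxa : polar q x a = 1) : IsSingularPlane q s a := by
  refine ⟨hs, ha, h, hs0, ?_, ?_⟩
  · rintro rfl
    exact zero_ne_one ((QuadraticMap.polar_zero_right q x).symm.trans hxa)
  · rintro rfl
    exact zero_ne_one (hxs.symm.trans hxa)

variable (q) in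
/-- The orthogonal transvection in the direction of `v`; over `𝔽₂` these take the place of the
reflections. -/
noncomputable def reflect (v : V) : V ≃ₗ[ZMod 2] V :=
  LinearEquiv.ofInvolutive (LinearMap.id + (q.polarBilin.flip v).smulRight v) fun x => by
    change x + polar q x v • v + polar q (x + polar q x v • v) v • v = x
    rw [QuadraticMap.polar_add_left, QuadraticMap.polar_smul_left, polar_self_eq_zero, smul_zero,
      add_zero, add_assoc, ZModModule.add_self, add_zero]

theorem reflect_apply (v x : V) : reflect q v x = x + polar q x v • v := rfl

theorem reflect_mul_self (v : V) : reflect q v * reflect q v = 1 :=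
  LinearEquiv.ext (reflect q v).symm_apply_apply

/-- The Siegel transformation of a totally singular plane. -/
noncomputable def siegel {s a : V} (h : IsSingularPlane q s a) : V ≃ₗ[ZMod 2] V :=
  LinearEquiv.ofInvolutive (LinearMap.id + ((q.polarBilin.flip s).smulRight a +
      (q.polarBilin.flip a).smulRight s)) fun x => by
    change x + (polar q x s • a + polar q x a • s) +
      (polar q (x + (polar q x s • a + polar q x a • s)) s • a +
        polar q (x + (polar q x s • a + polar q x a • s)) a • s) = x
    simp only [QuadraticMap.polar_add_left, QuadraticMap.polar_smul_left, polar_self_eq_zero,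
      h.orthogonal, QuadraticMap.polar_comm q a s, smul_zero, add_zero]
    rw [add_assoc, ZModModule.add_self, add_zero]

theorem siegel_apply {s a : V} (h : IsSingularPlane q s a) (x : V) :
    siegel h x = x + (polar q x s • a + polar q x a • s) := rfl

variable (q) in
/-- The Siegel transformations of totally singular planes. -/
def IsSiegel (g : V ≃ₗ[ZMod 2] V) : Prop :=
  ∃ (s a : V) (h : IsSingularPlane q s a), g = siegel h

theorem isSiegel_siegel {s a : V} (h : IsSingularPlane q s a) : IsSiegel q (siegel h) :=
  ⟨s, a, h, rfl⟩

theorem reflect_mem_isometryGroup {v : V} (hv : q v = 1) : reflect q v ∈ IsometryGroup q := by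
  intro x
  rw [reflect_apply, QuadraticMap.map_add q, QuadraticMap.map_smul, hv,
    QuadraticMap.polar_smul_right]
  rcases zmod_cases (polar q x v) with h | h <;> rw [h]
  · simp only [zero_mul, zero_smul, add_zero]
  · rw [one_smul, mul_one, one_smul, add_assoc, CharTwo.add_self_eq_zero, add_zero]

theorem dicksonInvariant_reflect (hq : q.polarBilin.Nondegenerate) {v : V} (hv : v ≠ 0) :
    dicksonInvariant (reflect q v) = 1 := by
  have sub_apply : ∀ x, ((reflect q v : V →ₗ[ZMod 2] V) - LinearMap.id : V →ₗ[ZMod 2] V) x =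
      polar q x v • v := fun x => add_sub_cancel_left _ _
  have range : LinearMap.range ((reflect q v : V →ₗ[ZMod 2] V) - LinearMap.id) =
      Submodule.span (ZMod 2) {v} := by
    apply le_antisymm
    · rintro _ ⟨x, rfl⟩
      rw [sub_apply]
      exact Submodule.smul_mem _ _ (Submodule.mem_span_singleton_self _)
    · rw [Submodule.span_singleton_le_iff_mem]
      obtain ⟨x, hx⟩ := exists_polar_eq_one hq hv
      exact ⟨x, by rw [sub_apply, hx, one_smul]⟩
  rw [dicksonInvariant, range, finrank_span_singleton hv, Nat.cast_one]

theorem siegel_mem_isometryGroup {s a : V} (h : IsSingularPlane q s a) :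
    siegel h ∈ IsometryGroup q := by
  intro x
  rw [siegel_apply]
  simp only [QuadraticMap.map_add q, QuadraticMap.map_smul, QuadraticMap.polar_add_right,
    QuadraticMap.polar_smul_right, QuadraticMap.polar_smul_left, h.left, h.right, h.orthogonal,
    QuadraticMap.polar_comm q a s, mul_zero, add_zero, smul_eq_mul]
  rw [mul_comm (polar q x a), CharTwo.add_self_eq_zero, add_zero]

theorem dicksonInvariant_siegel (hq : q.polarBilin.Nondegenerate) {s a : V}
    (h : IsSingularPlane q s a) : dicksonInvariant (siegel h) = 0 := by
  have sub_apply : ∀ x, ((siegel h : V →ₗ[ZMod 2] V) - LinearMap.id : V →ₗ[ZMod 2] V) x =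
      polar q x s • a + polar q x a • s := fun x => add_sub_cancel_left _ _
  have range : LinearMap.range ((siegel h : V →ₗ[ZMod 2] V) - LinearMap.id) =
      Submodule.span (ZMod 2) (Set.range ![s, a]) := by
    rw [Matrix.range_cons_cons_empty]
    apply le_antisymm
    · rintro _ ⟨x, rfl⟩
      rw [sub_apply, add_comm]
      exact Submodule.mem_span_pair.2 ⟨_, _, rfl⟩
    · refine Submodule.span_le.2 (Set.pair_subset ?_ ?_)
      · obtain ⟨x, hx, hx'⟩ := exists_polar_eq_zero_one hq h.right_ne h.ne
        exact ⟨x, by rw [sub_apply, hx, hx', one_smul, zero_smul, zero_add]⟩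
      · obtain ⟨x, hx, hx'⟩ := exists_polar_eq_zero_one hq h.left_ne h.ne.symm
        exact ⟨x, by rw [sub_apply, hx, hx', one_smul, zero_smul, add_zero]⟩
  rw [dicksonInvariant, range,
    finrank_span_eq_card (linearIndependent_pair_of_ne h.left_ne h.right_ne h.ne)]
  decide

theorem reflect_add_apply {v w : V} (h : polar q v w = 1) : reflect q (v + w) v = w := by
  rw [reflect_apply, QuadraticMap.polar_add_right, polar_self_eq_zero, h, zero_add, one_smul,
    ← add_assoc, ZModModule.add_self, zero_add]

theorem reflect_add_apply_of_polar_eq {v w x : V} (h : polar q v x = polar q w x) :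
    reflect q (v + w) x = x := by
  rw [reflect_apply, QuadraticMap.polar_comm, QuadraticMap.polar_add_left, h,
    CharTwo.add_self_eq_zero, zero_smul, add_zero]

theorem apply_add_eq_one {v w : V} (hv : q v = 1) (hw : q w = 1) (h : polar q v w = 1) :
    q (v + w) = 1 := by
  rw [QuadraticMap.map_add q, hv, hw, h, add_assoc, CharTwo.add_self_eq_zero, add_zero]

variable (q) in
/-- The group generated by the orthogonal transvections. -/
def reflectionGroup : Subgroup (V ≃ₗ[ZMod 2] V) :=
  Subgroup.closure (reflect q '' {v | q v = 1})

theorem reflect_mem_reflectionGroup {v : V} (hv : q v = 1) : reflect q v ∈ reflectionGroup q :=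
  Subgroup.subset_closure ⟨v, hv, rfl⟩

theorem reflectionGroup_le : reflectionGroup q ≤ IsometryGroup q := by
  rw [reflectionGroup, Subgroup.closure_le]
  rintro _ ⟨v, hv, rfl⟩
  exact reflect_mem_isometryGroup hv

/-- Witt's argument: if reflections can correct the images of the basis vectors `w k` one at a time,
then they generate the orthogonal group. -/
theorem isometryGroup_le_reflectionGroup {n : ℕ} {w : Fin n → V} (hw : Function.Injective w)
    (hspan : Submodule.span (ZMod 2) (Set.range w) = ⊤)
    (hstep : ∀ k v, q v = q (w k) →
      (∀ j < k, polar q v (w j) = polar q (w k) (w j) ∧ v ≠ w j) →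
      ∃ h ∈ reflectionGroup q, h v = w k ∧ ∀ j < k, h (w j) = w j) :
    IsometryGroup q ≤ reflectionGroup q := by
  suffices ∀ m k : ℕ, m + k = n → ∀ g ∈ IsometryGroup q, (∀ j : Fin n, j < k → g (w j) = w j) →
      g ∈ reflectionGroup q from
    fun g hg => this n 0 (add_zero n) g hg fun j hj => absurd hj (Nat.not_lt_zero _)
  intro m
  induction m with
  | zero =>
    intro k hk g _ hfix
    have : g = 1 := LinearEquiv.toLinearMap_injective <|
      LinearMap.ext_on_range hspan fun j => hfix j (by omega)
    exact this ▸ one_mem _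
  | succ m ih =>
    intro k hk g hg hfix
    let i : Fin n := ⟨k, by omega⟩
    obtain ⟨h, hh, hi, hj⟩ := hstep i (g (w i)) (hg _) fun j hj => by
      refine ⟨?_, fun e => hj.ne (hw (g.injective ?_))⟩
      · conv_lhs => rw [← hfix j hj, polar_map_of_mem_isometryGroup hg]
      · rw [hfix j hj, e]
    have := ih (k + 1) (by omega) (h * g) (mul_mem (reflectionGroup_le hh) hg) fun j hjk => by
      rw [LinearEquiv.mul_apply]
      rcases (Nat.lt_succ_iff_lt_or_eq.1 hjk) with hjk | hjk
      · rw [hfix j hjk, hj j hjk]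
      · rw [show j = i from Fin.ext hjk, hi]
    exact ((reflectionGroup q).mul_mem_cancel_left hh).1 this

theorem reflect_mul_reflect_eq {v w a : V} (hvw : polar q v w = 0) (ha : polar q (v + w) a = 0)
    (hva : polar q v a = 1) (h₁ : IsSingularPlane q (v + w) a)
    (h₂ : IsSingularPlane q (v + w) (v + a)) :
    reflect q v * reflect q w = siegel h₁ * siegel h₂ := by
  have hwa : polar q w a = 1 := by
    rw [QuadraticMap.polar_add_left, hva] at ha
    exact (add_eq_zero_iff_eq_of_zmod_two.1 ha).symm
  ext x
  rw [LinearEquiv.mul_apply, LinearEquiv.mul_apply]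
  simp only [reflect_apply, siegel_apply, QuadraticMap.polar_add_left,
    QuadraticMap.polar_add_right, QuadraticMap.polar_smul_left, polar_self_eq_zero, hvw, hva, hwa,
    QuadraticMap.polar_comm q w v, QuadraticMap.polar_comm q a v, QuadraticMap.polar_comm q a w]
  generalize polar q x v = α, polar q x w = β, polar q x a = γ
  match_scalars <;> (revert α β γ; decide)

end Isometries

section Generation

theorem mem_or_mul_mem_of_mem_closure {G : Type*} [Group G] {S : Set G} {Γ : Subgroup G}
    (hS : ∀ s ∈ S, s * s = 1) (hΓ : ∀ s ∈ S, ∀ t ∈ S, s * t ∈ Γ) {r g : G} (hr : r ∈ S)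
    (hg : g ∈ Subgroup.closure S) : g ∈ Γ ∨ r * g ∈ Γ := by
  have step : ∀ s ∈ S, ∀ g, g ∈ Γ ∨ r * g ∈ Γ → s * g ∈ Γ ∨ r * (s * g) ∈ Γ := by
    rintro s hs g (hg | hg)
    · exact Or.inr (mul_assoc r s g ▸ mul_mem (hΓ r hr s hs) hg)
    · have : s * r * (r * g) = s * g := by rw [mul_assoc, ← mul_assoc r, hS r hr, one_mul]
      exact Or.inl (this ▸ mul_mem (hΓ s hs r hr) hg)
  induction hg using Subgroup.closure_induction_left with
  | one => exact Or.inl (one_mem Γ)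
  | mul_left s hs g _ h => exact step s hs g h
  | inv_mul_cancel s hs g _ h =>
    rw [inv_eq_of_mul_eq_one_left (hS s hs)]
    exact step s hs g h

theorem specialIsometryGroup_le {V : Type*} [AddCommGroup V] [Module (ZMod 2) V]
    [FiniteDimensional (ZMod 2) V] {q : QuadraticForm (ZMod 2) V} (hq : q.polarBilin.Nondegenerate)
    (hgen : IsometryGroup q ≤ reflectionGroup q) {Γ : Subgroup (V ≃ₗ[ZMod 2] V)}
    (hΓ : ∀ v w, q v = 1 → q w = 1 → reflect q v * reflect q w ∈ Γ) {r : V} (hr : q r = 1) :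
    SpecialIsometryGroup q hq ≤ Γ := by
  have reflect_inv (v : V) : (reflect q v)⁻¹ = reflect q v :=
    inv_eq_of_mul_eq_one_left (reflect_mul_self v)
  have dickson_mul {v : V} (hv : q v = 1) {g : V ≃ₗ[ZMod 2] V} (hg : g ∈ IsometryGroup q) :
      dicksonInvariant (reflect q v * g) = dicksonInvariant g + 1 := by
    rw [← dicksonInvariant_reflect hq (ne_zero_of_eq_one hv),
      ← dicksonInvariant_inv_mul q hq hg (reflect_mem_isometryGroup hv), reflect_inv]
  rintro g ⟨hg, hg0⟩
  have mem_or_mul_mem := mem_or_mul_mem_of_mem_closure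
    (S := reflect q '' {v | q v = 1}) (Γ := Γ ⊓ SpecialIsometryGroup q hq)
    (by rintro _ ⟨v, -, rfl⟩; exact reflect_mul_self v)
    (by
      rintro _ ⟨v, hv, rfl⟩ _ ⟨w, hw, rfl⟩
      have hw' := reflect_mem_isometryGroup hw
      refine ⟨hΓ v w hv hw, mul_mem (reflect_mem_isometryGroup hv) hw', ?_⟩
      rw [dickson_mul hv hw', dicksonInvariant_reflect hq (ne_zero_of_eq_one hw),
        CharTwo.add_self_eq_zero])
    (Set.mem_image_of_mem _ hr) (hgen hg)
  rcases mem_or_mul_mem with h | h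
  · exact h.1
  · have : dicksonInvariant (reflect q r * g) = 0 := h.2.2
    rw [dickson_mul hr hg, hg0, zero_add] at this
    exact absurd this one_ne_zero

end Generation

section SingularImage

variable {V : Type*} [AddCommGroup V] [Module (ZMod 2) V] {q : QuadraticForm (ZMod 2) V}
  {S : V →ₗ[ZMod 2] V}

theorem polar_apply_apply_eq_zero (hS : ∀ x, q (S x) = 0) (x y : V) : polar q (S x) (S y) = 0 := by
  have := QuadraticMap.map_add q (S x) (S y)
  rwa [← map_add, hS, hS, hS, zero_add, zero_add, eq_comm] at this

theorem polar_sub_self_of_mem_isometryGroup {g : V ≃ₗ[ZMod 2] V} (hg : g ∈ IsometryGroup q)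
    {x : V} (hx : q (g x - x) = 0) : polar q (g x - x) x = 0 := by
  have := QuadraticMap.map_add q (g x - x) x
  rwa [hx, zero_add, sub_add_cancel, hg x, left_eq_add] at this

theorem polar_apply_comm (hS : ∀ x, polar q (S x) x = 0) (x y : V) :
    polar q (S x) y = polar q (S y) x := by
  have := hS (x + y)
  rwa [map_add, QuadraticMap.polar_add_left, QuadraticMap.polar_add_right,
    QuadraticMap.polar_add_right, hS, hS, zero_add, add_zero, add_eq_zero_iff_eq_of_zmod_two]
    at this

variable [FiniteDimensional (ZMod 2) V]

theorem even_finrank_range (hq : q.polarBilin.Nondegenerate) (hS : ∀ x, polar q (S x) x = 0) :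
    Even (finrank (ZMod 2) (LinearMap.range S)) := by
  obtain ⟨k, hk⟩ := exists_finrank_eq_finrank_ker_add _ (q.polarBilin ∘ₗ S) hS rfl
  have ker_eq : LinearMap.ker (q.polarBilin ∘ₗ S) = LinearMap.ker S :=
    LinearMap.ker_comp_of_ker_eq_bot _ (LinearMap.separatingLeft_iff_ker_eq_bot.1 hq.1)
  have rank_nullity := LinearMap.finrank_range_add_finrank_ker S
  rw [ker_eq] at hk
  exact ⟨k, by omega⟩

theorem two_mul_finrank_range_le (hq : q.polarBilin.Nondegenerate) (hS : ∀ x, q (S x) = 0) :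
    2 * finrank (ZMod 2) (LinearMap.range S) ≤ finrank (ZMod 2) V := by
  have orthogonal : LinearMap.range S ≤ LinearMap.BilinForm.orthogonal q.polarBilin
      (LinearMap.range S) := by
    rintro _ ⟨x, rfl⟩ _ ⟨y, rfl⟩
    exact polar_apply_apply_eq_zero hS y x
  have := Submodule.finrank_mono orthogonal
  rw [LinearMap.BilinForm.finrank_orthogonal hq] at this
  have := (LinearMap.range S).finrank_le
  omega

theorem range_eq_span_pair (hS : ∀ x, polar q (S x) x = 0)
    (hrank : finrank (ZMod 2) (LinearMap.range S) ≤ 2) {u v : V} (huv : polar q (S u) v = 1) :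
    LinearMap.range S = Submodule.span (ZMod 2) {S u, S v} := by
  have hvu : polar q (S v) u = 1 := (polar_apply_comm hS v u).trans huv
  have left_ne : S u ≠ 0 := fun h => by simp [h] at huv
  have right_ne : S v ≠ 0 := fun h => by simp [h] at hvu
  have ne : S u ≠ S v := fun h => by simp [h, hS v] at huv
  have independent := linearIndependent_pair_of_ne left_ne right_ne ne
  rw [← Matrix.range_cons_cons_empty _ _ ![]]
  have span_le : Submodule.span (ZMod 2) (Set.range ![S u, S v]) ≤ LinearMap.range S := by
    rw [Submodule.span_le, Matrix.range_cons_cons_empty, Set.pair_subset_iff]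
    exact ⟨⟨u, rfl⟩, ⟨v, rfl⟩⟩
  refine (Submodule.eq_of_le_of_finrank_le span_le ?_).symm
  rwa [finrank_span_eq_card independent, Fintype.card_fin]

theorem apply_eq_polar_smul_add (hS : ∀ x, polar q (S x) x = 0)
    (hrank : finrank (ZMod 2) (LinearMap.range S) ≤ 2) {u v : V} (huv : polar q (S u) v = 1)
    (x : V) : S x = polar q x (S u) • S v + polar q x (S v) • S u := by
  have hx : S x ∈ Submodule.span (ZMod 2) {S u, S v} :=
    range_eq_span_pair hS hrank huv ▸ LinearMap.mem_range_self S x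
  obtain ⟨c, d, hcd⟩ := Submodule.mem_span_pair.1 hx
  have coeff (y : V) : polar q x (S y) = c * polar q (S u) y + d * polar q (S v) y := by
    rw [QuadraticMap.polar_comm, polar_apply_comm hS, ← hcd, QuadraticMap.polar_add_left,
      QuadraticMap.polar_smul_left, QuadraticMap.polar_smul_left, smul_eq_mul, smul_eq_mul]
  rw [coeff, coeff, hS, hS, huv, polar_apply_comm hS v u, huv, ← hcd]
  simp only [mul_zero, mul_one, zero_add, add_zero]
  exact add_comm _ _

/- The image of `g - 1` is totally singular, hence of dimension at most three, and it carries the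
alternating form `(g x - x, y) ↦ polar q (g x - x) y`, hence is of even dimension: it is a plane. -/
theorem isSiegel_of_apply_sub_eq_zero (hq : q.polarBilin.Nondegenerate)
    (hV : finrank (ZMod 2) V < 8) {g : V ≃ₗ[ZMod 2] V} (hg : g ∈ IsometryGroup q) (hg1 : g ≠ 1)
    (hsub : ∀ x, q (g x - x) = 0) : IsSiegel q g := by
  let S : V →ₗ[ZMod 2] V := (g : V →ₗ[ZMod 2] V) - LinearMap.id
  have self_eq_zero : ∀ x, polar q (S x) x = 0 := fun x =>
    polar_sub_self_of_mem_isometryGroup hg (hsub x)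
  have hrank : finrank (ZMod 2) (LinearMap.range S) ≤ 2 := by
    have := two_mul_finrank_range_le (S := S) hq hsub
    obtain ⟨k, hk⟩ := even_finrank_range hq self_eq_zero
    omega
  obtain ⟨u, hu⟩ : ∃ u, S u ≠ 0 := by
    by_contra! h
    exact hg1 (LinearEquiv.ext fun x => sub_eq_zero.1 (h x))
  obtain ⟨v, hv⟩ := exists_polar_eq_one hq hu
  have huv : polar q (S u) v = 1 := (QuadraticMap.polar_comm _ _ _).trans hv
  have hvu : polar q u (S v) = 1 := by
    rw [QuadraticMap.polar_comm, polar_apply_comm self_eq_zero, huv]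
  have hplane : IsSingularPlane q (S u) (S v) :=
    isSingularPlane_of_polar (hsub u) (hsub v) (polar_apply_apply_eq_zero (S := S) hsub u v) hu
      ((QuadraticMap.polar_comm _ _ _).trans (self_eq_zero u)) hvu
  refine ⟨_, _, hplane, LinearEquiv.ext fun x => ?_⟩
  rw [siegel_apply, ← apply_eq_polar_smul_add self_eq_zero hrank huv]
  exact (add_sub_cancel x (g x)).symm

end SingularImage

/-! ### The Klein correspondence -/

section KleinQuadric

theorem separatingRight_polarBilin_klein : klein.polarBilin.SeparatingRight := by
  intro w h
  have h (i : Fin 6) : polar klein (Pi.single i 1) w = 0 := h _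
  ext i
  fin_cases i
  · simpa [polar_klein] using h 1
  · simpa [polar_klein] using h 0
  · simpa [polar_klein] using h 3
  · simpa [polar_klein] using h 2
  · simpa [polar_klein] using h 5
  · simpa [polar_klein] using h 4

set_option maxRecDepth 100000 in
theorem exists_contract_hodge_eq_zero : ∀ {s : Biv}, klein s = 0 → ∀ {a : Biv}, klein a = 0 →
    polar klein s a = 0 → ∃ p, p ≠ 0 ∧ contract p (hodge s) = 0 ∧ contract p (hodge a) = 0 := by
  simp only [klein_apply, polar_klein]
  decide +kernel

set_option maxRecDepth 100000 in
theorem exists_eq_wedge_of_contract_hodge : ∀ {p : Vec}, p ≠ 0 → ∀ {s : Biv},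
    contract p (hodge s) = 0 → ∃ x, s = wedge p x := by
  decide +kernel

/-- The functional `det (p, x, y, ·)`. -/
def triple (p x y : Vec) : Vec := contract y (hodge (wedge p x))

theorem triple_dotProduct (p x y : Vec) : triple p x y ⬝ᵥ p = 0 := by
  simp [triple, hodge, contract_apply, wedge_apply, dotProduct, Fin.sum_univ_succ]
  grind

theorem contract_triple (p x y : Vec) (w : Biv) :
    contract (triple p x y) w = polar klein w (wedge p x) • y + polar klein w (wedge p y) • x +
      polar klein w (wedge x y) • p := by
  ext i
  fin_cases i <;> simp [triple, hodge, contract_apply, wedge_apply, polar_klein] <;> grind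

theorem transvect_triple {p x y : Vec} (h : IsSingularPlane klein (wedge p x) (wedge p y))
    (w : Biv) : transvect p (triple p x y) w = siegel h w := by
  rw [transvect_apply, contract_triple, siegel_apply]
  simp only [map_add, map_smul, wedge_self, smul_zero, add_zero]

theorem exists_transvect_eq_siegel {s a : Biv} (h : IsSingularPlane klein s a) :
    ∃ p φ : Vec, p ≠ 0 ∧ φ ≠ 0 ∧ φ ⬝ᵥ p = 0 ∧ ∀ w, transvect p φ w = siegel h w := by
  obtain ⟨p, hp, hs, ha⟩ := exists_contract_hodge_eq_zero h.left h.right h.orthogonal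
  obtain ⟨x, rfl⟩ := exists_eq_wedge_of_contract_hodge hp hs
  obtain ⟨y, rfl⟩ := exists_eq_wedge_of_contract_hodge hp ha
  refine ⟨p, triple p x y, hp, fun h0 => h.right_ne ?_, triple_dotProduct p x y,
    transvect_triple h⟩
  obtain ⟨w, hwa, hws⟩ :=
    exists_apply_eq_zero_one separatingRight_polarBilin_klein h.left_ne h.ne.symm
  have hφ := transvect_triple h w
  rw [h0, siegel_apply, ← QuadraticMap.polarBilin_apply_apply,
    ← QuadraticMap.polarBilin_apply_apply, hwa, hws] at hφ
  simpa [transvect_apply] using hφ.symm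

end KleinQuadric

/-! ### `H / {±1}` as the space of bivectors -/

section Coordinates

theorem Q_toA (h : H) : Q (toA h) = sqType h := rfl

theorem polar_Q_toA (h k : H) : polar Q (toA h) (toA k) = commType h k := rfl

theorem commType_eq_zero_iff {h k : H} : commType h k = 0 ↔ h * k = k * h := by
  constructor
  · intro e
    have := mat_comm h k
    rw [e, sgn_zero, one_mul] at this
    exact mat_inj this
  · intro e
    refine sgn_inj ?_
    have := mat_comm h k
    rw [← mat_mul, ← mat_mul, ← e] at this
    calc sgn (commType h k) = sgn (commType h k) * mat (h * k) * mat (h * k)⁻¹ := by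
          rw [mul_assoc, mat_mul_inv, mul_one]
      _ = sgn 0 := by rw [← this, mat_mul_inv, sgn_zero]

theorem Q_toA_eq_zero {h : H} (e : h * h = 1) : Q (toA h) = 0 :=
  if_pos (by rw [← mat_mul, e, mat_one])

/-- The map `(a, b, c) ↦ a ⊗ b ⊗ c` onto `H`. -/
def tensor : WI24 × WI24 × WI24 →* H :=
  (tensorHom.comp (WI24.subtype.prodMap (WI24.subtype.prodMap WI24.subtype))).codRestrict H
    fun w => mem_H.2 ⟨w.1, w.1.2, w.2.1, w.2.1.2, w.2.2, w.2.2.2, rfl⟩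

theorem tensor_surjective : Function.Surjective tensor := by
  rintro ⟨h, hh⟩
  obtain ⟨a, ha, b, hb, c, hc, rfl⟩ := mem_H.1 hh
  exact ⟨(⟨a, ha⟩, ⟨b, hb⟩, ⟨c, hc⟩), rfl⟩

/-- The inclusions of `WI24` into `H` as the three tensor factors. -/
def factor (i : Fin 3) : WI24 →* H :=
  tensor.comp (![MonoidHom.inl _ _, (MonoidHom.inr _ _).comp (MonoidHom.inl _ _),
    (MonoidHom.inr _ _).comp (MonoidHom.inr _ _)] i)

theorem tensor_eq_mul (w : WI24 × WI24 × WI24) :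
    tensor w = factor 0 w.1 * factor 1 w.2.1 * factor 2 w.2.2 := by
  simp [factor, ← map_mul]

theorem factor_commute {i j : Fin 3} (h : i ≠ j) (a b : WI24) :
    factor i a * factor j b = factor j b * factor i a := by
  fin_cases i <;> fin_cases j <;> first
    | exact absurd rfl h
    | simp [factor, ← map_mul]

theorem factor_injective (i : Fin 3) : Function.Injective (factor i) := by
  intro a b h
  have one : (1 : Matrix.orthogonalGroup (Fin 2) ℝ).1 ≠ 0 := orth_ne_zero 1
  have h : mat (factor i a) = mat (factor i b) := congrArg mat h
  refine Subtype.ext (Subtype.ext ?_)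
  fin_cases i
  · exact kron_right_cancel (kron_ne_zero one one) h
  · exact kron_right_cancel one (kron_left_cancel one h)
  · exact kron_left_cancel one (kron_left_cancel one h)

/-- The two generating reflections of `WI24`. -/
def generator : Fin 2 → WI24 := ![⟨refl₂, refl₂_mem⟩, ⟨refl₁, refl₁_mem⟩]

theorem generator_mul_self (j : Fin 2) : generator j * generator j = 1 := by
  refine Subtype.ext (Subtype.ext ?_)
  fin_cases j
  · change refl₂.1 * refl₂.1 = 1
    simp [refl₂, Matrix.one_fin_two]
  · change refl₁.1 * refl₁.1 = 1
    simp [refl₁, Matrix.one_fin_two]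

theorem generator_mul_ne {j k : Fin 2} (h : j ≠ k) :
    generator j * generator k ≠ generator k * generator j := by
  have refl_mul_ne : refl₂.1 * refl₁.1 ≠ refl₁.1 * refl₂.1 := by
    intro e
    have := congrFun (congrFun e 0) 1
    simp [refl₁, refl₂] at this
    norm_num at this
  intro e
  have e := congrArg (fun w => w.1.1) e
  fin_cases j <;> fin_cases k
  exacts [h rfl, refl_mul_ne e, refl_mul_ne e.symm, h rfl]

theorem closure_generator : Subgroup.closure (Set.range generator) = ⊤ := by
  have : Set.range generator = (↑) ⁻¹' {refl₁, refl₂} := by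
    rw [generator, Matrix.range_cons_cons_empty, Set.pair_comm]
    ext w
    simp only [Set.mem_preimage, Set.mem_insert_iff, Set.mem_singleton_iff, Subtype.ext_iff]
  rw [this]
  exact Subgroup.closure_closure_coe_preimage

theorem polar_factor_of_ne {i j : Fin 3} (h : i ≠ j) (a b : WI24) :
    polar Q (toA (factor i a)) (toA (factor j b)) = 0 :=
  commType_eq_zero_iff.2 (factor_commute h a b)

theorem polar_factor_generator (i : Fin 3) {j k : Fin 2} (h : j ≠ k) :
    polar Q (toA (factor i (generator j))) (toA (factor i (generator k))) = 1 :=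
  (zmod_cases _).resolve_left fun e => generator_mul_ne h <| factor_injective i <| by
    rw [map_mul, map_mul, commType_eq_zero_iff.1 e]

/-- The classes of the generators of `H`, numbered like the coordinates of bivectors. -/
noncomputable def gen (k : Fin 6) : A :=
  toA (factor (Fin.divNat (m := 3) (n := 2) k) (generator (Fin.modNat (m := 3) (n := 2) k)))

theorem Q_gen (k : Fin 6) : Q (gen k) = 0 :=
  Q_toA_eq_zero (by rw [← map_mul, generator_mul_self, map_one])

theorem polar_klein_single : ∀ k l : Fin 6, polar klein (Pi.single k 1) (Pi.single l 1) =
    if Fin.divNat (m := 3) (n := 2) k = Fin.divNat (m := 3) (n := 2) l ∧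
      Fin.modNat (m := 3) (n := 2) k ≠ Fin.modNat (m := 3) (n := 2) l then 1 else 0 := by
  simp only [polar_klein]
  decide

theorem polar_gen (k l : Fin 6) :
    polar Q (gen k) (gen l) = polar klein (Pi.single k 1) (Pi.single l 1) := by
  rw [polar_klein_single, gen, gen]
  by_cases hi : Fin.divNat (m := 3) (n := 2) k = Fin.divNat (m := 3) (n := 2) l
  · rw [← hi]
    by_cases hj : Fin.modNat (m := 3) (n := 2) k = Fin.modNat (m := 3) (n := 2) l
    · rw [hj, polar_self_eq_zero, if_neg fun h => h.2 rfl]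
    · rw [polar_factor_generator _ hj, if_pos ⟨rfl, hj⟩]
  · rw [polar_factor_of_ne hi, if_neg fun h => hi h.1]

/-- The linear map from bivectors to `H / {±1}` given by the generators of `H`. -/
noncomputable def coordMap : Biv →ₗ[ZMod 2] A := Fintype.linearCombination (ZMod 2) gen

theorem coordMap_single (k : Fin 6) : coordMap (Pi.single k 1) = gen k := by
  rw [coordMap, Fintype.linearCombination_apply_single, one_smul]

theorem polarBilin_comp_coordMap :
    Q.polarBilin.compl₁₂ coordMap coordMap = klein.polarBilin := by
  refine LinearMap.ext_basis (Pi.basisFun (ZMod 2) (Fin 6)) (Pi.basisFun (ZMod 2) (Fin 6))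
    fun k l => ?_
  rw [Pi.basisFun_apply, Pi.basisFun_apply, LinearMap.compl₁₂_apply, coordMap_single,
    coordMap_single]
  exact polar_gen k l

theorem polar_coordMap (x y : Biv) : polar Q (coordMap x) (coordMap y) = polar klein x y :=
  LinearMap.congr_fun₂ polarBilin_comp_coordMap x y

theorem Q_coordMap (x : Biv) : Q (coordMap x) = klein x := by
  have polar_add (u v : Biv) : polar (Q.comp coordMap + klein) u v = 0 := by
    have : polar (Q.comp coordMap) u v = polar klein u v := by
      rw [← polar_coordMap, polar, polar, ← map_add]
      rfl
    rw [FunLike.coe_add, QuadraticMap.polar_add, this, CharTwo.add_self_eq_zero]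
  have add_single : ∀ u ∈ Set.range (Pi.basisFun (ZMod 2) (Fin 6)),
      (Q.comp coordMap + klein) u = 0 := by
    rintro _ ⟨k, rfl⟩
    have klein_single : ∀ k, klein (Pi.single k 1) = 0 := by
      simp only [klein_apply]
      decide
    rw [_root_.add_apply, QuadraticMap.comp_apply, Pi.basisFun_apply, coordMap_single,
      Q_gen, klein_single, add_zero]
  exact add_eq_zero_iff_eq_of_zmod_two.1 <| eq_zero_of_mem_span _ add_single
    (fun u _ v _ => polar_add u v) ((Pi.basisFun (ZMod 2) (Fin 6)).mem_span x)

theorem coordMap_injective : Function.Injective coordMap := by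
  rw [injective_iff_map_eq_zero]
  refine fun x hx => separatingRight_polarBilin_klein x fun y => ?_
  rw [QuadraticMap.polarBilin_apply_apply, ← polar_coordMap, hx, QuadraticMap.polar_zero_right]

theorem toA_factor_mem_range (i : Fin 3) (a : WI24) :
    toA (factor i a) ∈ LinearMap.range coordMap := by
  have ha : a ∈ Subgroup.closure (Set.range generator) := closure_generator ▸ Subgroup.mem_top a
  induction ha using Subgroup.closure_induction with
  | mem x hx =>
    obtain ⟨j, rfl⟩ := hx
    obtain ⟨k, rfl, rfl⟩ : ∃ k, Fin.divNat (m := 3) (n := 2) k = i ∧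
        Fin.modNat (m := 3) (n := 2) k = j := by
      decide +revert
    exact ⟨_, coordMap_single k⟩
  | one =>
    rw [map_one]
    exact zero_mem (LinearMap.range coordMap)
  | mul x y _ _ hx hy =>
    rw [map_mul, toA_mul]
    exact add_mem hx hy
  | inv x _ hx =>
    rw [map_inv]
    exact neg_mem hx

theorem coordMap_surjective : Function.Surjective coordMap := by
  intro x
  obtain ⟨h, rfl⟩ := toA_surjective x
  obtain ⟨w, rfl⟩ := tensor_surjective h
  rw [tensor_eq_mul, toA_mul, toA_mul]
  exact add_mem (add_mem (toA_factor_mem_range 0 _) (toA_factor_mem_range 1 _))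
    (toA_factor_mem_range 2 _)

/-- The isometry between bivectors with the Klein form and `H / {±1}`. -/
noncomputable def coord : Biv ≃ₗ[ZMod 2] A :=
  LinearEquiv.ofBijective coordMap ⟨coordMap_injective, coordMap_surjective⟩

theorem Q_coord (x : Biv) : Q (coord x) = klein x := Q_coordMap x

theorem polar_coord (x y : Biv) : polar Q (coord x) (coord y) = polar klein x y :=
  polar_coordMap x y

theorem finrank_A : finrank (ZMod 2) A = 6 := by
  rw [← coord.finrank_eq, Module.finrank_fin_fun]

theorem natCard_A : Nat.card A = 64 := by
  rw [← Nat.card_congr coord.toEquiv]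
  simp

theorem isSingularPlane_coord {s a : Biv} :
    IsSingularPlane Q (coord s) (coord a) ↔ IsSingularPlane klein s a := by
  constructor <;> rintro ⟨h₁, h₂, h₃, h₄, h₅, h₆⟩
  · rw [Q_coord] at h₁ h₂
    rw [polar_coord] at h₃
    exact ⟨h₁, h₂, h₃, (map_ne_zero_iff _ coord.injective).1 h₄,
      (map_ne_zero_iff _ coord.injective).1 h₅, ne_of_apply_ne _ h₆⟩
  · rw [← Q_coord] at h₁ h₂
    rw [← polar_coord] at h₃
    exact ⟨h₁, h₂, h₃, (map_ne_zero_iff _ coord.injective).2 h₄,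
      (map_ne_zero_iff _ coord.injective).2 h₅, coord.injective.ne h₆⟩

theorem siegel_coord {s a : Biv} (h : IsSingularPlane klein s a) (x : Biv) :
    siegel (isSingularPlane_coord.2 h) (coord x) = coord (siegel h x) := by
  simp only [siegel_apply, map_add, map_smul, polar_coord]

end Coordinates

/-! ### Generation of `O⁺(Q)` by Siegel transformations -/

section Quadric

set_option maxRecDepth 100000 in
theorem exists_singular_polar_eq_one : ∀ {s : A}, Q s = 0 → s ≠ 0 →
    ∀ {v}, polar Q s v = 0 ∧ s ≠ v ∧ v ≠ 0 → ∃ a, Q a = 0 ∧ polar Q s a = 0 ∧ polar Q v a = 1 := by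
  simp only [coord.surjective.forall, coord.surjective.exists, Q_coord, polar_coord,
    map_ne_zero_iff _ coord.injective, coord.injective.ne_iff, klein_apply, polar_klein]
  decide +kernel

set_option maxRecDepth 100000 in
theorem exists_singular_orthogonal_pair : ∀ {s : A}, Q s = 0 → ∀ {t}, Q t = 0 → polar Q s t = 1 →
    ∃ r, Q r = 0 ∧ polar Q s r = 0 ∧ polar Q t r = 0 ∧ r ≠ 0 := by
  simp only [coord.surjective.forall, coord.surjective.exists, Q_coord, polar_coord,
    map_ne_zero_iff _ coord.injective, klein_apply, polar_klein]
  decide +kernel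

set_option maxRecDepth 100000 in
theorem exists_singular_orthogonal (v : A) : ∃ s, Q s = 0 ∧ polar Q v s = 0 ∧ s ≠ 0 ∧ s ≠ v := by
  revert v
  simp only [coord.surjective.forall, coord.surjective.exists, Q_coord, polar_coord,
    map_ne_zero_iff _ coord.injective, coord.injective.ne_iff, klein_apply, polar_klein]
  decide +kernel

set_option maxRecDepth 100000 in
theorem exists_nonsingular_orthogonal_pair : ∀ {s : A} {a : A}, Q s = Q a → polar Q s a = Q s →
    ∃ v, Q v = 1 ∧ polar Q v s = 0 ∧ polar Q v a = 0 := by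
  simp only [coord.surjective.forall, coord.surjective.exists, Q_coord, polar_coord,
    klein_apply, polar_klein]
  decide +kernel

end Quadric

section Generation

/-- A basis of bivectors on which the Klein form is `1`, ordered so that Witt's argument applies. -/
def witt : Fin 6 → Biv :=
  ![![0, 0, 0, 0, 1, 1], ![0, 0, 1, 1, 0, 1], ![0, 1, 0, 0, 1, 1], ![1, 0, 0, 1, 1, 1],
    ![0, 0, 1, 0, 1, 1], ![0, 0, 0, 1, 1, 1]]

theorem Q_coord_witt (i : Fin 6) : Q (coord (witt i)) = 1 := by
  rw [Q_coord]
  revert i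
  simp only [klein_apply]
  decide

theorem coord_witt_injective : Function.Injective (coord ∘ witt) := by
  rw [coord.injective.of_comp_iff]
  decide

theorem span_coord_witt : Submodule.span (ZMod 2) (Set.range (coord ∘ witt)) = ⊤ := by
  have mem_span : ∀ w, ∃ c : Fin 6 → ZMod 2, ∑ i, c i • witt i = w := by decide +kernel
  refine Submodule.eq_top_iff'.2 (coord.surjective.forall.2 fun w => ?_)
  obtain ⟨c, rfl⟩ := mem_span w
  rw [map_sum]
  refine Submodule.sum_mem _ fun i _ => ?_
  rw [map_smul]
  exact Submodule.smul_mem _ _ (Submodule.subset_span ⟨i, rfl⟩)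

set_option maxRecDepth 100000 in
theorem witt_cases : ∀ k v, Q v = 1 → (∀ j < k, polar Q v (coord (witt j)) =
      polar Q (coord (witt k)) (coord (witt j)) ∧ v ≠ coord (witt j)) →
    v = coord (witt k) ∨ polar Q v (coord (witt k)) = 1 ∨ ∃ u, Q u = 1 ∧
      (∀ j < k, polar Q u (coord (witt j)) = polar Q (coord (witt k)) (coord (witt j))) ∧
      polar Q v u = 1 ∧ polar Q u (coord (witt k)) = 1 := by
  simp only [coord.surjective.forall, coord.surjective.exists, Q_coord, polar_coord,
    coord.injective.eq_iff, coord.injective.ne_iff, klein_apply, polar_klein]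
  decide +kernel

theorem witt_step (k : Fin 6) (v : A) (hv : Q v = 1) (hvj : ∀ j < k, polar Q v (coord (witt j)) =
      polar Q (coord (witt k)) (coord (witt j)) ∧ v ≠ coord (witt j)) :
    ∃ h ∈ reflectionGroup Q, h v = coord (witt k) ∧
      ∀ j < k, h (coord (witt j)) = coord (witt j) := by
  rcases witt_cases k v hv hvj with rfl | hvk | ⟨u, hu, huj, hvu, huk⟩
  · exact ⟨1, one_mem _, rfl, fun _ _ => rfl⟩
  · exact ⟨_, reflect_mem_reflectionGroup (apply_add_eq_one hv (Q_coord_witt k) hvk),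
      reflect_add_apply hvk, fun j hj => reflect_add_apply_of_polar_eq (hvj j hj).1⟩
  · refine ⟨_, mul_mem (reflect_mem_reflectionGroup (apply_add_eq_one hu (Q_coord_witt k) huk))
      (reflect_mem_reflectionGroup (apply_add_eq_one hv hu hvu)), ?_, fun j hj => ?_⟩
    · rw [LinearEquiv.mul_apply, reflect_add_apply hvu, reflect_add_apply huk]
    · rw [LinearEquiv.mul_apply,
        reflect_add_apply_of_polar_eq ((hvj j hj).1.trans (huj j hj).symm),
        reflect_add_apply_of_polar_eq (huj j hj)]

theorem isometryGroup_Q_le_reflectionGroup : IsometryGroup Q ≤ reflectionGroup Q :=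
  isometryGroup_le_reflectionGroup coord_witt_injective span_coord_witt fun k v hv hvj =>
    witt_step k v (hv.trans (Q_coord_witt k)) hvj

theorem reflect_mul_reflect_mem {Γ : Subgroup (A ≃ₗ[ZMod 2] A)} (hΓ : ∀ g, IsSiegel Q g → g ∈ Γ)
    {v w : A} (hv : Q v = 1) (hw : Q w = 1) (h : polar Q v w = 0) :
    reflect Q v * reflect Q w ∈ Γ := by
  rcases eq_or_ne v w with rfl | hvw
  · rw [reflect_mul_self]
    exact one_mem Γ
  have hs : Q (v + w) = 0 := by
    rw [QuadraticMap.map_add Q, hv, hw, h, add_zero, CharTwo.add_self_eq_zero]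
  have hs0 : v + w ≠ 0 := mt add_eq_zero_iff_eq_of_zmod_two.1 hvw
  have hsv : polar Q (v + w) v = 0 := by
    rw [QuadraticMap.polar_add_left, polar_self_eq_zero, QuadraticMap.polar_comm, h, add_zero]
  obtain ⟨a, ha, hsa, hva⟩ := exists_singular_polar_eq_one hs hs0
    ⟨hsv, by simpa using ne_zero_of_eq_one hw, ne_zero_of_eq_one hv⟩
  have hvs : polar Q v (v + w) = 0 := by rw [QuadraticMap.polar_comm, hsv]
  have h₁ : IsSingularPlane Q (v + w) a := isSingularPlane_of_polar hs ha hsa hs0 hvs hva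
  have h₂ : IsSingularPlane Q (v + w) (v + a) := by
    refine isSingularPlane_of_polar hs ?_ ?_ hs0 hvs ?_
    · rw [QuadraticMap.map_add Q, hv, ha, hva, add_zero, CharTwo.add_self_eq_zero]
    · rw [QuadraticMap.polar_add_right, hsv, hsa, add_zero]
    · rw [QuadraticMap.polar_add_right, polar_self_eq_zero, hva, zero_add]
  rw [reflect_mul_reflect_eq h hsa hva h₁ h₂]
  exact mul_mem (hΓ _ (isSiegel_siegel h₁)) (hΓ _ (isSiegel_siegel h₂))

theorem specialIsometryGroup_Q_le {Γ : Subgroup (A ≃ₗ[ZMod 2] A)}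
    (hΓ : ∀ g, IsSiegel Q g → g ∈ Γ) : SpecialIsometryGroup Q Q_nondegenerate ≤ Γ := by
  refine specialIsometryGroup_le Q_nondegenerate isometryGroup_Q_le_reflectionGroup
    (fun v w hv hw => ?_) (Q_coord_witt 0)
  rcases zmod_cases (polar Q v w) with h | h
  · exact reflect_mul_reflect_mem hΓ hv hw h
  · obtain ⟨u, hu, huv, huw⟩ := exists_nonsingular_orthogonal_pair (hv.trans hw.symm)
      (h.trans hv.symm)
    have : reflect Q v * reflect Q w = reflect Q v * reflect Q u * (reflect Q u * reflect Q w) := by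
      rw [mul_assoc, ← mul_assoc (reflect Q u), reflect_mul_self, one_mul]
    rw [this]
    exact mul_mem (reflect_mul_reflect_mem hΓ hv hu ((QuadraticMap.polar_comm _ _ _).trans huv))
      (reflect_mul_reflect_mem hΓ hu hw huw)

end Generation

/-! ### Irreducibility of `H` and the kernel of the action of `N` -/

section MatrixSpan

variable {K : Type*} [Field K] {m n : Type*}

theorem span_image2_kronecker_eq_top [Finite m] [Finite n] {S : Set (Matrix m m K)}
    {T : Set (Matrix n n K)}
    (hS : Submodule.span K S = ⊤) (hT : Submodule.span K T = ⊤) :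
    Submodule.span K (Set.image2 (· ⊗ₖ ·) S T) = ⊤ := by
  have kronecker_mem (a b) : a ⊗ₖ b ∈ Submodule.span K (Set.image2 (· ⊗ₖ ·) S T) := by
    have := Submodule.apply_mem_map₂ (kroneckerBilinear (R := K) (α := K))
      (hS ▸ Submodule.mem_top : a ∈ Submodule.span K S)
      (hT ▸ Submodule.mem_top : b ∈ Submodule.span K T)
    rwa [Submodule.map₂_span_span] at this
  classical
  cases nonempty_fintype m
  cases nonempty_fintype n
  refine Submodule.eq_top_iff'.2 fun M => ?_
  rw [matrix_eq_sum_single M]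
  refine sum_mem fun i _ => sum_mem fun j _ => ?_
  have : single i j (M i j) = single i.1 j.1 (M i j) ⊗ₖ single i.2 j.2 1 := by
    rw [single_kronecker_single, mul_one]
  rw [this]
  exact kronecker_mem _ _

variable [Fintype n]

theorem exists_eq_smul_one_of_commute [DecidableEq n] {S : Set (Matrix n n K)}
    (hS : Submodule.span K S = ⊤)
    {M : Matrix n n K} (hM : ∀ X ∈ S, X * M = M * X) : ∃ c : K, M = c • 1 := by
  have span_le : Submodule.span K S ≤ Subalgebra.toSubmodule (Subalgebra.centralizer K {M}) :=
    Submodule.span_le.2 fun X hX => Set.mem_centralizer_iff.2 <| by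
      rintro _ rfl
      exact (hM X hX).symm
  obtain ⟨c, rfl⟩ := mem_range_scalar_of_commute_single fun i j _ =>
    (Set.mem_centralizer_iff.1 (span_le (hS ▸ Submodule.mem_top (x := single i j 1))) M rfl).symm
  exact ⟨c, (smul_one_eq_diagonal c).symm⟩

theorem eq_top_of_mulVec_mem {S : Set (Matrix n n K)} (hS : Submodule.span K S = ⊤)
    {U : Submodule K (n → K)} (hU : U ≠ ⊥) (h : ∀ X ∈ S, ∀ v ∈ U, X *ᵥ v ∈ U) : U = ⊤ := by
  classical
  obtain ⟨v, hv, hv0⟩ := Submodule.exists_mem_ne_zero_of_ne_bot hU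
  have span_le : Submodule.span K S ≤ U.comap ((mulVecBilin K K).flip v) :=
    Submodule.span_le.2 fun X hX => h X hX v hv
  obtain ⟨i, hi⟩ := Function.ne_iff.1 hv0
  refine Submodule.eq_top_iff'.2 fun u => ?_
  have hu : vecMulVec u (Pi.single i (v i)⁻¹) *ᵥ v ∈ U :=
    span_le (hS ▸ Submodule.mem_top (x := vecMulVec u (Pi.single i (v i)⁻¹)))
  rwa [vecMulVec_mulVec, single_dotProduct, inv_mul_cancel₀ hi, MulOpposite.op_one, one_smul]
    at hu

end MatrixSpan

section Irreducible

/-- The square matrices on which `H` acts by multiplication, indexed by triples. -/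
abbrev Mat8 : Type := Matrix (Fin 2 × Fin 2 × Fin 2) (Fin 2 × Fin 2 × Fin 2) ℝ

theorem span_WI24 :
    Submodule.span ℝ (Subtype.val '' (WI24 : Set (Matrix.orthogonalGroup (Fin 2) ℝ))) = ⊤ := by
  refine Submodule.eq_top_iff'.2 fun m => ?_
  have mem_span {w} (hw : w ∈ WI24) (c : ℝ) :
      c • w.1 ∈ Submodule.span ℝ (Subtype.val '' (WI24 : Set (Matrix.orthogonalGroup (Fin 2) ℝ))) :=
    Submodule.smul_mem _ _ (Submodule.subset_span (Set.mem_image_of_mem _ hw))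
  have : m = ((m 0 0 + m 1 1) / 2) • (1 : Matrix.orthogonalGroup (Fin 2) ℝ).1 +
      ((m 0 0 - m 1 1) / 2) • refl₁.1 + ((m 0 1 + m 1 0) / 2) • refl₂.1 +
      ((m 0 1 - m 1 0) / 2) • (refl₁ * refl₂).1 := by
    ext i j
    fin_cases i <;> fin_cases j <;> simp [refl₁, refl₂] <;> ring
  rw [this]
  exact add_mem (add_mem (add_mem (mem_span (one_mem _) _) (mem_span refl₁_mem _))
    (mem_span refl₂_mem _)) (mem_span (mul_mem refl₁_mem refl₂_mem) _)

theorem span_range_mat : Submodule.span ℝ (Set.range mat) = ⊤ := by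
  rw [← span_image2_kronecker_eq_top span_WI24 (span_image2_kronecker_eq_top span_WI24 span_WI24)]
  congr 1
  ext M
  constructor
  · rintro ⟨h, rfl⟩
    obtain ⟨w, rfl⟩ := tensor_surjective h
    exact ⟨_, ⟨_, w.1.2, rfl⟩, _, ⟨_, ⟨_, w.2.1.2, rfl⟩, _, ⟨_, w.2.2.2, rfl⟩, rfl⟩, rfl⟩
  · rintro ⟨_, ⟨a, ha, rfl⟩, _, ⟨_, ⟨b, hb, rfl⟩, _, ⟨c, hc, rfl⟩, rfl⟩, rfl⟩
    exact ⟨tensor (⟨a, ha⟩, ⟨b, hb⟩, ⟨c, hc⟩), rfl⟩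

theorem exists_eq_smul_one {M : Mat8} (hM : ∀ h : H, mat h * M = M * mat h) :
    ∃ c : ℝ, M = c • 1 :=
  exists_eq_smul_one_of_commute span_range_mat (Set.forall_mem_range.2 hM)

theorem eq_top_of_H_invariant {U : Submodule ℝ (Fin 2 × Fin 2 × Fin 2 → ℝ)} (hU : U ≠ ⊥)
    (h : ∀ k : H, ∀ v ∈ U, mat k *ᵥ v ∈ U) : U = ⊤ :=
  eq_top_of_mulVec_mem span_range_mat hU (Set.forall_mem_range.2 h)

theorem eq_one_or_neg_one_of_scalar {g : SO8} {c : ℝ} (h : g.1 = c • 1) :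
    g.1 = 1 ∨ g.1 = -1 := by
  have orthogonal : g.1 * g.1ᵀ = 1 := (Matrix.mem_orthogonalGroup_iff _ _).1
    (Matrix.mem_specialOrthogonalGroup_iff.1 g.2).1
  have entry := congrFun₂ (h ▸ orthogonal) (0, 0, 0) (0, 0, 0)
  simp only [transpose_smul, transpose_one, smul_mul_smul_comm, mul_one, Matrix.smul_apply,
    one_apply_eq, smul_eq_mul] at entry
  rcases mul_self_eq_one_iff.1 entry with rfl | rfl
  · exact Or.inl (h.trans (one_smul ℝ 1))
  · exact Or.inr (h.trans (by rw [neg_smul, one_smul]))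

end Irreducible

section Kernel

theorem toA_eq_iff {h k : H} : toA h = toA k ↔ mat k = mat h ∨ mat k = -mat h := by
  have mat_k : mat k = mat h * mat (h⁻¹ * k) := by rw [← mat_mul, mul_inv_cancel_left]
  have inv_mul_mat : mat h⁻¹ * mat h = 1 := by rw [← mat_mul, inv_mul_cancel, mat_one]
  refine (QuotientGroup.eq (s := signSubgroup)).trans ⟨?_, ?_⟩
  · rintro (e | e) <;> rw [mat_k, e] <;> simp
  · rintro (e | e)
    · exact Or.inl (by rw [mat_mul, e, inv_mul_mat])
    · exact Or.inr (by rw [mat_mul, e, mul_neg, inv_mul_mat])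

theorem toA_eq_iff_exists_sgn {h k : H} : toA h = toA k ↔ ∃ x, mat k = sgn x * mat h := by
  rw [toA_eq_iff]
  constructor
  · rintro (e | e)
    · exact ⟨0, by rw [e, sgn_zero, one_mul]⟩
    · exact ⟨1, by rw [e, sgn_one, neg_one_mul]⟩
  · rintro ⟨x, e⟩
    rcases zmod_cases x with rfl | rfl
    · exact Or.inl (by rw [e, sgn_zero, one_mul])
    · exact Or.inr (by rw [e, sgn_one, neg_one_mul])

theorem toA_eq_zero_iff {h : H} : toA h = 0 ↔ mat h = 1 ∨ mat h = -1 :=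
  eq_comm.trans (toA_eq_iff (h := 1))

theorem sgn_mul_mat_inj {x y : ZMod 2} {h : H} (e : sgn x * mat h = sgn y * mat h) : x = y := by
  apply sgn_inj
  simpa only [mul_assoc, mat_mul_inv, mul_one] using congrArg (· * mat h⁻¹) e

theorem exists_neg_one_mem : ∃ k : H, mat k = -1 := by
  obtain ⟨h, hh⟩ := toA_surjective (coord (witt 0))
  have : sqType h = 1 := by rw [← Q_toA, hh, Q_coord_witt]
  exact ⟨h * h, by rw [mat_mul, mat_sq_eq, this, sgn_one]⟩

theorem mem_H_of_mem_centralizer {g : SO8} (hg : ∀ h : H, h.1 * g = g * h.1) : g ∈ H := by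
  obtain ⟨c, hc⟩ := exists_eq_smul_one fun h => congrArg Subtype.val (hg h)
  rcases eq_one_or_neg_one_of_scalar hc with h | h
  · exact (Subtype.ext h : g = 1) ▸ one_mem H
  · obtain ⟨z, hz⟩ := exists_neg_one_mem
    exact (Subtype.ext (h.trans hz.symm) : g = z) ▸ z.2

theorem exists_commType_eq (f : A →ₗ[ZMod 2] ZMod 2) : ∃ k, ∀ h, commType k h = f (toA h) := by
  obtain ⟨k, hk⟩ := toA_surjective
    ((LinearMap.BilinForm.toDual Q.polarBilin Q_nondegenerate).symm f)
  refine ⟨k, fun h => ?_⟩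
  rw [← polar_Q_toA, hk]
  exact LinearMap.BilinForm.apply_toDual_symm_apply (hB := Q_nondegenerate) f (toA h)

theorem exists_mat_normalizer_eq_sgn_mul {n : N} (hn : conjAction n = 1) :
    ∃ f : A →ₗ[ZMod 2] ZMod 2, ∀ h,
      mat (Subgroup.normalizerMonoidHom H n h) = sgn (f (toA h)) * mat h := by
  have exists_sgn (h : H) : ∃ x, mat (Subgroup.normalizerMonoidHom H n h) = sgn x * mat h :=
    toA_eq_iff_exists_sgn.1 (by rw [← conjAction_toA, hn]; rfl)
  choose c hc using exists_sgn
  have c_mul (h k) : c (h * k) = c h + c k := by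
    refine sgn_mul_mat_inj (h := h * k) ?_
    rw [← hc, map_mul, mat_mul, mat_mul, hc, hc, sgn_add, mul_assoc, ← mul_assoc (mat h), sgn_comm]
    simp only [mul_assoc]
  have c_sign (h) (hh : h ∈ signSubgroup) : c h = 0 := by
    refine sgn_mul_mat_inj (h := h) ?_
    rw [← hc, mat_normalizer, sgn_zero, one_mul]
    have : n.1.1 * (n.1⁻¹).1 = 1 := congrArg Subtype.val (mul_inv_cancel n.1)
    rcases hh with e | e <;> simp [e, this]
  let φ : H →* Multiplicative (ZMod 2) := MonoidHom.mk' (fun h => Multiplicative.ofAdd (c h)) c_mul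
  exact ⟨(QuotientGroup.lift signSubgroup φ c_sign).toAdditiveLeft.toZModLinearMap 2, hc⟩

theorem mem_H_of_conjAction_eq_one {n : N} (hn : conjAction n = 1) : n.1 ∈ H := by
  obtain ⟨f, hf⟩ := exists_mat_normalizer_eq_sgn_mul hn
  obtain ⟨k, hk⟩ := exists_commType_eq f
  have conj_eq (h : H) : Subgroup.normalizerMonoidHom H n h = k * h * k⁻¹ := mat_inj <| by
    rw [hf, ← hk, mat_mul, mat_mul, mat_comm, mul_assoc, mul_assoc, mat_mul_inv, mul_one]
  have centralizes (h : H) : h.1 * (k.1⁻¹ * n.1) = k.1⁻¹ * n.1 * h.1 := by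
    have : n.1 * h.1 * n.1⁻¹ = k.1 * h.1 * k.1⁻¹ := congrArg Subtype.val (conj_eq h)
    rw [mul_inv_eq_iff_eq_mul] at this
    rw [mul_assoc, this]
    group
  simpa using mul_mem k.2 (mem_H_of_mem_centralizer centralizes)

theorem conjAction_eq_one_of_mem_H {n : N} (hn : n.1 ∈ H) : conjAction n = 1 := by
  refine LinearEquiv.ext <| toA_surjective.forall.2 fun h => ?_
  have : Subgroup.normalizerMonoidHom H n h = ⟨n.1, hn⟩ * h * ⟨n.1, hn⟩⁻¹ := rfl
  rw [conjAction_toA, this, toA_mul, toA_mul, add_right_comm, ← toA_mul, mul_inv_cancel]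
  exact zero_add _

theorem ker_conjAction : conjAction.ker = H.subgroupOf N :=
  Subgroup.ext fun _ => ⟨mem_H_of_conjAction_eq_one, conjAction_eq_one_of_mem_H⟩

instance : Finite N := by
  have : Finite (A ≃ₗ[ZMod 2] A) := DFunLike.finite _
  have : Finite conjAction.ker := by
    rw [ker_conjAction]
    exact Finite.of_injective (fun x : H.subgroupOf N => (⟨x.1.1, x.2⟩ : H)) fun x y e =>
      Subtype.ext (Subtype.ext (congrArg (fun z : H => z.1) e))
  have : Finite (N ⧸ conjAction.ker) :=
    Finite.of_injective _ (QuotientGroup.kerLift_injective conjAction)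
  exact Finite.of_equiv _ (Subgroup.groupEquivQuotientProdSubgroup (s := conjAction.ker)).symm

end Kernel

/-! ### Rotations in `N` act as Siegel transformations -/

section FixedSpace

variable {n : Type} [Fintype n] [DecidableEq n] {r : Matrix.specialOrthogonalGroup n ℝ}

/-- The fixed point subspace of an element of the special orthogonal group. -/
noncomputable def fixedSpace (g : Matrix.specialOrthogonalGroup n ℝ) : Submodule ℝ (n → ℝ) :=
  LinearMap.ker (Matrix.toLin' g.1 - LinearMap.id)

theorem mem_fixedSpace {v : n → ℝ} : v ∈ fixedSpace r ↔ r.1 *ᵥ v = v :=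
  sub_eq_zero

theorem IsRotation.finrank_fixedSpace (hr : IsRotation r) :
    finrank ℝ (fixedSpace r) + 2 = Fintype.card n :=
  hr

/-- The natural action of the special orthogonal group, by linear automorphisms. -/
noncomputable def linearAction :
    Matrix.specialOrthogonalGroup n ℝ →* ((n → ℝ) ≃ₗ[ℝ] (n → ℝ)) where
  toFun g := LinearEquiv.ofLinearMap (Matrix.toLin' g.1) (Matrix.toLin' (g⁻¹).1)
    (by rw [← toLin'_mul, ← toLin'_one]; exact congrArg (Matrix.toLin' ·.1) (mul_inv_cancel g))
    (by rw [← toLin'_mul, ← toLin'_one]; exact congrArg (Matrix.toLin' ·.1) (inv_mul_cancel g))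
  map_one' := LinearEquiv.ext one_mulVec
  map_mul' g h := LinearEquiv.ext fun v => (mulVec_mulVec v g.1 h.1).symm

theorem inv_mulVec_mulVec (g : Matrix.specialOrthogonalGroup n ℝ) (v : n → ℝ) :
    (g⁻¹).1 *ᵥ g.1 *ᵥ v = v :=
  (linearAction g).symm_apply_apply v

theorem IsRotation.exists_fixed_mulVec (hr : IsRotation r) (hn : 4 < Fintype.card n)
    (g : Matrix.specialOrthogonalGroup n ℝ) :
    ∃ v ≠ 0, r.1 *ᵥ v = v ∧ r.1 *ᵥ g.1 *ᵥ v = g.1 *ᵥ v := by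
  have finrank_map : finrank ℝ ((fixedSpace r).map (Matrix.toLin' g.1)) =
      finrank ℝ (fixedSpace r) := LinearEquiv.finrank_map_eq (linearAction g) (fixedSpace r)
  have dimension := Submodule.finrank_sup_add_finrank_inf_eq (fixedSpace r)
    ((fixedSpace r).map (Matrix.toLin' g.1))
  have sup_le := Submodule.finrank_le (fixedSpace r ⊔ (fixedSpace r).map (Matrix.toLin' g.1))
  rw [Module.finrank_fintype_fun_eq_card] at sup_le
  have inf_ne_bot : fixedSpace r ⊓ (fixedSpace r).map (Matrix.toLin' g.1) ≠ ⊥ := by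
    intro e
    have := hr.finrank_fixedSpace
    rw [e, finrank_bot] at dimension
    omega
  obtain ⟨_, ⟨hv, u, hu, rfl⟩, hv0⟩ := Submodule.exists_mem_ne_zero_of_ne_bot inf_ne_bot
  refine ⟨u, ?_, mem_fixedSpace.1 hu, mem_fixedSpace.1 hv⟩
  rintro rfl
  exact hv0 (map_zero _)

theorem IsRotation.ne_smul_one (hr : IsRotation r) (hn : 4 < Fintype.card n) (c : ℝ) :
    r.1 ≠ c • 1 := by
  intro e
  obtain ⟨v, hv, hrv, -⟩ := hr.exists_fixed_mulVec hn 1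
  have hc : c = 1 := by
    rw [e, smul_mulVec, one_mulVec] at hrv
    exact smul_left_injective ℝ hv (hrv.trans (one_smul ℝ v).symm)
  have fixedSpace_eq : fixedSpace r = ⊤ := Submodule.eq_top_iff'.2 fun v => by
    rw [mem_fixedSpace, e, hc, one_smul, one_mulVec]
  have := hr.finrank_fixedSpace
  rw [fixedSpace_eq, finrank_top, Module.finrank_fintype_fun_eq_card] at this
  omega

theorem IsRotation.conj (hr : IsRotation r) (g : Matrix.specialOrthogonalGroup n ℝ) :
    IsRotation (g * r * g⁻¹) := by
  have fixedSpace_conj :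
      fixedSpace (g * r * g⁻¹) = (fixedSpace r).map (linearAction g : _ →ₗ[ℝ] _) := by
    ext v
    rw [Submodule.mem_map_equiv, mem_fixedSpace, mem_fixedSpace]
    change linearAction (g * r * g⁻¹) v = v ↔ _
    rw [map_mul, map_mul, map_inv]
    exact (LinearEquiv.eq_symm_apply (linearAction g)).symm
  have := hr.finrank_fixedSpace
  rwa [← LinearEquiv.finrank_map_eq (linearAction g) (fixedSpace r), ← fixedSpace_conj] at this

end FixedSpace

section RotationSiegel

theorem IsRotation.exists_commutator_mulVec_eq {n : N} (hr : IsRotation n.1) (h : H) :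
    ∃ v ≠ 0, mat (Subgroup.normalizerMonoidHom H n h * h⁻¹) *ᵥ v = v := by
  obtain ⟨u, hu, hru, hrhu⟩ := hr.exists_fixed_mulVec (by decide) h.1
  have hinv : (n.1⁻¹).1 *ᵥ u = u := by
    nth_rewrite 1 [← hru]
    exact inv_mulVec_mulVec n.1 u
  refine ⟨mat h *ᵥ u, fun e => hu ?_, ?_⟩
  · rw [← inv_mulVec_mulVec h.1 u, e, mulVec_zero]
  · rw [mat_mul, ← mulVec_mulVec]
    change _ *ᵥ (h.1⁻¹).1 *ᵥ h.1.1 *ᵥ u = _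
    rw [inv_mulVec_mulVec, mat_normalizer, ← mulVec_mulVec, hinv, ← mulVec_mulVec, hrhu]

theorem mat_mul_self_of_mulVec_eq {k : H} {v : Fin 2 × Fin 2 × Fin 2 → ℝ} (hv : v ≠ 0)
    (h : mat k *ᵥ v = v) : mat k * mat k = 1 := by
  refine (mat_sq k).resolve_right fun e => hv (neg_eq_self.1 ?_)
  calc -v = (mat k * mat k) *ᵥ v := by rw [e, neg_mulVec, one_mulVec]
    _ = v := by rw [← mulVec_mulVec, h, h]

theorem toA_commutator (n : N) (h : H) :
    toA (Subgroup.normalizerMonoidHom H n h * h⁻¹) = conjAction n (toA h) - toA h := by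
  rw [toA_mul, ← conjAction_toA, sub_eq_add_neg]
  rfl

theorem IsRotation.Q_sub_eq_zero {n : N} (hr : IsRotation n.1) (x : A) :
    Q (conjAction n x - x) = 0 := by
  obtain ⟨h, rfl⟩ := toA_surjective x
  obtain ⟨v, hv, hv'⟩ := hr.exists_commutator_mulVec_eq h
  rw [← toA_commutator, Q_toA]
  exact if_pos (mat_mul_self_of_mulVec_eq hv hv')

theorem IsRotation.commute {n : N} (hr : IsRotation n.1) {h : H}
    (hh : conjAction n (toA h) = toA h) : mat h * n.1.1 = n.1.1 * mat h := by
  obtain ⟨v, hv, hv'⟩ := hr.exists_commutator_mulVec_eq h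
  have class_eq_zero := toA_commutator n h
  rw [hh, sub_self, toA_eq_zero_iff] at class_eq_zero
  rcases class_eq_zero with e | e
  · have fixed : n.1 * h.1 * n.1⁻¹ = h.1 := congrArg Subtype.val (mul_inv_eq_one.1 (mat_inj e))
    exact congrArg Subtype.val (mul_inv_eq_iff_eq_mul.1 fixed).symm
  · rw [e, neg_mulVec, one_mulVec, neg_eq_self] at hv'
    exact absurd hv' hv

theorem IsRotation.conjAction_ne_one {n : N} (hr : IsRotation n.1) : conjAction n ≠ 1 := by
  intro e
  obtain ⟨c, hc⟩ := exists_eq_smul_one fun h => hr.commute (h := h) (by rw [e]; rfl)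
  exact hr.ne_smul_one (by decide) c hc

theorem conjAction_mem_isometryGroup (n : N) : conjAction n ∈ IsometryGroup Q := by
  refine toA_surjective.forall.2 fun h => sgn_inj ?_
  have hn : n.1.1 * (n.1⁻¹).1 = 1 := congrArg Subtype.val (mul_inv_cancel n.1)
  rw [conjAction_toA, Q_toA, Q_toA, ← mat_sq_eq, ← mat_mul, ← map_mul, mat_normalizer, mat_mul,
    mat_sq_eq, sgn_comm, mul_assoc, hn, mul_one]

theorem IsRotation.isSiegel {n : N} (hr : IsRotation n.1) : IsSiegel Q (conjAction n) :=
  isSiegel_of_apply_sub_eq_zero Q_nondegenerate (by rw [finrank_A]; norm_num)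
    (conjAction_mem_isometryGroup n) hr.conjAction_ne_one hr.Q_sub_eq_zero

theorem mem_L_iff {g : SO8} :
    g ∈ L ↔ ∃ hg : g ∈ N, conjAction ⟨g, hg⟩ ∈ SpecialIsometryGroup Q Q_nondegenerate := by
  constructor
  · rintro ⟨n, hn, rfl⟩
    exact ⟨n.2, hn⟩
  · rintro ⟨hg, h⟩
    exact ⟨⟨g, hg⟩, h, rfl⟩

theorem L_le_N : L ≤ N := fun _ hg => (mem_L_iff.1 hg).1

theorem IsRotation.mem_L {r : SO8} (hr : IsRotation r) (hN : r ∈ N) : r ∈ L := by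
  obtain ⟨s, a, h, e⟩ := IsRotation.isSiegel (n := ⟨r, hN⟩) hr
  exact mem_L_iff.2 ⟨hN, e ▸ ⟨siegel_mem_isometryGroup h,
    dicksonInvariant_siegel Q_nondegenerate h⟩⟩

end RotationSiegel

/-! ### The rotation attached to a singular plane -/

section JointFlip

variable {R : Type*} [Ring R] [Algebra ℝ R] {a b : R}

/-- The projection onto the `1`-eigenspace of an involution `a`, along its `-1`-eigenspace. -/
noncomputable def fixProj (a : R) : R := (2⁻¹ : ℝ) • (1 + a)

theorem two_smul_fixProj (a : R) : (2 : ℝ) • fixProj a = 1 + a :=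
  smul_inv_smul₀ two_ne_zero _

theorem isIdempotentElem_fixProj (ha : a * a = 1) : IsIdempotentElem (fixProj a) := by
  have : (1 + a) * (1 + a) = (2 : ℝ) • (1 + a) := by
    rw [mul_add, mul_one, add_mul, ha, one_mul]
    module
  rw [IsIdempotentElem, fixProj, smul_mul_smul_comm, this, smul_smul]
  norm_num

theorem semiconjBy_fixProj {h a' : R} (ha : SemiconjBy h a a') :
    SemiconjBy h (fixProj a) (fixProj a') :=
  ((SemiconjBy.one_right h).add_right ha).smul_right _

/-- The involution acting as `-1` on the common `1`-eigenspace of the commuting involutions `a` and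
`b`, and as `1` on the other joint eigenspaces. -/
noncomputable def jointFlip (a b : R) : R := 1 - (2 : ℝ) • (fixProj a * fixProj b)

theorem semiconjBy_jointFlip {h a' b' : R} (ha : SemiconjBy h a a') (hb : SemiconjBy h b b') :
    SemiconjBy h (jointFlip a b) (jointFlip a' b') :=
  (SemiconjBy.one_right h).sub_right
    (((semiconjBy_fixProj ha).mul_right (semiconjBy_fixProj hb)).smul_right _)

theorem commute_fixProj (hab : Commute a b) : Commute (fixProj a) (fixProj b) :=
  semiconjBy_fixProj (semiconjBy_fixProj hab.symm).symm

theorem jointFlip_comm (hab : Commute a b) : jointFlip a b = jointFlip b a := by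
  rw [jointFlip, (commute_fixProj hab).eq, jointFlip]

theorem jointFlip_eq_neg_mul (ha : a * a = 1) : jointFlip a b = -a * jointFlip a (-b) := by
  have absorb : a * fixProj a = fixProj a := by
    rw [fixProj, mul_smul_comm, mul_add, ha, mul_one, add_comm]
  have resolve : fixProj b + fixProj (-b) = 1 := by
    rw [fixProj, fixProj]
    module
  calc jointFlip a b = 1 - (2 : ℝ) • (fixProj a * (1 - fixProj (-b))) := by
        rw [jointFlip, ← resolve, add_sub_cancel_right]
    _ = -a + (2 : ℝ) • (fixProj a * fixProj (-b)) := by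
        rw [mul_sub, mul_one, smul_sub, two_smul_fixProj]
        abel
    _ = -a * jointFlip a (-b) := by
        rw [jointFlip, mul_sub, mul_one, mul_smul_comm, ← mul_assoc, neg_mul, absorb, neg_mul,
          smul_neg, sub_neg_eq_add]

theorem one_sub_two_smul_mul_self {P : R} (hP : IsIdempotentElem P) :
    (1 - (2 : ℝ) • P) * (1 - (2 : ℝ) • P) = 1 := by
  rw [mul_sub, sub_mul, sub_mul, smul_mul_smul_comm, hP.eq, mul_one, mul_one, one_mul]
  module

theorem one_sub_add_mul_mul_self {P j : R} (hP : IsIdempotentElem P) (hj : j * j = -1)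
    (hjP : Commute j P) : (1 - P + j * P) * (1 - P + j * P) = 1 - (2 : ℝ) • P := by
  have orthogonal : (1 - P) * (j * P) = 0 := by
    rw [hjP.eq, ← mul_assoc, hP.one_sub_mul_self, zero_mul]
  have orthogonal' : j * P * (1 - P) = 0 := by rw [mul_assoc, hP.mul_one_sub_self, mul_zero]
  have square : j * P * (j * P) = -P := by
    rw [hjP.symm.mul_mul_mul_comm, hj, hP.eq, neg_one_mul]
  rw [mul_add, add_mul, add_mul, hP.one_sub.eq, orthogonal, orthogonal', square]
  module

end JointFlip

section RotationOfProjection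

variable {n : Type} [Fintype n] [DecidableEq n] {P : Matrix n n ℝ}

theorem one_sub_two_smul_mem_specialOrthogonalGroup {j : Matrix n n ℝ} (hP : IsIdempotentElem P)
    (hPt : Pᵀ = P) (hj : j * j = -1) (hjP : Commute j P) :
    1 - (2 : ℝ) • P ∈ Matrix.specialOrthogonalGroup n ℝ := by
  have involutive := one_sub_two_smul_mul_self hP
  refine Matrix.mem_specialOrthogonalGroup_iff.2 ⟨(Matrix.mem_orthogonalGroup_iff n ℝ).2 ?_, ?_⟩
  · rw [transpose_sub, transpose_one, transpose_smul, hPt, involutive]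
  · have det_nonneg : 0 ≤ (1 - (2 : ℝ) • P).det := by
      rw [← one_sub_add_mul_mul_self hP hj hjP, det_mul]
      exact mul_self_nonneg _
    have det_mul_self := congrArg Matrix.det involutive
    rw [det_mul, det_one] at det_mul_self
    rcases mul_self_eq_one_iff.1 det_mul_self with h | h <;> linarith

theorem isRotation_of_eq_one_sub_two_smul {r : Matrix.specialOrthogonalGroup n ℝ}
    (hr : r.1 = 1 - (2 : ℝ) • P) (hP : IsIdempotentElem P) (htrace : P.trace = 2) :
    IsRotation r := by
  have fixedSpace_eq : fixedSpace r = LinearMap.ker (Matrix.toLin' P) := by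
    ext v
    rw [mem_fixedSpace, hr, sub_mulVec, one_mulVec, smul_mulVec, sub_eq_self, LinearMap.mem_ker,
      toLin'_apply, smul_eq_zero_iff_right two_ne_zero]
  have idempotent : IsIdempotentElem (Matrix.toLin' P) := by
    rw [IsIdempotentElem, Module.End.mul_eq_comp, ← toLin'_mul, hP.eq]
  have finrank_range : finrank ℝ (LinearMap.range (Matrix.toLin' P)) = 2 := by
    have := (LinearMap.IsIdempotentElem.isProj_range _ idempotent).trace
    rw [trace_toLin'_eq, htrace] at this
    exact_mod_cast this.symm
  have := LinearMap.finrank_range_add_finrank_ker (Matrix.toLin' P)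
  rw [finrank_range, ← fixedSpace_eq, Module.finrank_fintype_fun_eq_card, add_comm] at this
  exact this

end RotationOfProjection

section SingularPlaneRotation

theorem transpose_eq_of_mul_self {h : H} (e : mat h * mat h = 1) : (mat h)ᵀ = mat h := by
  have orthogonal : mat h * (mat h)ᵀ = 1 := (Matrix.mem_orthogonalGroup_iff _ _).1
    (Matrix.mem_specialOrthogonalGroup_iff.1 h.1.2).1
  exact (left_inv_eq_right_inv e orthogonal).symm

theorem trace_eq_zero {h : H} (hh : toA h ≠ 0) : (mat h).trace = 0 := by
  obtain ⟨x, hx⟩ := exists_polar_eq_one Q_nondegenerate hh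
  obtain ⟨k, rfl⟩ := toA_surjective x
  rw [polar_Q_toA] at hx
  have conj_eq : mat k * mat h * mat k⁻¹ = -mat h := by
    rw [mat_comm, hx, sgn_one, neg_one_mul, neg_mul, mul_assoc, mat_mul_inv, mul_one]
  have trace_conj : (mat k * mat h * mat k⁻¹).trace = (mat h).trace := by
    rw [Matrix.trace_mul_cycle, ← mat_mul, inv_mul_cancel, mat_one, one_mul]
  rw [conj_eq, trace_neg] at trace_conj
  exact neg_eq_self.1 trace_conj

theorem commute_mat_iff {h k : H} : Commute (mat h) (mat k) ↔ polar Q (toA h) (toA k) = 0 := by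
  rw [polar_Q_toA, commType_eq_zero_iff]
  exact ⟨fun e => mat_inj e, fun e => congrArg mat e⟩

theorem exists_mat_eq_sgn_mul (x : ZMod 2) (h : H) :
    ∃ k, toA k = toA h ∧ mat k = sgn x * mat h := by
  obtain ⟨k, hk⟩ : ∃ k, mat k = sgn x * mat h := by
    obtain ⟨z, hz⟩ := exists_neg_one_mem
    rcases zmod_cases x with rfl | rfl
    · exact ⟨h, by rw [sgn_zero, one_mul]⟩
    · exact ⟨z * h, by rw [mat_mul, hz, sgn_one]⟩
  exact ⟨k, (toA_eq_iff_exists_sgn.2 ⟨x, hk⟩).symm, hk⟩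

theorem exists_jointFlip_eq_mat_mul {p : H} (hp : mat p * mat p = 1) (b : Mat8) (y : ZMod 2) :
    ∃ k : H, toA k = y • toA p ∧ jointFlip (mat p) b = mat k * jointFlip (mat p) (sgn y * b) := by
  rcases zmod_cases y with rfl | rfl
  · exact ⟨1, (zero_smul _ (toA p)).symm, by rw [mat_one, sgn_zero, one_mul, one_mul]⟩
  · obtain ⟨k, hkp, hk⟩ := exists_mat_eq_sgn_mul 1 p
    exact ⟨k, by rw [hkp, one_smul], by
      rw [hk, sgn_one, neg_one_mul, neg_one_mul, ← jointFlip_eq_neg_mul hp]⟩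

theorem exists_jointFlip_mul_mat {p q : H} (hp : mat p * mat p = 1) (hq : mat q * mat q = 1)
    (hpq : Commute (mat p) (mat q)) (h : H) :
    ∃ k : H, toA k = commType h q • toA p + commType h p • toA q ∧
      jointFlip (mat p) (mat q) * mat h = mat k * mat h * jointFlip (mat p) (mat q) := by
  obtain ⟨q', hq', mat_q'⟩ := exists_mat_eq_sgn_mul (commType h q) q
  have hq'q' : mat q' * mat q' = 1 := by
    rw [mat_sq_eq, ← Q_toA, hq', Q_toA, ← mat_sq_eq, hq]
  have hpq' : Commute (mat p) (mat q') := by rwa [commute_mat_iff, hq', ← commute_mat_iff]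
  obtain ⟨k, hk, e⟩ := exists_jointFlip_eq_mat_mul hp (mat q) (commType h q)
  obtain ⟨l, hl, f⟩ := exists_jointFlip_eq_mat_mul hq'q' (mat p) (commType h p)
  have hpq'' : Commute (sgn (commType h p) * mat p) (mat q') :=
    SemiconjBy.mul_left (sgn_comm _ _).symm hpq'
  have flip_eq : jointFlip (mat p) (mat q) =
      mat (k * l) * jointFlip (sgn (commType h p) * mat p) (sgn (commType h q) * mat q) := by
    rw [e, ← mat_q', jointFlip_comm hpq', f, jointFlip_comm hpq'', mat_mul, mul_assoc]
  have semiconj (g : H) : SemiconjBy (mat h) (mat g) (sgn (commType h g) * mat g) := by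
    rw [SemiconjBy, mat_comm, mul_assoc]
  refine ⟨k * l, by rw [toA_mul, hk, hl, hq'], ?_⟩
  conv_lhs => rw [flip_eq]
  rw [mul_assoc, mul_assoc, (semiconjBy_jointFlip (semiconj p) (semiconj q)).eq]

theorem exists_rotation_of_involutions {p q : H} (hp : mat p * mat p = 1) (hq : mat q * mat q = 1)
    (hpq : Commute (mat p) (mat q)) (hp0 : toA p ≠ 0) (hq0 : toA q ≠ 0) (hne : toA p ≠ toA q) :
    ∃ r : SO8, IsRotation r ∧ r.1 = jointFlip (mat p) (mat q) := by
  have Q_eq_zero {h : H} (e : mat h * mat h = 1) : Q (toA h) = 0 := Q_toA_eq_zero (mat_inj e)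
  obtain ⟨v, hv, hvp, hvq⟩ := exists_nonsingular_orthogonal_pair (s := toA p) (a := toA q)
    ((Q_eq_zero hp).trans (Q_eq_zero hq).symm)
    ((commute_mat_iff.1 hpq).trans (Q_eq_zero hp).symm)
  obtain ⟨j, rfl⟩ := toA_surjective v
  have hj : mat j * mat j = -1 := by rw [mat_sq_eq, ← Q_toA, hv, sgn_one]
  have idempotent := (isIdempotentElem_fixProj hp).mul_of_commute (commute_fixProj hpq)
    (isIdempotentElem_fixProj hq)
  have symmetric : (fixProj (mat p) * fixProj (mat q))ᵀ = fixProj (mat p) * fixProj (mat q) := by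
    rw [transpose_mul, (commute_fixProj hpq).eq]
    simp only [fixProj, transpose_smul, transpose_add, transpose_one, transpose_eq_of_mul_self hp,
      transpose_eq_of_mul_self hq]
  have commute : Commute (mat j) (fixProj (mat p) * fixProj (mat q)) :=
    (semiconjBy_fixProj (commute_mat_iff.2 hvp)).mul_right
      (semiconjBy_fixProj (commute_mat_iff.2 hvq))
  have trace_eq : (fixProj (mat p) * fixProj (mat q)).trace = 2 := by
    rw [fixProj, fixProj, smul_mul_smul_comm, add_mul, one_mul, mul_add, mul_one, trace_smul,
      trace_add, trace_add, trace_add, ← mat_mul, trace_eq_zero hp0, trace_eq_zero hq0,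
      trace_eq_zero (h := p * q) (fun e => hne (add_eq_zero_iff_eq_of_zmod_two.1 e)), trace_one]
    norm_num
  exact ⟨⟨_, one_sub_two_smul_mem_specialOrthogonalGroup idempotent symmetric hj commute⟩,
    isRotation_of_eq_one_sub_two_smul rfl idempotent trace_eq, rfl⟩

theorem IsSingularPlane.exists_rotation {s t : A} (hst : IsSingularPlane Q s t) :
    ∃ n : N, IsRotation n.1 ∧ conjAction n = siegel hst := by
  obtain ⟨p, rfl⟩ := toA_surjective s
  obtain ⟨q, rfl⟩ := toA_surjective t
  have hp : mat p * mat p = 1 := by rw [mat_sq_eq, ← Q_toA, hst.left, sgn_zero]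
  have hq : mat q * mat q = 1 := by rw [mat_sq_eq, ← Q_toA, hst.right, sgn_zero]
  have hpq := commute_mat_iff.2 hst.orthogonal
  obtain ⟨r, hr, r_eq⟩ := exists_rotation_of_involutions hp hq hpq hst.left_ne hst.right_ne hst.ne
  have conj_eq (h : H) : ∃ k : H, toA k = commType h q • toA p + commType h p • toA q ∧
      r * h.1 * r⁻¹ = k.1 * h.1 := by
    obtain ⟨k, hk, e⟩ := exists_jointFlip_mul_mat hp hq hpq h
    rw [← r_eq] at e
    exact ⟨k, hk, mul_inv_eq_iff_eq_mul.2 (Subtype.ext e)⟩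
  have : Finite (H : Set SO8) := inferInstanceAs (Finite H)
  have hN : r ∈ N := Subgroup.mem_normalizer_fintype fun h hh => by
    obtain ⟨k, -, e⟩ := conj_eq ⟨h, hh⟩
    exact e ▸ mul_mem k.2 hh
  refine ⟨⟨r, hN⟩, hr, LinearEquiv.ext (toA_surjective.forall.2 fun h => ?_)⟩
  obtain ⟨k, hk, e⟩ := conj_eq h
  have normalizer_eq : Subgroup.normalizerMonoidHom H ⟨r, hN⟩ h = k * h := Subtype.ext e
  rw [conjAction_toA, normalizer_eq, toA_mul, hk, siegel_apply, polar_Q_toA, polar_Q_toA, add_comm]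
  abel

end SingularPlaneRotation

/-! ### Systems of imprimitivity -/

section JointEigenspace

variable {K V ι : Type*} [Field K] [AddCommGroup V] [Module K V] {f : Module.End K V}
  {T : ι → Module.End K V}

theorem isSemisimple_of_mul_self (h2 : (2 : K) ≠ 0) (hf : f * f = 1) : f.IsSemisimple :=
  Module.End.isSemisimple_of_squarefree_aeval_eq_zero (p := Polynomial.X ^ 2 - Polynomial.C 1)
    (Polynomial.separable_X_pow_sub_C (1 : K) h2 one_ne_zero).squarefree
    (by rw [map_sub, map_pow, Polynomial.aeval_X, map_one, map_one, pow_two, hf, sub_self])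

theorem maxGenEigenspace_eq_eigenspace_of_mul_self (h2 : (2 : K) ≠ 0) (hf : f * f = 1) (μ : K) :
    f.maxGenEigenspace μ = f.eigenspace μ :=
  (isSemisimple_of_mul_self h2 hf).isFinitelySemisimple.maxGenEigenspace_eq_eigenspace μ

theorem iSup_eigenspace_of_mul_self (h2 : (2 : K) ≠ 0) (hf : f * f = 1) :
    ⨆ μ, f.eigenspace μ = ⊤ := by
  have hff (v : V) : f (f v) = v := LinearMap.congr_fun hf v
  refine Submodule.eq_top_iff'.2 fun v => (Submodule.smul_mem_iff _ h2).1 ?_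
  have decomposition : (2 : K) • v = (f v + v) + (v - f v) := by module
  rw [decomposition]
  refine add_mem (Submodule.mem_iSup_of_mem 1 ?_) (Submodule.mem_iSup_of_mem (-1) ?_) <;>
    rw [Module.End.mem_eigenspace_iff]
  · rw [map_add, hff, one_smul, add_comm]
  · rw [map_sub, hff, neg_one_smul, neg_sub]

/-- The simultaneous eigenspace of the endomorphisms `T i` with eigenvalues `χ i`. -/
def jointEigenspace (T : ι → Module.End K V) (χ : ι → K) : Submodule K V :=
  ⨅ i, (T i).eigenspace (χ i)

theorem mem_jointEigenspace {χ : ι → K} {v : V} :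
    v ∈ jointEigenspace T χ ↔ ∀ i, T i v = χ i • v := by
  simp only [jointEigenspace, Submodule.mem_iInf, Module.End.mem_eigenspace_iff]

theorem iSupIndep_jointEigenspace (hcomm : ∀ i j, Commute (T i) (T j)) :
    iSupIndep (jointEigenspace T) :=
  (Module.End.independent_iInf_maxGenEigenspace_of_forall_mapsTo T fun i j =>
    Module.End.mapsTo_maxGenEigenspace_of_comm (hcomm j i)).mono
      fun _ => iInf_mono fun _ => Module.End.genEigenspace_le_maximal _ _ 1

theorem iSup_jointEigenspace [FiniteDimensional K V] (h2 : (2 : K) ≠ 0)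
    (hsq : ∀ i, T i * T i = 1) (hcomm : ∀ i j, Commute (T i) (T j)) :
    ⨆ χ, jointEigenspace T χ = ⊤ := by
  have eigenspace_eq i μ := maxGenEigenspace_eq_eigenspace_of_mul_self h2 (hsq i) μ
  have := Module.End.iSup_iInf_maxGenEigenspace_eq_top_of_iSup_maxGenEigenspace_eq_top_of_commute T
    (fun i j _ => hcomm i j) fun i => by
      simpa only [eigenspace_eq] using iSup_eigenspace_of_mul_self h2 (hsq i)
  simpa only [jointEigenspace, eigenspace_eq] using this

theorem map_jointEigenspace (g : V ≃ₗ[K] V) (σ : ι ≃ ι) (h : ∀ i v, g (T i v) = T (σ i) (g v))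
    (χ : ι → K) :
    (jointEigenspace T χ).map (g : V →ₗ[K] V) = jointEigenspace T (χ ∘ σ.symm) := by
  ext v
  rw [Submodule.mem_map_equiv, mem_jointEigenspace, mem_jointEigenspace, σ.forall_congr_left]
  refine forall_congr' fun i => ?_
  rw [← g.injective.eq_iff, h, map_smul, g.apply_symm_apply, σ.apply_symm_apply]
  rfl

end JointEigenspace

section Imprimitive

variable {n : Type} [Fintype n] [DecidableEq n]
  {G : Subgroup (Matrix.specialOrthogonalGroup n ℝ)}

theorem isImprimitive_of_isInternal {κ : Type*} [DecidableEq κ] {E : κ → Submodule ℝ (n → ℝ)}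
    (hE : DirectSum.IsInternal E) (hproper : ∀ k, E k ≠ ⊤)
    (hG : ∀ g ∈ G, ∀ k, ∃ k', (E k).map (linearAction g : (n → ℝ) →ₗ[ℝ] (n → ℝ)) = E k') :
    IsImprimitive G := by
  classical
  have : Finite {k // E k ≠ ⊥} := WellFoundedGT.finite_ne_bot_of_iSupIndep hE.submodule_iSupIndep
  obtain ⟨l, ⟨e⟩⟩ := Finite.exists_equiv_fin {k // E k ≠ ⊥}
  refine ⟨l, fun i => E (e.symm i), ?_, fun i => ⟨(e.symm i).2, hproper _⟩, fun g hg i => ?_⟩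
  · have nonzero := DirectSum.isInternal_ne_bot_iff.2 hE
    rw [DirectSum.isInternal_submodule_iff_iSupIndep_and_iSup_eq_top] at nonzero ⊢
    exact ⟨nonzero.1.comp e.symm.injective,
      (e.symm.iSup_comp (g := fun k : {k // E k ≠ ⊥} => E k)).trans nonzero.2⟩
  · obtain ⟨k', hk'⟩ := hG g hg (e.symm i)
    have map_ne_bot : E k' ≠ ⊥ := by
      rw [← hk', Ne, Submodule.map_eq_bot_iff]
      exact (e.symm i).2
    exact ⟨e ⟨k', map_ne_bot⟩, hk'.trans (by simp only [e.symm_apply_apply])⟩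

theorem isImprimitive_of_involutions {ι : Type*} {T : ι → Matrix n n ℝ}
    (hsq : ∀ i, T i * T i = 1) (hcomm : ∀ i j, Commute (T i) (T j))
    (hscalar : ∃ i, ∀ c : ℝ, T i ≠ c • 1)
    (hG : ∀ g ∈ G, ∃ σ : ι ≃ ι, ∀ i, g.1 * T i = T (σ i) * g.1) : IsImprimitive G := by
  classical
  have hsq' i : toLin' (T i) * toLin' (T i) = 1 := by
    rw [Module.End.mul_eq_comp, ← toLin'_mul, hsq, toLin'_one]
    rfl
  have hcomm' : ∀ i j, Commute (toLin' (T i)) (toLin' (T j)) := fun i j =>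
    (hcomm i j).map (Matrix.toLinAlgEquiv' (R := ℝ))
  refine isImprimitive_of_isInternal
    (DirectSum.isInternal_submodule_of_iSupIndep_of_iSup_eq_top (iSupIndep_jointEigenspace hcomm')
      (iSup_jointEigenspace two_ne_zero hsq' hcomm')) (fun χ hχ => ?_) fun g hg χ => ?_
  · obtain ⟨i, hi⟩ := hscalar
    refine hi (χ i) (Matrix.ext_of_mulVec_single fun j => ?_)
    have mem : (Pi.single j 1 : n → ℝ) ∈ jointEigenspace (fun i => toLin' (T i)) χ :=
      hχ ▸ Submodule.mem_top
    rw [smul_mulVec, one_mulVec]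
    exact mem_jointEigenspace.1 mem i
  · obtain ⟨σ, hσ⟩ := hG g hg
    refine ⟨χ ∘ σ.symm, map_jointEigenspace _ σ (fun i v => ?_) χ⟩
    change g.1 *ᵥ T i *ᵥ v = T (σ i) *ᵥ g.1 *ᵥ v
    rw [mulVec_mulVec, hσ, mulVec_mulVec]

end Imprimitive

theorem isImprimitive_of_totallySingular {G : Subgroup SO8} (hGN : G ≤ N)
    {S : Submodule (ZMod 2) A} (hS : S ≠ ⊥) (hQ : ∀ w ∈ S, Q w = 0)
    (hG : ∀ n : N, n.1 ∈ G → ∀ w, conjAction n w ∈ S ↔ w ∈ S) : IsImprimitive G := by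
  refine isImprimitive_of_involutions (T := fun h : {h : H // toA h ∈ S} => mat h.1)
    (fun h => ?_) (fun h k => ?_) ?_ fun g hg => ?_
  · rw [mat_sq_eq, ← Q_toA, hQ _ h.2, sgn_zero]
  · refine commute_mat_iff.2 ?_
    rw [polar, hQ _ h.2, hQ _ k.2, hQ _ (add_mem h.2 k.2), sub_zero, sub_zero]
  · obtain ⟨w, hw, hw0⟩ := Submodule.exists_mem_ne_zero_of_ne_bot hS
    obtain ⟨h, rfl⟩ := toA_surjective w
    exact ⟨⟨h, hw⟩, fun c hc => hw0 (toA_eq_zero_iff.2 (eq_one_or_neg_one_of_scalar hc))⟩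
  · let n : N := ⟨g, hGN hg⟩
    have hg' : (g⁻¹).1 * g.1 = 1 := congrArg Subtype.val (inv_mul_cancel g)
    refine ⟨(Subgroup.normalizerMonoidHom H n).toEquiv.subtypeEquiv
      fun h => (hG n hg (toA h)).symm, fun h => ?_⟩
    change g.1 * mat h.1 = g.1 * mat h.1 * (g⁻¹).1 * g.1
    rw [mul_assoc _ _ g.1, hg', mul_one]

/-! ### The group `L` is a primitive rotation group -/

section SiegelInvariant

variable {U : Submodule (ZMod 2) A}

theorem span_gen : Submodule.span (ZMod 2) (Set.range gen) = ⊤ := by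
  rw [← Fintype.range_linearCombination]
  exact LinearMap.range_eq_top.2 coordMap_surjective

theorem gen_ne_zero (k : Fin 6) : gen k ≠ 0 := by
  rw [← coordMap_single, map_ne_zero_iff _ coordMap_injective, Ne, Pi.single_eq_zero_iff]
  exact one_ne_zero

theorem mem_of_siegel_mem (hU : ∀ s a (h : IsSingularPlane Q s a), ∀ x ∈ U, siegel h x ∈ U)
    {x s : A} (hx : x ∈ U) (hx0 : x ≠ 0) (hs : Q s = 0) (hs0 : s ≠ 0) (hsx : polar Q s x = 0) :
    s ∈ U := by
  rcases eq_or_ne s x with rfl | hne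
  · exact hx
  obtain ⟨a, ha, hsa, hxa⟩ := exists_singular_polar_eq_one hs hs0 ⟨hsx, hne, hx0⟩
  have hxs : polar Q x s = 0 := (QuadraticMap.polar_comm Q x s).trans hsx
  have := hU s a (isSingularPlane_of_polar hs ha hsa hs0 hxs hxa) x hx
  rw [siegel_apply, hxs, hxa, zero_smul, one_smul, zero_add] at this
  exact (Submodule.add_mem_iff_right U hx).1 this

theorem eq_top_of_siegel_mem (hU0 : U ≠ ⊥)
    (hU : ∀ s a (h : IsSingularPlane Q s a), ∀ x ∈ U, siegel h x ∈ U) : U = ⊤ := by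
  obtain ⟨x, hx, hx0⟩ := Submodule.exists_mem_ne_zero_of_ne_bot hU0
  obtain ⟨s, hs, hxs, hs0, -⟩ := exists_singular_orthogonal x
  have hsU : s ∈ U :=
    mem_of_siegel_mem hU hx hx0 hs hs0 ((QuadraticMap.polar_comm Q s x).trans hxs)
  have singular_mem (t : A) (ht : Q t = 0) (ht0 : t ≠ 0) : t ∈ U := by
    rcases zmod_cases (polar Q s t) with hst | hst
    · exact mem_of_siegel_mem hU hsU hs0 ht ht0 ((QuadraticMap.polar_comm Q t s).trans hst)
    · obtain ⟨r, hr, hsr, htr, hr0⟩ := exists_singular_orthogonal_pair hs ht hst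
      have hrU := mem_of_siegel_mem hU hsU hs0 hr hr0 ((QuadraticMap.polar_comm Q r s).trans hsr)
      exact mem_of_siegel_mem hU hrU hr0 ht ht0 htr
  rw [eq_top_iff, ← span_gen, Submodule.span_le]
  rintro _ ⟨k, rfl⟩
  exact singular_mem _ (Q_gen k) (gen_ne_zero k)

theorem exists_isSingularPlane : ∃ s a, IsSingularPlane Q s a := by
  obtain ⟨s, hs, -, hs0, -⟩ := exists_singular_orthogonal 0
  obtain ⟨a, ha, hsa, ha0, hne⟩ := exists_singular_orthogonal s
  exact ⟨s, a, hs, ha, hsa, hs0, ha0, hne.symm⟩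

theorem exists_rotation_mem_N : ∃ n : N, IsRotation n.1 := by
  obtain ⟨s, a, h⟩ := exists_isSingularPlane
  obtain ⟨n, hn, -⟩ := h.exists_rotation
  exact ⟨n, hn⟩

end SiegelInvariant

section ImageInA

variable {R : Subgroup SO8}

/-- The image of `R ∩ H` in the vector space `H / {±1}`. -/
noncomputable def imageInA (R : Subgroup SO8) : Submodule (ZMod 2) A :=
  AddSubgroup.toZModSubmodule 2
    (Subgroup.toAddSubgroup ((R.subgroupOf H).map (QuotientGroup.mk' signSubgroup)))

theorem mem_imageInA {x : A} : x ∈ imageInA R ↔ ∃ h : H, h.1 ∈ R ∧ toA h = x := Iff.rfl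

/-- `H` is extraspecial: two elements of `R` that do not commute have commutator `-1`, so `R` then
contains the kernel of `H → H / {±1}`. -/
theorem H_le_of_imageInA_eq_top (hR : imageInA R = ⊤) : H ≤ R := by
  have exists_mem (x : A) : ∃ h : H, h.1 ∈ R ∧ toA h = x :=
    mem_imageInA.1 (hR ▸ Submodule.mem_top)
  obtain ⟨z, hz⟩ := exists_neg_one_mem
  have hzR : z.1 ∈ R := by
    obtain ⟨y, hy⟩ := exists_polar_eq_one Q_nondegenerate (gen_ne_zero 0)
    obtain ⟨h, hh, eh⟩ := exists_mem y
    obtain ⟨k, hk, ek⟩ := exists_mem (gen 0)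
    have commutator_eq : z * (k * h) = h * k := mat_inj (by
      rw [mat_mul, hz, mat_mul, mat_mul, mat_comm h k, ← polar_Q_toA, eh, ek, hy, sgn_one])
    rw [eq_mul_inv_of_mul_eq commutator_eq]
    exact mul_mem (mul_mem hh hk) (inv_mem (mul_mem hk hh))
  suffices ∀ g : H, g.1 ∈ R from fun g hg => this ⟨g, hg⟩
  intro g
  obtain ⟨k, hk, e⟩ := exists_mem (toA g)
  rcases toA_eq_iff.1 e with e | e
  · exact mat_inj e ▸ hk
  · have : g = z * k := mat_inj (by rw [mat_mul, hz, e, neg_mul, one_mul])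
    exact this ▸ mul_mem hzR hk

theorem H_le_of_conj_mem (hR0 : imageInA R ≠ ⊥)
    (hR : ∀ n : N, IsRotation n.1 → ∀ h ∈ R, n.1 * h * n.1⁻¹ ∈ R) : H ≤ R := by
  refine H_le_of_imageInA_eq_top (eq_top_of_siegel_mem hR0 fun s a hsa x hx => ?_)
  obtain ⟨h, hh, rfl⟩ := mem_imageInA.1 hx
  obtain ⟨n, hn, e⟩ := hsa.exists_rotation
  exact mem_imageInA.2 ⟨Subgroup.normalizerMonoidHom H n h, hR n hn h.1 hh,
    (conjAction_toA n h).symm.trans (by rw [e])⟩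

end ImageInA

theorem H_le_N : H ≤ N := Subgroup.le_normalizer

theorem H_le_L : H ≤ L := fun h hh => mem_L_iff.2 ⟨H_le_N hh, by
  rw [conjAction_eq_one_of_mem_H (n := ⟨h, H_le_N hh⟩) hh]
  exact one_mem _⟩

theorem H_lt_L : H < L := by
  obtain ⟨n, hn⟩ := exists_rotation_mem_N
  exact lt_of_le_of_ne H_le_L fun e =>
    hn.conjAction_ne_one (conjAction_eq_one_of_mem_H (e ▸ hn.mem_L n.2))

theorem L_le_of_isSiegel {G : Subgroup SO8} (hG : H ≤ G)
    (h : ∀ g, IsSiegel Q g → ∃ n : N, n.1 ∈ G ∧ conjAction n = g) : L ≤ G := by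
  have ker_le : conjAction.ker ≤ G.subgroupOf N := by
    rw [ker_conjAction]
    exact Subgroup.comap_mono hG
  refine Subgroup.map_le_iff_le_comap.2 ?_
  change _ ≤ G.subgroupOf N
  rw [← Subgroup.comap_map_eq_self ker_le]
  exact Subgroup.comap_mono (specialIsometryGroup_Q_le h)

theorem closure_isRotation_L : Subgroup.closure {g | g ∈ L ∧ IsRotation g} = L := by
  refine le_antisymm ((Subgroup.closure_le _).2 fun g hg => hg.1) ?_
  have rotation_mem {n : N} (hn : IsRotation n.1) :
      n.1 ∈ Subgroup.closure {g | g ∈ L ∧ IsRotation g} :=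
    Subgroup.subset_closure ⟨hn.mem_L n.2, hn⟩
  have commutator_mem {n : N} (hn : IsRotation n.1) (h : H) :
      n.1 * h.1 * n.1⁻¹ * h.1⁻¹ ∈ Subgroup.closure {g | g ∈ L ∧ IsRotation g} := by
    have conj_mem : h.1 * n.1 * h.1⁻¹ ∈ Subgroup.closure {g | g ∈ L ∧ IsRotation g} :=
      rotation_mem (n := ⟨_, mul_mem (mul_mem (H_le_N h.2) n.2) (inv_mem (H_le_N h.2))⟩)
        (hn.conj h.1)
    have commutator_eq : n.1 * h.1 * n.1⁻¹ * h.1⁻¹ = n.1 * (h.1 * n.1 * h.1⁻¹)⁻¹ := by group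
    exact commutator_eq ▸ mul_mem (rotation_mem hn) (inv_mem conj_mem)
  refine L_le_of_isSiegel (H_le_of_conj_mem ?_ fun n hn h hh =>
    mul_mem (mul_mem (rotation_mem hn) hh) (inv_mem (rotation_mem hn))) ?_
  · obtain ⟨n, hn⟩ := exists_rotation_mem_N
    refine fun e => hn.conjAction_ne_one (LinearEquiv.ext (toA_surjective.forall.2 fun h => ?_))
    have := mem_imageInA.2 ⟨_, commutator_mem hn h, toA_commutator n h⟩
    rw [e] at this
    exact sub_eq_zero.1 ((Submodule.mem_bot _).1 this)
  · rintro g ⟨s, a, h, rfl⟩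
    obtain ⟨n, hn, e⟩ := h.exists_rotation
    exact ⟨n, rotation_mem hn, e⟩

theorem isRotationGroup_L : IsRotationGroup L :=
  ⟨Finite.of_injective (Subgroup.inclusion L_le_N) (Subgroup.inclusion_injective L_le_N),
    closure_isRotation_L⟩

section Blocks

open scoped Pointwise

variable {ι : Type*} {V : ι → Submodule ℝ (Fin 2 × Fin 2 × Fin 2 → ℝ)}

theorem iSup_smul_eq_top {U : Submodule ℝ (Fin 2 × Fin 2 × Fin 2 → ℝ)} (hU : U ≠ ⊥) :
    ⨆ h : H, linearAction h.1 • U = ⊤ := by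
  refine eq_top_of_H_invariant (ne_bot_of_le_ne_bot hU ?_) fun k v hv => ?_
  · exact le_iSup_of_le 1 (by rw [OneMemClass.coe_one, map_one, one_smul])
  · have smul_le : linearAction k.1 • (⨆ h : H, linearAction h.1 • U) ≤
        ⨆ h : H, linearAction h.1 • U := by
      rw [Submodule.smul_iSup']
      refine iSup_le fun h => le_iSup_of_le (k * h) ?_
      rw [Subgroup.coe_mul, map_mul, mul_smul]
    exact smul_le (Submodule.smul_mem_pointwise_smul v (linearAction k.1) _ hv)

theorem exists_smul_eq (hind : iSupIndep V) (hV : ∀ i, V i ≠ ⊥)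
    (hperm : ∀ h : H, ∀ i, ∃ j, linearAction h.1 • V i = V j) (i j : ι) :
    ∃ h : H, linearAction h.1 • V i = V j := by
  by_contra! hj
  have le_others : ⨆ h : H, linearAction h.1 • V i ≤ ⨆ k ≠ j, V k := by
    refine iSup_le fun h => ?_
    obtain ⟨k, hk⟩ := hperm h i
    exact hk ▸ le_iSup₂_of_le k (fun e => hj h (e ▸ hk)) le_rfl
  rw [iSup_smul_eq_top (hV i), top_le_iff] at le_others
  exact hV j (disjoint_top.1 (le_others ▸ hind j))

theorem smul_eq_smul_of_toA_eq {h k : H} (e : toA h = toA k)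
    (S : Submodule ℝ (Fin 2 × Fin 2 × Fin 2 → ℝ)) :
    linearAction h.1 • S = linearAction k.1 • S := by
  change S.map (toLin' (mat h)) = S.map (toLin' (mat k))
  rcases toA_eq_iff.1 e with e | e <;> rw [e]
  rw [map_neg, Submodule.map_neg]

theorem exists_smul_eq_self [Finite ι] (hcard : Nat.card ι < 64)
    (hperm : ∀ h : H, ∀ i, ∃ j, linearAction h.1 • V i = V j) (i : ι) :
    ∃ u : H, toA u ≠ 0 ∧ linearAction u.1 • V i = V i := by
  choose lift hlift using toA_surjective
  choose f hf using fun x => hperm (lift x) i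
  have not_injective : ¬ Function.Injective f := fun hinj =>
    hcard.not_ge (natCard_A ▸ Nat.card_le_card_of_injective f hinj)
  obtain ⟨x, y, hfxy, hxy⟩ := Function.not_injective_iff.1 not_injective
  refine ⟨(lift y)⁻¹ * lift x, fun h0 => hxy ?_, ?_⟩
  · rw [← hlift x, ← mul_inv_cancel_left (lift y) (lift x), toA_mul, h0, add_zero, hlift]
  · rw [Subgroup.coe_mul, Subgroup.coe_inv, map_mul, map_inv, mul_smul, inv_smul_eq_iff, hf, hf,
      hfxy]

/-- The elements carrying each of the subspaces `V i` onto itself. -/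
noncomputable def blockStabilizer (V : ι → Submodule ℝ (Fin 2 × Fin 2 × Fin 2 → ℝ)) :
    Subgroup SO8 :=
  ⨅ i, (MulAction.stabilizer _ (V i)).comap linearAction

theorem mem_blockStabilizer {g : SO8} :
    g ∈ blockStabilizer V ↔ ∀ i, linearAction g • V i = V i := by
  simp only [blockStabilizer, Subgroup.mem_iInf, Subgroup.mem_comap, MulAction.mem_stabilizer_iff]

theorem conj_mem_blockStabilizer {g h : SO8} (hg : ∀ i, ∃ j, linearAction g⁻¹ • V i = V j)
    (hh : h ∈ blockStabilizer V) : g * h * g⁻¹ ∈ blockStabilizer V := by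
  refine mem_blockStabilizer.2 fun i => ?_
  obtain ⟨j, hj⟩ := hg i
  rw [map_mul, map_mul, mul_smul, mul_smul, hj, mem_blockStabilizer.1 hh j, ← hj, map_inv,
    smul_inv_smul]

/-- Elements of `H` commute up to sign and signs fix every subspace, so an element of `H` fixing
one block fixes the whole `H`-orbit of that block. -/
theorem mem_blockStabilizer_of_smul_eq {u : H} {i : ι}
    (htrans : ∀ j, ∃ h : H, linearAction h.1 • V i = V j) (hu : linearAction u.1 • V i = V i) :
    u.1 ∈ blockStabilizer V := by
  refine mem_blockStabilizer.2 fun j => ?_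
  obtain ⟨h, hh⟩ := htrans j
  have commute : toA (u * h) = toA (h * u) := by rw [toA_mul, toA_mul, add_comm]
  calc linearAction u.1 • V j = linearAction (u * h).1 • V i := by
        rw [← hh, Subgroup.coe_mul, map_mul, mul_smul]
    _ = linearAction (h * u).1 • V i := smul_eq_smul_of_toA_eq commute (V i)
    _ = V j := by rw [Subgroup.coe_mul, map_mul, mul_smul, hu, hh]

theorem imageInA_blockStabilizer_ne_bot [Finite ι] [Nonempty ι] (hind : iSupIndep V)
    (hV : ∀ i, V i ≠ ⊥) (hperm : ∀ h : H, ∀ i, ∃ j, linearAction h.1 • V i = V j) :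
    imageInA (blockStabilizer V) ≠ ⊥ := by
  have hcard : Nat.card ι < 64 := by
    have := Fintype.ofFinite ι
    have card_le := hind.subtype_ne_bot_le_finrank
    rw [Fintype.card_congr (Equiv.subtypeUnivEquiv hV),
      Module.finrank_fintype_fun_eq_card] at card_le
    rw [Nat.card_eq_fintype_card]
    exact card_le.trans_lt (by decide)
  obtain ⟨i⟩ := ‹Nonempty ι›
  obtain ⟨u, hu0, hu⟩ := exists_smul_eq_self hcard hperm i
  exact fun e => hu0 ((Submodule.mem_bot _).1 (e ▸ mem_imageInA.2
    ⟨u, mem_blockStabilizer_of_smul_eq (exists_smul_eq hind hV hperm i) hu, rfl⟩))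

theorem isPrimitive_L : IsPrimitive L := by
  rintro ⟨l, V, hV, hne, hperm⟩
  have hperm_N (n : N) (hn : IsRotation n.1) (i : Fin l) :
      ∃ j, linearAction n.1⁻¹ • V i = V j := hperm _ (inv_mem (hn.mem_L n.2)) i
  rw [DirectSum.isInternal_submodule_iff_iSupIndep_and_iSup_eq_top] at hV
  have : Nonempty (Fin l) := by
    by_contra h
    rw [not_nonempty_iff] at h
    exact bot_ne_top ((iSup_of_empty V).symm.trans hV.2)
  have H_le : H ≤ blockStabilizer V := H_le_of_conj_mem
    (imageInA_blockStabilizer_ne_bot hV.1 (fun i => (hne i).1)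
      fun h => hperm h.1 (H_le_L h.2))
    fun n hn _ => conj_mem_blockStabilizer (hperm_N n hn)
  obtain ⟨i⟩ := this
  refine (hne i).2 (eq_top_of_H_invariant (hne i).1 fun h v hv => ?_)
  rw [← mem_blockStabilizer.1 (H_le h.2) i]
  exact Submodule.smul_mem_pointwise_smul v (linearAction h.1) _ hv

end Blocks

/-! ### Primitive rotation groups between `H` and `N` -/

section Classification

open scoped Pointwise

variable {G : Subgroup SO8}

/-- Some element of `G` acts on `H / {±1}`, identified with the space of bivectors, as the
transvection with center `p` and axis `φ`. -/
def InducesTransvection (G : Subgroup SO8) (p φ : Vec) : Prop :=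
  p ≠ 0 ∧ φ ≠ 0 ∧ φ ⬝ᵥ p = 0 ∧
    ∃ n : N, n.1 ∈ G ∧ ∀ x, conjAction n (coord x) = coord (transvect p φ x)

theorem isTransvectionSet_inducesTransvection (G : Subgroup SO8) :
    IsTransvectionSet (InducesTransvection G) where
  center_ne h := h.1
  axis_ne h := h.2.1
  flag h := h.2.2.1
  add := by
    rintro p φ ψ ⟨hp, -, hφp, m, hm, hm'⟩ ⟨-, -, hψp, n, hn, hn'⟩ hne
    refine ⟨hp, add_eq_zero_iff_eq_of_zmod_two.not.2 hne,
      by rw [add_dotProduct, hφp, hψp, add_zero], m * n, mul_mem hm hn, fun x => ?_⟩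
    rw [map_mul, LinearEquiv.mul_apply, hn', hm', transvect_transvect hφp]
  conj := by
    rintro p φ q ψ ⟨-, -, hψq, n, hn, hn'⟩ ⟨hp, hφ, hφp, m, hm, hm'⟩
    have hqψ : q ⬝ᵥ ψ = 0 := (dotProduct_comm q ψ).trans hψq
    refine ⟨(shear_injective hψq).ne_iff' (shear_zero q ψ) |>.2 hp,
      (shear_injective hqψ).ne_iff' (shear_zero ψ q) |>.2 hφ,
      (shear_dotProduct_shear hψq φ p).trans hφp, n * m * n, mul_mem (mul_mem hn hm) hn,
      fun x => ?_⟩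
    rw [map_mul, map_mul, LinearEquiv.mul_apply, LinearEquiv.mul_apply, hn', hm', hn',
      transvect_conj hψq, transvect_involutive hψq]

theorem exists_transvect_of_isSiegel {g : A ≃ₗ[ZMod 2] A} (hg : IsSiegel Q g) :
    ∃ p φ : Vec, p ≠ 0 ∧ φ ≠ 0 ∧ φ ⬝ᵥ p = 0 ∧ ∀ x, g (coord x) = coord (transvect p φ x) := by
  obtain ⟨s, a, h, rfl⟩ := hg
  obtain ⟨s, rfl⟩ := coord.surjective s
  obtain ⟨a, rfl⟩ := coord.surjective a
  obtain ⟨p, φ, hp, hφ, hφp, e⟩ := exists_transvect_eq_siegel (isSingularPlane_coord.1 h)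
  exact ⟨p, φ, hp, hφ, hφp, fun x => by rw [siegel_coord, e]⟩

theorem IsRotation.exists_inducesTransvection {n : N} (hr : IsRotation n.1) (hn : n.1 ∈ G) :
    ∃ p φ, InducesTransvection G p φ ∧ ∀ x, conjAction n (coord x) = coord (transvect p φ x) := by
  obtain ⟨p, φ, hp, hφ, hφp, e⟩ := exists_transvect_of_isSiegel hr.isSiegel
  exact ⟨p, φ, ⟨hp, hφ, hφp, n, hn, e⟩, e⟩

theorem isImprimitive_of_hasSingularInvariant (hrot : IsRotationGroup G) (hGN : G ≤ N)
    (h : HasSingularInvariant (InducesTransvection G)) : IsImprimitive G := by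
  obtain ⟨S, hS, hklein, hinv⟩ := h
  let S' : Submodule (ZMod 2) A := S.map (coord : Biv →ₗ[ZMod 2] A)
  have G_le : G ≤
      ((MulAction.stabilizer (A ≃ₗ[ZMod 2] A) (S' : Set A)).comap conjAction).map N.subtype := by
    rw [← hrot.2, Subgroup.closure_le]
    rintro r ⟨hrG, hr⟩
    obtain ⟨p, φ, hT, e⟩ := IsRotation.exists_inducesTransvection (n := ⟨r, hGN hrG⟩) hr hrG
    refine ⟨⟨r, hGN hrG⟩, MulAction.mem_stabilizer_set.2 (coord.surjective.forall.2 fun w => ?_),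
      rfl⟩
    rw [LinearEquiv.smul_def, e]
    simp only [S', SetLike.mem_coe, Submodule.mem_map_equiv, LinearEquiv.symm_apply_apply]
    refine ⟨fun hw => ?_, hinv p φ hT w⟩
    rw [← transvect_involutive hT.2.2.1 w]
    exact hinv p φ hT _ hw
  refine isImprimitive_of_totallySingular hGN (S := S') ?_ ?_ fun n hn => ?_
  · rwa [Ne, Submodule.map_eq_bot_iff]
  · rintro _ ⟨w, hw, rfl⟩
    exact (Q_coord w).trans (hklein w hw)
  · obtain ⟨m, hm, e⟩ := G_le hn
    exact Subtype.ext e ▸ MulAction.mem_stabilizer_set.1 hm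

theorem eq_zero_of_transvect_fixed (hrot : IsRotationGroup G) (hHG : H ≤ G) (hGN : G ≤ N) {w : Biv}
    (hw : ∀ p φ, InducesTransvection G p φ → transvect p φ w = w) : w = 0 := by
  obtain ⟨k, hk⟩ := toA_surjective (coord w)
  have G_le : G ≤ Subgroup.centralizer {k.1} := by
    rw [← hrot.2, Subgroup.closure_le]
    rintro r ⟨hrG, hr⟩
    obtain ⟨p, φ, hT, e⟩ := IsRotation.exists_inducesTransvection (n := ⟨r, hGN hrG⟩) hr hrG
    exact Subgroup.mem_centralizer_singleton_iff.2 <| Subtype.ext <|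
      IsRotation.commute (n := ⟨r, hGN hrG⟩) (h := k) hr (by rw [hk, e, hw p φ hT]) |>.symm
  have k_central : k ∈ signSubgroup := H_central fun g => congrArg Subtype.val
    (Subgroup.mem_centralizer_singleton_iff.1 (G_le (hHG g.2))).symm
  rw [← map_eq_zero_iff coord coord.injective, ← hk]
  exact toA_eq_zero_iff.2 k_central

theorem exists_inducesTransvection (hrot : IsRotationGroup G) (hHG : H ≤ G) (hGN : G ≤ N) :
    ∃ p φ, InducesTransvection G p φ := by
  by_contra! h
  exact one_ne_zero (α := Biv)
    (eq_zero_of_transvect_fixed hrot hHG hGN fun p φ hT => absurd hT (h p φ))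

theorem le_L_of_isRotationGroup (hrot : IsRotationGroup G) (hGN : G ≤ N) : G ≤ L := by
  rw [← hrot.2, Subgroup.closure_le]
  exact fun r hr => hr.2.mem_L (hGN hr.1)

theorem eq_L_of_isPrimitive (hrot : IsRotationGroup G) (hprim : IsPrimitive G) (hHG : H ≤ G)
    (hGN : G ≤ N) : G = L := by
  refine le_antisymm (le_L_of_isRotationGroup hrot hGN) ?_
  obtain ⟨p₀, φ₀, h₀⟩ := exists_inducesTransvection hrot hHG hGN
  rcases (isTransvectionSet_inducesTransvection G).trichotomy h₀ with h | h | ⟨w, hw, h⟩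
  · refine L_le_of_isSiegel hHG fun g hg => ?_
    obtain ⟨p, φ, hp, hφ, hφp, e⟩ := exists_transvect_of_isSiegel hg
    obtain ⟨-, -, -, n, hn, e'⟩ := h p φ hp hφ hφp
    exact ⟨n, hn, LinearEquiv.ext (coord.surjective.forall.2 fun x => (e' x).trans (e x).symm)⟩
  · exact absurd (isImprimitive_of_hasSingularInvariant hrot hGN h) hprim
  · exact absurd (eq_zero_of_transvect_fixed hrot hHG hGN h) hw

end Classification

end RotationGroup

theorem lemma4p19 (G : Subgroup RotationGroup.SO8) :
    (RotationGroup.IsRotationGroup G ∧ RotationGroup.IsPrimitive G ∧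
      RotationGroup.H < G ∧ G ≤ RotationGroup.N) ↔ G = RotationGroup.L := by
  constructor
  · rintro ⟨hrot, hprim, hHG, hGN⟩
    exact RotationGroup.eq_L_of_isPrimitive hrot hprim hHG.le hGN
  · rintro rfl
    exact ⟨RotationGroup.isRotationGroup_L, RotationGroup.isPrimitive_L, RotationGroup.H_lt_L,
      RotationGroup.L_le_N⟩
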